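/- Let $\Gamma$ be a compact metric graph: finitely many vertices $\mathcal V$ and finitely many oriented edges $e$ (loops and multiple edges allowed), each identified with an interval $[0,\ell_e]$, $\ell_e>0$, the orientation being such that every vertex of degree two has one ingoing and one outgoing edge (the degree counts edge ends). Let $H^2(\Gamma)=\bigoplus_e H^2([0,\ell_e])$. Fix $s\in\mathbb R\cup\{\infty\}$ and $\alpha\in[0,\pi)$ with $s=\cot\alpha$ ($\alpha=0$ if $s=\infty$). Let $B\subset\mathcal V$ be a set of vertices of degree one or two. For $v\in B$ write $f_1(v),f_1'(v)$ (resp. $f_2(v),f_2'(v)$) for the value and the derivative, in the direction of the edge, of $f\in H^2(\Gamma)$ at $v$ along the edge entering (resp. leaving) $v$, and put $$\gamma_i^s(f)=\cos\alpha\, f_i-\sin\alpha\, f_i',\qquad \gamma_i^{s\star}(f)=\sin\alpha\, f_i+\cos\alpha\, f_i' ;$$ if $v$ has degree one and only the trace with index $i$ exists, then $\gamma_j^s:=\gamma_i^s$ and $\gamma_j^{s\star}:=0$ for the other index $j$. The $\delta_s$ family placed on $B$ is the family of operators $H^s(t)=-\frac{d^2}{dx^2}$ in $L^2(\Gamma)$,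 $t\in\mathbb R\cup\{\infty\}$, whose domain consists of the $f\in H^2(\Gamma)$ that satisfy the Neumann–Kirchhoff condition (continuity, and outgoing derivatives summing to $0$) at the vertices outside $B$ and, at each $v\in B$, $$\gamma_1^s(f)=\gamma_2^s(f),\qquad \gamma_2^{s\star}(f)-\gamma_1^{s\star}(f)=t\,\gamma_1^s(f)\quad(t\in\mathbb R),\qquad\text{resp.}\quad \gamma_1^s(f)=\gamma_2^s(f)=0\quad(t=\infty).$$ Put $H^s(-\infty):=H^s(\infty)$. For $c\in\mathbb R$, the spectral flow through $c$ over $[-\infty,\infty]$ is $$\mathrm{Sf}_c^{\delta_s}[-\infty,\infty]=\sum_{l=1}^{N}\ \sum_{a_l\le\mu<c}\bigl(\dim\ker(H^s(t_{l-1})-\mu)-\dim\ker(H^s(t_l)-\mu)\bigr),$$ where $-\infty=t_0<t_1<\dots<t_N=\infty$ and $a_l<c<b_l$ are such that $a_l,b_l\notin\operatorname{spec}H^s(t)$ for all $t\in[t_{l-1},t_l]$, $1\le l\le N$. 1. For every real $c\notin\operatorname{spec}H^s(\infty)$, such $t_l,a_l,b_l$ exist, the sum does not depend on their choice, and $$\mathrm{Sf}_c^{\delta_s}[-\infty,\infty]=|B|.$$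 2. In particular, let $f$ be an eigenfunction of the Neumann–Kirchhoff Laplacian on $\Gamma$ whose set of $s$-points is finite; the $s$-points are the interior points of edges and the vertices of degree one or two at which $f'=sf$, derivatives being taken in the direction of the edges ($f=0$ if $s=\infty$). Turn the $s$-points in the interior of edges into vertices of degree two and place the $\delta_s$ family on the set of all $s$-points of $f$. Then for every real $c\notin\operatorname{spec}H^s(\infty)$ the spectral flow is, in the same sense, well defined and $$\mathrm{Sf}_c^{\delta_s}[-\infty,\infty]=\phi_s(f),$$ where $\phi_s(f)$ is the number of $s$-points of $f$. -/

import Mathlib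

open MeasureTheory Set
open scoped OnePoint

/-! ## Unbounded operators: spectrum, kernels, spectral flow -/

namespace UnboundedOp

variable {X : Type*} [NormedAddCommGroup X] [NormedSpace ℂ X]

/-- `z` is in the resolvent set of `T` if `T - z : dom T → X` has an everywhere defined bounded
two-sided inverse `R`. -/
def IsResolventPoint (T : X →ₗ.[ℂ] X) (z : ℂ) : Prop :=
  ∃ R : X →L[ℂ] X,
    (∀ w : X, ∃ h : R w ∈ T.domain, T ⟨R w, h⟩ - z • R w = w) ∧
    ∀ u : T.domain, R (T u - z • (u : X)) = u

/-- The spectrum of a (partially defined) operator. -/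
def spec (T : X →ₗ.[ℂ] X) : Set ℂ := {z | ¬ IsResolventPoint T z}

/-- `dim ker (T - z)`. -/
noncomputable def dimKer (T : X →ₗ.[ℂ] X) (z : ℂ) : ℕ :=
  Module.finrank ℂ (LinearMap.ker (T.toFun - z • T.domain.subtype))

/-- The data used to compute the spectral flow through `lam` of a family `H` over the interval
`[p, q]` of extended reals: a partition `p = t₀ < t₁ < ⋯ < t_N = q` and, for each of its `N` pieces,
a window `[lo, hi]` around `lam` whose endpoints are not in the spectrum of `H τ` for any `τ`
in that piece. -/
structure FlowPartition (H : EReal → (X →ₗ.[ℂ] X)) (p q : EReal) (lam : ℝ) where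
  N : ℕ
  t : Fin (N + 1) → EReal
  strictMono : StrictMono t
  first : t 0 = p
  last : t (Fin.last N) = q
  lo : Fin N → ℝ
  hi : Fin N → ℝ
  lo_lt : ∀ l, lo l < lam
  lt_hi : ∀ l, lam < hi l
  lo_notMem : ∀ l, ∀ τ ∈ Icc (t l.castSucc) (t l.succ), (lo l : ℂ) ∉ spec (H τ)
  hi_notMem : ∀ l, ∀ τ ∈ Icc (t l.castSucc) (t l.succ), (hi l : ℂ) ∉ spec (H τ)

/-- The sum computing the spectral flow from given partition data. -/
noncomputable def FlowPartition.flow {H : EReal → (X →ₗ.[ℂ] X)} {p q : EReal} {lam : ℝ}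
    (π : FlowPartition H p q lam) : ℤ :=
  ∑ l : Fin π.N, ∑ᶠ α ∈ Ico (π.lo l) lam,
    ((dimKer (H (π.t l.castSucc)) (α : ℂ) : ℤ) - (dimKer (H (π.t l.succ)) (α : ℂ) : ℤ))

/-- The spectral flow of `H` through `lam` over `[p, q]` is well defined and equal to `n`:
partition data exist, and each choice of them computes `n`. -/
def HasSpectralFlow (H : EReal → (X →ₗ.[ℂ] X)) (p q : EReal) (lam : ℝ) (n : ℤ) : Prop :=
  Nonempty (FlowPartition H p q lam) ∧ ∀ π : FlowPartition H p q lam, π.flow = n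

end UnboundedOp

/-! ## Metric graphs -/

/-- A metric graph with vertex set `V`, edge set `E`, oriented edges (loops and multiple edges are
allowed) and positive edge lengths; the edge `e` is the interval `[0, len e]`, with `0` at `src e`
and `len e` at `tgt e`. -/
structure MetricGraph (V E : Type*) where
  src : E → V
  tgt : E → V
  len : E → ℝ
  len_pos : ∀ e, 0 < len e

namespace MetricGraph

variable {V E : Type*}

/-- Number of edges ending at `v`. -/
noncomputable def inDeg (Γ : MetricGraph V E) (v : V) : ℕ := {e | Γ.tgt e = v}.ncard

/-- Number of edges starting at `v`. -/
noncomputable def outDeg (Γ : MetricGraph V E) (v : V) : ℕ := {e | Γ.src e = v}.ncard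

/-- Degree: number of edge ends at `v` (a loop counts twice). -/
noncomputable def deg (Γ : MetricGraph V E) (v : V) : ℕ := Γ.inDeg v + Γ.outDeg v

/-- The standing choice of orientation: each vertex of degree two has one ingoing and one
outgoing edge. -/
def WellOriented (Γ : MetricGraph V E) : Prop :=
  ∀ v, Γ.deg v = 2 → Γ.inDeg v = 1 ∧ Γ.outDeg v = 1

/-! ### The spaces `L²(Γ)` and `H²(Γ)` -/

/-- Lebesgue measure on the edge `[0, len e]`. -/
noncomputable abbrev edgeMeasure (Γ : MetricGraph V E) (e : E) : Measure ℝ :=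
  volume.restrict (Icc 0 (Γ.len e))

/-- `L²(Γ) = ⊕ₑ L²([0, len e])`. -/
abbrev L2 [Fintype E] (Γ : MetricGraph V E) : Type _ :=
  PiLp 2 (fun e : E => Lp ℂ 2 (Γ.edgeMeasure e))

/-- An element of `H²(Γ) = ⊕ₑ H²([0, len e])`, given on each edge by its `C¹` representative `f`,
the derivative `d = f'` (in the direction of the edge), which is absolutely continuous, and
`g = f'' ∈ L²`. -/
structure H2Fun (Γ : MetricGraph V E) where
  f : E → ℝ → ℂ
  d : E → ℝ → ℂ
  g : E → ℝ → ℂ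
  memLp : ∀ e, MemLp (g e) 2 (Γ.edgeMeasure e)
  f_eq : ∀ e, ∀ x ∈ Icc 0 (Γ.len e), f e x = f e 0 + ∫ y in (0 : ℝ)..x, d e y
  d_eq : ∀ e, ∀ x ∈ Icc 0 (Γ.len e), d e x = d e 0 + ∫ y in (0 : ℝ)..x, g e y

/-- Boundary data: for each edge, the pair (value, derivative in the direction of the edge)
at its start (first component) and at its end (second component). -/
abbrev Traces (E : Type*) : Type _ := E → (ℂ × ℂ) × (ℂ × ℂ)

/-- The boundary data of an `H²` function. -/
def H2Fun.traces {Γ : MetricGraph V E} (F : Γ.H2Fun) : Traces E := fun e =>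
  ((F.f e 0, F.d e 0), (F.f e (Γ.len e), F.d e (Γ.len e)))

/-! ### Vertex conditions -/

/-- The Prüfer angle `α ∈ [0, π)` of `s ∈ ℝ ∪ {∞}`, characterised by `s = cot α`
(`α = 0` for `s = ∞`). -/
noncomputable def pruferAngle : OnePoint ℝ → ℝ
  | ∞ => 0
  | (s : ℝ) => Real.pi / 2 - Real.arctan s

/-- `γˢ` of a pair (value, derivative): first row of the rotation by the Prüfer angle. -/
noncomputable def gam (s : OnePoint ℝ) (p : ℂ × ℂ) : ℂ :=
  (Real.cos (pruferAngle s) : ℂ) * p.1 - (Real.sin (pruferAngle s) : ℂ) * p.2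

/-- `γˢ⋆` of a pair (value, derivative): second row of the rotation by the Prüfer angle. -/
noncomputable def gamStar (s : OnePoint ℝ) (p : ℂ × ℂ) : ℂ :=
  (Real.sin (pruferAngle s) : ℂ) * p.1 + (Real.cos (pruferAngle s) : ℂ) * p.2

section Conditions

variable [Fintype E]

open Classical in
/-- The sum over the edges ending at `v` of `γˢ` at their ends. At the vertices where the `δ_s`
condition is placed there is at most one such edge. -/
noncomputable def gamIn (Γ : MetricGraph V E) (s : OnePoint ℝ) (τ : Traces E) (v : V) : ℂ :=
  ∑ e with Γ.tgt e = v, gam s (τ e).2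

open Classical in
/-- The sum over the edges starting at `v` of `γˢ` at their starts. -/
noncomputable def gamOut (Γ : MetricGraph V E) (s : OnePoint ℝ) (τ : Traces E) (v : V) : ℂ :=
  ∑ e with Γ.src e = v, gam s (τ e).1

open Classical in
/-- `γ₁ˢ`: the trace from the ingoing edge; without an ingoing edge, `γ₁ˢ = γ₂ˢ` by convention. -/
noncomputable def gam₁ (Γ : MetricGraph V E) (s : OnePoint ℝ) (τ : Traces E) (v : V) : ℂ :=
  if ∃ e, Γ.tgt e = v then Γ.gamIn s τ v else Γ.gamOut s τ v

open Classical in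
/-- `γ₂ˢ`: the trace from the outgoing edge; without an outgoing edge, `γ₂ˢ = γ₁ˢ` by
convention. -/
noncomputable def gam₂ (Γ : MetricGraph V E) (s : OnePoint ℝ) (τ : Traces E) (v : V) : ℂ :=
  if ∃ e, Γ.src e = v then Γ.gamOut s τ v else Γ.gamIn s τ v

open Classical in
/-- `γ₁ˢ⋆`: the dual trace from the ingoing edge; it is `0` without an ingoing edge. -/
noncomputable def gamStar₁ (Γ : MetricGraph V E) (s : OnePoint ℝ) (τ : Traces E) (v : V) : ℂ :=
  ∑ e with Γ.tgt e = v, gamStar s (τ e).2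

open Classical in
/-- `γ₂ˢ⋆`: the dual trace from the outgoing edge; it is `0` without an outgoing edge. -/
noncomputable def gamStar₂ (Γ : MetricGraph V E) (s : OnePoint ℝ) (τ : Traces E) (v : V) : ℂ :=
  ∑ e with Γ.src e = v, gamStar s (τ e).1

open Classical in
/-- The Neumann–Kirchhoff condition at `v`: continuity (there is a common value `a` of all edge
ends at `v`), and the derivatives directed out of `v` sum to zero. -/
def IsNeumannKirchhoff (Γ : MetricGraph V E) (τ : Traces E) (v : V) : Prop :=
  (∃ a : ℂ, (∀ e, Γ.src e = v → (τ e).1.1 = a) ∧ ∀ e, Γ.tgt e = v → (τ e).2.1 = a) ∧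
  ∑ e with Γ.src e = v, (τ e).1.2 - ∑ e with Γ.tgt e = v, (τ e).2.2 = 0

/-- The `δ_s` vertex condition at `v` with parameter `t ∈ ℝ ∪ {∞}`. -/
def IsDelta (Γ : MetricGraph V E) (s : OnePoint ℝ) (τ : Traces E) (v : V) : OnePoint ℝ → Prop
  | ∞ => Γ.gam₁ s τ v = 0 ∧ Γ.gam₂ s τ v = 0
  | (t : ℝ) => Γ.gam₁ s τ v = Γ.gam₂ s τ v ∧
      Γ.gamStar₂ s τ v - Γ.gamStar₁ s τ v = (t : ℂ) * Γ.gam₁ s τ v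

/-- The boundary data satisfying the `δ_s` condition with parameter `t` at `B` and the
Neumann–Kirchhoff condition at all other vertices. -/
def IsDeltaData (Γ : MetricGraph V E) (s : OnePoint ℝ) (B : Finset V) (t : OnePoint ℝ)
    (τ : Traces E) : Prop :=
  (∀ v, v ∉ B → Γ.IsNeumannKirchhoff τ v) ∧ ∀ v ∈ B, Γ.IsDelta s τ v t

end Conditions

/-! ### The operators `Hˢ(t)` -/

section Linearity

variable {Γ : MetricGraph V E}

theorem H2Fun.intervalIntegrable_g (F : Γ.H2Fun) (e : E) {x : ℝ} (hx : x ∈ Icc 0 (Γ.len e)) :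
    IntervalIntegrable (F.g e) volume 0 x := by
  have h : IntegrableOn (F.g e) (Icc 0 (Γ.len e)) :=
    (F.memLp e).integrable (by norm_num)
  refine (intervalIntegrable_iff_integrableOn_Icc_of_le hx.1).2 (h.mono_set ?_)
  exact Icc_subset_Icc_right hx.2

theorem H2Fun.continuousOn_d (F : Γ.H2Fun) (e : E) :
    ContinuousOn (F.d e) (Icc 0 (Γ.len e)) := by
  have h : IntegrableOn (F.g e) (uIcc 0 (Γ.len e)) := by
    rw [uIcc_of_le (Γ.len_pos e).le]
    exact (F.memLp e).integrable (by norm_num)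
  have h2 := intervalIntegral.continuousOn_primitive_interval h
  rw [uIcc_of_le (Γ.len_pos e).le] at h2
  exact (continuousOn_const.add h2).congr (F.d_eq e)

theorem H2Fun.continuousOn_f (F : Γ.H2Fun) (e : E) :
    ContinuousOn (F.f e) (Icc 0 (Γ.len e)) := by
  have h : IntegrableOn (F.d e) (uIcc 0 (Γ.len e)) := by
    rw [uIcc_of_le (Γ.len_pos e).le]
    exact (F.continuousOn_d e).integrableOn_Icc
  have h2 := intervalIntegral.continuousOn_primitive_interval h
  rw [uIcc_of_le (Γ.len_pos e).le] at h2
  exact (continuousOn_const.add h2).congr (F.f_eq e)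

theorem H2Fun.intervalIntegrable_d (F : Γ.H2Fun) (e : E) {x : ℝ} (hx : x ∈ Icc 0 (Γ.len e)) :
    IntervalIntegrable (F.d e) volume 0 x := by
  refine ContinuousOn.intervalIntegrable_of_Icc hx.1 ((F.continuousOn_d e).mono ?_)
  exact Icc_subset_Icc_right hx.2

/-- Sum of `H²` functions. -/
def H2Fun.add (F G : Γ.H2Fun) : Γ.H2Fun where
  f := F.f + G.f
  d := F.d + G.d
  g := F.g + G.g
  memLp e := (F.memLp e).add (G.memLp e)
  f_eq e x hx := by
    simp only [Pi.add_apply]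
    rw [intervalIntegral.integral_add (F.intervalIntegrable_d e hx) (G.intervalIntegrable_d e hx),
      F.f_eq e x hx, G.f_eq e x hx]
    ring
  d_eq e x hx := by
    simp only [Pi.add_apply]
    rw [intervalIntegral.integral_add (F.intervalIntegrable_g e hx) (G.intervalIntegrable_g e hx),
      F.d_eq e x hx, G.d_eq e x hx]
    ring

/-- Scalar multiple of an `H²` function. -/
def H2Fun.smul (a : ℂ) (F : Γ.H2Fun) : Γ.H2Fun where
  f := a • F.f
  d := a • F.d
  g := a • F.g
  memLp e := (F.memLp e).const_smul a
  f_eq e x hx := by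
    simp only [Pi.smul_apply, smul_eq_mul, intervalIntegral.integral_const_mul]
    rw [F.f_eq e x hx]
    ring
  d_eq e x hx := by
    simp only [Pi.smul_apply, smul_eq_mul, intervalIntegral.integral_const_mul]
    rw [F.d_eq e x hx]
    ring

/-- The zero function. -/
def H2Fun.zero : Γ.H2Fun where
  f := 0
  d := 0
  g := 0
  memLp e := MemLp.zero
  f_eq e x hx := by simp
  d_eq e x hx := by simp

variable [Fintype E]

theorem IsNeumannKirchhoff.lin {τ σ : Traces E} {v : V} (a b : ℂ)
    (h : Γ.IsNeumannKirchhoff τ v) (k : Γ.IsNeumannKirchhoff σ v) :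
    Γ.IsNeumannKirchhoff (a • τ + b • σ) v := by
  obtain ⟨⟨x, hx, hx'⟩, h2⟩ := h
  obtain ⟨⟨y, hy, hy'⟩, k2⟩ := k
  refine ⟨⟨a * x + b * y, fun e he => ?_, fun e he => ?_⟩, ?_⟩
  · simp [hx e he, hy e he]
  · simp [hx' e he, hy' e he]
  · simp only [Pi.add_apply, Pi.smul_apply, Prod.fst_add, Prod.snd_add, Prod.smul_fst,
      Prod.smul_snd, smul_eq_mul, Finset.sum_add_distrib, ← Finset.mul_sum]
    linear_combination a * h2 + b * k2

theorem gam₁_lin (s : OnePoint ℝ) (τ σ : Traces E) (v : V) (a b : ℂ) :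
    Γ.gam₁ s (a • τ + b • σ) v = a * Γ.gam₁ s τ v + b * Γ.gam₁ s σ v := by
  unfold gam₁ gamIn gamOut gam
  split_ifs <;> simp only [Finset.mul_sum, ← Finset.sum_add_distrib] <;>
    refine Finset.sum_congr rfl fun e _ => ?_ <;> simp <;> ring

theorem gam₂_lin (s : OnePoint ℝ) (τ σ : Traces E) (v : V) (a b : ℂ) :
    Γ.gam₂ s (a • τ + b • σ) v = a * Γ.gam₂ s τ v + b * Γ.gam₂ s σ v := by
  unfold gam₂ gamIn gamOut gam
  split_ifs <;> simp only [Finset.mul_sum, ← Finset.sum_add_distrib] <;>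
    refine Finset.sum_congr rfl fun e _ => ?_ <;> simp <;> ring

theorem gamStar₁_lin (s : OnePoint ℝ) (τ σ : Traces E) (v : V) (a b : ℂ) :
    Γ.gamStar₁ s (a • τ + b • σ) v = a * Γ.gamStar₁ s τ v + b * Γ.gamStar₁ s σ v := by
  unfold gamStar₁ gamStar
  simp only [Finset.mul_sum, ← Finset.sum_add_distrib]
  refine Finset.sum_congr rfl fun e _ => ?_
  simp
  ring

theorem gamStar₂_lin (s : OnePoint ℝ) (τ σ : Traces E) (v : V) (a b : ℂ) :
    Γ.gamStar₂ s (a • τ + b • σ) v = a * Γ.gamStar₂ s τ v + b * Γ.gamStar₂ s σ v := by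
  unfold gamStar₂ gamStar
  simp only [Finset.mul_sum, ← Finset.sum_add_distrib]
  refine Finset.sum_congr rfl fun e _ => ?_
  simp
  ring

theorem IsDelta.lin {s : OnePoint ℝ} {τ σ : Traces E} {v : V} {t : OnePoint ℝ} (a b : ℂ)
    (h : Γ.IsDelta s τ v t) (k : Γ.IsDelta s σ v t) : Γ.IsDelta s (a • τ + b • σ) v t := by
  cases t with
  | infty =>
    obtain ⟨h1, h2⟩ := h
    obtain ⟨k1, k2⟩ := k
    refine ⟨?_, ?_⟩
    · rw [gam₁_lin, h1, k1]; simp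
    · rw [gam₂_lin, h2, k2]; simp
  | coe t =>
    obtain ⟨h1, h2⟩ := h
    obtain ⟨k1, k2⟩ := k
    refine ⟨?_, ?_⟩
    · rw [gam₁_lin, gam₂_lin, h1, k1]
    · rw [gam₁_lin, gamStar₁_lin, gamStar₂_lin]
      linear_combination a * h2 + b * k2

theorem IsDeltaData.lin {s : OnePoint ℝ} {B : Finset V} {t : OnePoint ℝ} {τ σ : Traces E}
    (a b : ℂ) (h : Γ.IsDeltaData s B t τ) (k : Γ.IsDeltaData s B t σ) :
    Γ.IsDeltaData s B t (a • τ + b • σ) :=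
  ⟨fun v hv => (h.1 v hv).lin a b (k.1 v hv), fun v hv => (h.2 v hv).lin a b (k.2 v hv)⟩

theorem isDeltaData_zero (s : OnePoint ℝ) (B : Finset V) (t : OnePoint ℝ) :
    Γ.IsDeltaData s B t 0 := by
  refine ⟨fun v _ => ⟨⟨0, by simp, by simp⟩, by simp⟩, fun v _ => ?_⟩
  cases t with
  | infty => simp [IsDelta, gam₁, gam₂, gamIn, gamOut, gam]
  | coe t => simp [IsDelta, gam₁, gam₂, gamIn, gamOut, gam, gamStar₁, gamStar₂, gamStar]

end Linearity

section Operator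

variable [Fintype E]

/-- The graph of `Hˢ(t)`: pairs `(u, w)` in `L²(Γ) × L²(Γ)` such that `u` is (the class of) an `H²`
function `F` satisfying the vertex conditions and `w = -F''`. -/
def deltaGraph (Γ : MetricGraph V E) (s : OnePoint ℝ) (B : Finset V) (t : OnePoint ℝ) :
    Submodule ℂ (Γ.L2 × Γ.L2) where
  carrier := {p | ∃ F : Γ.H2Fun, Γ.IsDeltaData s B t F.traces ∧
    ∀ e, p.1 e =ᵐ[Γ.edgeMeasure e] F.f e ∧ p.2 e =ᵐ[Γ.edgeMeasure e] -F.g e}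
  add_mem' := by
    rintro p q ⟨F, hF, hp⟩ ⟨G, hG, hq⟩
    refine ⟨F.add G, ?_, fun e => ⟨?_, ?_⟩⟩
    · have h := hF.lin 1 1 hG
      rw [one_smul, one_smul] at h
      exact h
    · refine (Lp.coeFn_add _ _).trans ?_
      exact (hp e).1.add (hq e).1
    · refine (Lp.coeFn_add _ _).trans ?_
      refine ((hp e).2.add (hq e).2).trans (Filter.EventuallyEq.of_eq ?_)
      change -F.g e + -G.g e = -(F.g e + G.g e)
      abel
  zero_mem' := ⟨H2Fun.zero, isDeltaData_zero s B t, fun e => ⟨Lp.coeFn_zero _ _ _, by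
    refine (Lp.coeFn_zero _ _ _).trans (Filter.EventuallyEq.of_eq ?_)
    change 0 = -(0 : ℝ → ℂ)
    simp⟩⟩
  smul_mem' := by
    rintro a p ⟨F, hF, hp⟩
    refine ⟨F.smul a, ?_, fun e => ⟨?_, ?_⟩⟩
    · have h := hF.lin a 0 (isDeltaData_zero s B t)
      rw [smul_zero, add_zero] at h
      exact h
    · refine (Lp.coeFn_smul _ _).trans ?_
      exact (hp e).1.const_smul a
    · refine (Lp.coeFn_smul _ _).trans ?_
      refine ((hp e).2.const_smul a).trans (Filter.EventuallyEq.of_eq ?_)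
      change a • -F.g e = -(a • F.g e)
      simp

/-- The operator `Hˢ(t) = -d²/dx²` of the `δ_s` family placed on `B`, as an unbounded operator on
`L²(Γ)`, defined through its graph. -/
noncomputable def deltaOp (Γ : MetricGraph V E) (s : OnePoint ℝ) (B : Finset V) (t : OnePoint ℝ) :
    Γ.L2 →ₗ.[ℂ] Γ.L2 :=
  (Γ.deltaGraph s B t).toLinearPMap

theorem deltaGraph_singleValued (Γ : MetricGraph V E) (s : OnePoint ℝ) (B : Finset V)
    (t : OnePoint ℝ) (p : Γ.L2 × Γ.L2) (hp : p ∈ Γ.deltaGraph s B t) (h0 : p.1 = 0) :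
    p.2 = 0 := by
  obtain ⟨F, -, hF⟩ := hp
  ext1 e
  have hlen := Γ.len_pos e
  have hf : EqOn (F.f e) 0 (Icc 0 (Γ.len e)) := by
    refine Measure.eqOn_Icc_of_ae_eq volume hlen.ne ?_ (F.continuousOn_f e) continuousOn_const
    have h1 := (hF e).1
    rw [h0] at h1
    exact h1.symm.trans (Lp.coeFn_zero _ _ _)
  have key : ∀ u w : ℝ → ℂ, EqOn u 0 (Icc 0 (Γ.len e)) →
      (∀ x ∈ Icc 0 (Γ.len e), u x = u 0 + ∫ y in (0 : ℝ)..x, w y) →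
      IntervalIntegrable w volume 0 (Γ.len e) → w =ᵐ[Γ.edgeMeasure e] 0 := by
    intro u w hu huw hw
    have hends : ∀ᵐ x : ℝ, x ≠ 0 ∧ x ≠ Γ.len e := by
      filter_upwards [Measure.ae_ne volume (0 : ℝ), Measure.ae_ne volume (Γ.len e)] with x h1 h2
      exact ⟨h1, h2⟩
    refine (ae_restrict_iff' measurableSet_Icc).2 ?_
    filter_upwards [hw.ae_hasDerivAt_integral, hends] with x hx hne hxm
    rw [uIcc_of_le hlen.le] at hx
    have h1 := hx hxm 0 (left_mem_Icc.2 hlen.le)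
    have h2 : HasDerivAt (fun x => ∫ y in (0 : ℝ)..x, w y) 0 x := by
      refine (hasDerivAt_const x (0 : ℂ)).congr_of_eventuallyEq ?_
      filter_upwards [Icc_mem_nhds (lt_of_le_of_ne hxm.1 hne.1.symm)
        (lt_of_le_of_ne hxm.2 hne.2)] with y hy
      have h3 := huw y hy
      rw [hu hy, hu (left_mem_Icc.2 hlen.le)] at h3
      simpa using h3.symm
    exact h1.unique h2
  have hd := key _ _ hf (F.f_eq e) (F.intervalIntegrable_d e (right_mem_Icc.2 hlen.le))
  have hd' : EqOn (F.d e) 0 (Icc 0 (Γ.len e)) :=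
    Measure.eqOn_Icc_of_ae_eq volume hlen.ne hd (F.continuousOn_d e) continuousOn_const
  have hg := key _ _ hd' (F.d_eq e) (F.intervalIntegrable_g e (right_mem_Icc.2 hlen.le))
  apply Lp.ext
  refine (hF e).2.trans ?_
  refine Filter.EventuallyEq.trans ?_ (Lp.coeFn_zero _ _ _).symm
  filter_upwards [hg] with x hx
  simp [hx]

/-- `Hˢ(t)` really has the graph through which it is defined. -/
theorem deltaOp_graph (Γ : MetricGraph V E) (s : OnePoint ℝ) (B : Finset V) (t : OnePoint ℝ) :
    (Γ.deltaOp s B t).graph = Γ.deltaGraph s B t :=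
  Submodule.toLinearPMap_graph_eq _ (Γ.deltaGraph_singleValued s B t)

/-- The map `[-∞, ∞] → ℝ ∪ {∞}` that identifies `-∞` and `∞`. -/
noncomputable def closeUp (t : EReal) : OnePoint ℝ :=
  if t = ⊥ ∨ t = ⊤ then ∞ else (t.toReal : OnePoint ℝ)

/-- The `δ_s` family placed on `B`, parametrised by `t ∈ [-∞, ∞]`, with `Hˢ(-∞) = Hˢ(∞)`. -/
noncomputable def deltaFamily (Γ : MetricGraph V E) (s : OnePoint ℝ) (B : Finset V) (t : EReal) :
    Γ.L2 →ₗ.[ℂ] Γ.L2 :=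
  Γ.deltaOp s B (closeUp t)

end Operator

/-! ### Points of the graph and `s`-points -/

/-- Interior points of edges: pairs `(e, x)` with `0 < x < len e`. -/
abbrev InteriorPoint (Γ : MetricGraph V E) : Type _ := {q : E × ℝ // q.2 ∈ Ioo 0 (Γ.len q.1)}

/-- The points of `Γ`: vertices and interior points of edges. -/
abbrev Point (Γ : MetricGraph V E) : Type _ := V ⊕ Γ.InteriorPoint

/-- The Robin condition `f' = s f` for a pair (value, derivative), read as `f = 0` if `s = ∞`. -/
def RobinCond : OnePoint ℝ → ℂ × ℂ → Prop
  | ∞, p => p.1 = 0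
  | (s : ℝ), p => p.2 = (s : ℂ) * p.1

/-- Being an `s`-point of `F`, for interior points and for vertices of degree one or two
(the derivative is taken in the direction of the edges). -/
def IsSPoint (Γ : MetricGraph V E) (s : OnePoint ℝ) (F : Γ.H2Fun) : Γ.Point → Prop
  | Sum.inl v => (Γ.deg v = 1 ∨ Γ.deg v = 2) ∧
      (∀ e, Γ.src e = v → RobinCond s (F.traces e).1) ∧
      ∀ e, Γ.tgt e = v → RobinCond s (F.traces e).2
  | Sum.inr q => RobinCond s (F.f q.1.1 q.1.2, F.d q.1.1 q.1.2)

/-- The set of `s`-points of `F`. -/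
def sSet (Γ : MetricGraph V E) (s : OnePoint ℝ) (F : Γ.H2Fun) : Set Γ.Point :=
  {p | Γ.IsSPoint s F p}

/-- The `s`-count `φ_s`: the number of `s`-points of `F`. -/
noncomputable def sCount (Γ : MetricGraph V E) (s : OnePoint ℝ) (F : Γ.H2Fun) : ℕ :=
  (Γ.sSet s F).ncard

/-- `F` is an eigenfunction, with eigenvalue `lam`, of the Laplacian with Neumann–Kirchhoff
conditions at all vertices. -/
def IsEigenfunction [Fintype E] (Γ : MetricGraph V E) (lam : ℝ) (F : Γ.H2Fun) : Prop :=
  (∀ v, Γ.IsNeumannKirchhoff F.traces v) ∧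
  (∀ e, ∀ᵐ x ∂(Γ.edgeMeasure e), -F.g e x = (lam : ℂ) * F.f e x) ∧
  ∃ e, ∃ x ∈ Icc 0 (Γ.len e), F.f e x ≠ 0

/-! ### Subdivision: a finite set of points is turned into vertices -/

open Classical in
/-- The positions on the edge `e`, beyond `x`, of the points of `P` interior to `e`. -/
noncomputable def cutsAfter (Γ : MetricGraph V E) (P : Finset Γ.Point) (e : E) (x : ℝ) : Finset ℝ :=
  {y ∈ (P.toRight.filter fun q => q.1.1 = e).image fun q => q.1.2 | x < y}

theorem mem_of_mem_cutsAfter {Γ : MetricGraph V E} {P : Finset Γ.Point} {e : E} {x y : ℝ}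
    (h : y ∈ Γ.cutsAfter P e x) :
    x < y ∧ ∃ hy : y ∈ Ioo 0 (Γ.len e), (⟨(e, y), hy⟩ : Γ.InteriorPoint) ∈ P.toRight := by
  classical
  simp only [cutsAfter, Finset.mem_filter, Finset.mem_image] at h
  obtain ⟨⟨⟨⟨e', y'⟩, hq⟩, ⟨hP, he⟩, hy⟩, hxy⟩ := h
  simp only at he hy
  subst he hy
  exact ⟨hxy, hq, hP⟩

/-- The edge of `Γ` containing a piece, and the position where the piece starts: the first piece
of the edge `e` is indexed by `e` itself, the piece starting at a cut point `q` by `q`. -/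
def pieceStart (Γ : MetricGraph V E) (P : Finset Γ.Point) : E ⊕ P.toRight → E × ℝ
  | Sum.inl e => (e, 0)
  | Sum.inr q => q.1.1

theorem pieceStart_lt (Γ : MetricGraph V E) (P : Finset Γ.Point) (i : E ⊕ P.toRight) :
    (Γ.pieceStart P i).2 < Γ.len (Γ.pieceStart P i).1 := by
  cases i with
  | inl e => exact Γ.len_pos e
  | inr q => exact q.1.2.2

/-- The graph `Γ` with the interior points in `P` turned into vertices (of degree two). Its
vertices are those of `Γ` and the cut points; each piece runs, in the direction of its edge, up to
the next cut point of that edge, or up to the end of the edge if there is none. -/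
noncomputable def subdivide (Γ : MetricGraph V E) (P : Finset Γ.Point) :
    MetricGraph (V ⊕ P.toRight) (E ⊕ P.toRight) where
  src i := i.map Γ.src id
  tgt i :=
    let e := (Γ.pieceStart P i).1
    if h : (Γ.cutsAfter P e (Γ.pieceStart P i).2).Nonempty then
      Sum.inr ⟨⟨(e, Finset.min' _ h), (mem_of_mem_cutsAfter (Finset.min'_mem _ h)).2.1⟩,
        (mem_of_mem_cutsAfter (Finset.min'_mem _ h)).2.2⟩
    else Sum.inl (Γ.tgt e)
  len i :=
    let e := (Γ.pieceStart P i).1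
    let x := (Γ.pieceStart P i).2
    if h : (Γ.cutsAfter P e x).Nonempty then Finset.min' _ h - x else Γ.len e - x
  len_pos i := by
    dsimp only
    split_ifs with h
    · exact sub_pos.2 (mem_of_mem_cutsAfter (Finset.min'_mem _ h)).1
    · exact sub_pos.2 (Γ.pieceStart_lt P i)

/-- The points of `P`, as vertices of the subdivided graph. -/
def markedVertices (Γ : MetricGraph V E) (P : Finset Γ.Point) : Finset (V ⊕ P.toRight) :=
  P.toLeft.disjSum P.toRight.attach

end MetricGraph

/-! The `δ_s` family is a family of extensions of one boundary relation: tuples `(u, w, g, j)` with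
`w = -u''`, `g = γ₁ˢ(u)`, `j = γ₂ˢ⋆(u) - γ₁ˢ⋆(u)` on `B`, and all parameter-free vertex conditions
imposed on `u`. Parameter `t` means `j = t g`, and `∞` means `g = 0`. Green's identity makes the
boundary form symplectic in `(g, j)`. If `c` is not in the spectrum at `∞`, each `g` has a unique
solution of `-u'' = c u` with that boundary value, and `g ↦ j` is a symmetric matrix `M(c)` of size
`|B|`. An eigenfunction at parameter `t` and energy `c` is exactly a solution with `M(c) g = t g`
(`Solution.kerRel_coe`). Hence the multiplicities of `c`, summed over all real `t`, give `|B|`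
(`IsSystem.finsum_mult`). It remains to see that every crossing of `c` has the same sign. This is
done by inertia, without following eigenvalue curves. On a piece `[p, q]` with window bottom `a`,
choose a reference parameter `r` between `p` and `q`, and rotate the boundary values so that `r`
plays the role of `∞`. One block quadratic form on `X × G`, built from the resolvent at `a` and from
`M(a)`, is diagonalised by completing the square in either variable (`index_identity`). Comparing
positive indices expresses the change of the eigenvalue count in `[a, c)` by the eigenvalues of
`M(a)` and `M(c)` beyond a threshold (`count_identity`). Since `a` is never an eigenvalue on the
piece, only the crossings of `c` remain (`IsSystem.count_sub_count`), and the sum over the pieces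
telescopes (`IsSystem.flow_eq`). Solution operators exist wherever the kernel is trivial, by the
Fredholm alternative: there are as many conditions at edge ends as initial data on the edges, and
the solution operator of `-f'' = w` is compact (`exists_bvp_inverse`). Windows exist because each
spectrum is countable on the real line, and an energy outside the spectrum at `∞` is an eigenvalue
for only finitely many parameters. The statement on `s`-points is the general one on the subdivided
graph, whose cut points have one ingoing and one outgoing edge. -/

/-! ## The positive index of a real-valued function on a vector space -/

namespace PosIndex

open Module Submodule

variable {W W' : Type*} [AddCommGroup W] [Module ℂ W] [AddCommGroup W'] [Module ℂ W']

/-- `q` has positive index `n`: the space is spanned by an `n`-dimensional subspace on which `q` is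
positive and a subspace on which `q` is nonpositive. -/
def HasPosIndex (q : W → ℝ) (n : ℕ) : Prop :=
  ∃ P N : Submodule ℂ W, FiniteDimensional ℂ P ∧ finrank ℂ P = n ∧ P ⊔ N = ⊤ ∧
    (∀ u ∈ P, u ≠ 0 → 0 < q u) ∧ ∀ u ∈ N, q u ≤ 0

/-- `P` maps onto `W ⧸ N`, and `P'` embeds into it. -/
theorem finrank_le_of_sup_eq_top_of_disjoint {P N P' : Submodule ℂ W} [FiniteDimensional ℂ P]
    (h : P ⊔ N = ⊤) (h' : Disjoint P' N) :
    FiniteDimensional ℂ P' ∧ finrank ℂ P' ≤ finrank ℂ P := by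
  have hsurj : Function.Surjective (N.mkQ ∘ₗ P.subtype) := by
    rw [← LinearMap.range_eq_top, LinearMap.range_comp, range_subtype]
    have := congrArg (Submodule.map N.mkQ) h
    rw [Submodule.map_sup, mkQ_map_self, sup_bot_eq, Submodule.map_top, range_mkQ] at this
    exact this
  have hfd : FiniteDimensional ℂ (W ⧸ N) := Module.Finite.of_surjective _ hsurj
  have hinj : Function.Injective (N.mkQ ∘ₗ P'.subtype) := by
    rw [← LinearMap.ker_eq_bot, LinearMap.ker_eq_bot']
    intro x hx
    have hx' : (x : W) ∈ N := by simpa using hx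
    exact Subtype.ext (disjoint_def.1 h' _ x.2 hx')
  have hfd' : FiniteDimensional ℂ P' := Module.Finite.of_injective _ hinj
  exact ⟨hfd', (LinearMap.finrank_le_finrank_of_injective hinj).trans
    (LinearMap.finrank_le_finrank_of_surjective hsurj)⟩

/-- Sylvester's law of inertia: a space where `q` is positive meets a space where it is nonpositive
only in `0`. Apply this crosswise to the two decompositions. -/
theorem HasPosIndex.unique {q : W → ℝ} {n m : ℕ} (hn : HasPosIndex q n) (hm : HasPosIndex q m) :
    n = m := by
  obtain ⟨P, N, hP, hn, hsup, hpos, hneg⟩ := hn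
  obtain ⟨P', N', hP', hm, hsup', hpos', hneg'⟩ := hm
  have h1 : Disjoint P' N := disjoint_def.2 fun x hx hx' => by
    by_contra h0
    exact absurd (hneg x hx') (not_le.2 (hpos' x hx h0))
  have h2 : Disjoint P N' := disjoint_def.2 fun x hx hx' => by
    by_contra h0
    exact absurd (hneg' x hx') (not_le.2 (hpos x hx h0))
  have h3 := (finrank_le_of_sup_eq_top_of_disjoint hsup h1).2
  have h4 := (finrank_le_of_sup_eq_top_of_disjoint hsup' h2).2
  omega

theorem HasPosIndex.congr {q : W → ℝ} {q' : W' → ℝ} {n : ℕ} (hn : HasPosIndex q n) (e : W ≃ₗ[ℂ] W')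
    (h : ∀ u, q' (e u) = q u) : HasPosIndex q' n := by
  obtain ⟨P, N, hP, hn, hsup, hpos, hneg⟩ := hn
  refine ⟨P.map e.toLinearMap, N.map e.toLinearMap, inferInstance, ?_, ?_, ?_, ?_⟩
  · rw [← hn]
    exact LinearEquiv.finrank_map_eq e P
  · rw [← Submodule.map_sup, hsup, Submodule.map_top, LinearEquiv.range]
  · rintro _ ⟨u, hu, rfl⟩ h0
    have : u ≠ 0 := by rintro rfl; simp at h0
    simpa [h] using hpos u hu this
  · rintro _ ⟨u, hu, rfl⟩
    simpa [h] using hneg u hu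

/-- Neither function is assumed quadratic, so the values at `0` enter as hypotheses; they treat
vectors with one vanishing component. -/
theorem HasPosIndex.prod {q : W → ℝ} {q' : W' → ℝ} {n m : ℕ} (hn : HasPosIndex q n)
    (hm : HasPosIndex q' m) (h0 : q 0 = 0) (h0' : q' 0 = 0) :
    HasPosIndex (fun u : W × W' => q u.1 + q' u.2) (n + m) := by
  obtain ⟨P, N, hP, hn, hsup, hpos, hneg⟩ := hn
  obtain ⟨P', N', hP', hm, hsup', hpos', hneg'⟩ := hm
  have hrange : P.prod P' = LinearMap.range (P.subtype.prodMap P'.subtype) := by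
    rw [LinearMap.range_prodMap, range_subtype, range_subtype]
  have hinj : Function.Injective (P.subtype.prodMap P'.subtype) :=
    Function.Injective.prodMap P.injective_subtype P'.injective_subtype
  refine ⟨P.prod P', N.prod N', ?_, ?_, ?_, ?_, ?_⟩
  · rw [hrange]; infer_instance
  · rw [← hn, ← hm, hrange, LinearMap.finrank_range_of_inj hinj, Module.finrank_prod]
  · rw [Submodule.prod_sup_prod, hsup, hsup', Submodule.prod_top]
  · rintro ⟨u, v⟩ ⟨hu, hv⟩ hne
    by_cases hu0 : u = 0
    · have hv0 : v ≠ 0 := by rintro rfl; exact hne (by simp [hu0])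
      simpa [hu0, h0] using hpos' v hv hv0
    · by_cases hv0 : v = 0
      · simpa [hv0, h0'] using hpos u hu hu0
      · exact add_pos (hpos u hu hu0) (hpos' v hv hv0)
  · rintro ⟨u, v⟩ ⟨hu, hv⟩
    exact add_nonpos (hneg u hu) (hneg' v hv)

/-! ### Dimensions of independent families of subspaces. -/

theorem finite_ne_bot_of_iSupIndep {ι : Type*} {p : ι → Submodule ℂ W} (hp : iSupIndep p)
    [FiniteDimensional ℂ (⨆ i, p i : Submodule ℂ W)] : {i | p i ≠ ⊥}.Finite := by
  have hI : ∀ i : {i // p i ≠ ⊥}, ∃ v ∈ p i, v ≠ (0 : W) := fun i => (Submodule.ne_bot_iff _).1 i.2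
  choose v hv hv0 using hI
  have hli : LinearIndependent ℂ v := (hp.comp Subtype.coe_injective).linearIndependent _ hv hv0
  let v' : {i // p i ≠ ⊥} → (⨆ i, p i : Submodule ℂ W) := fun i => ⟨v i, mem_iSup_of_mem i.1 (hv i)⟩
  have hli' : LinearIndependent ℂ v' := LinearIndependent.of_comp (Submodule.subtype _) hli
  exact Set.finite_coe_iff.1 hli'.finite

theorem finrank_biSup_of_iSupIndep {ι : Type*} {p : ι → Submodule ℂ W} (hp : iSupIndep p)
    (hfd : ∀ i, FiniteDimensional ℂ (p i)) (F : Finset ι) :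
    finrank ℂ (⨆ i ∈ F, p i : Submodule ℂ W) = ∑ i ∈ F, finrank ℂ (p i) := by
  classical
  induction F using Finset.induction_on with
  | empty => 
    rw [Finset.sum_empty, show (⨆ i ∈ (∅ : Finset ι), p i) = ⊥ by simp, finrank_bot]
  | insert i F hi ih =>
    have hdis : Disjoint (p i) (⨆ j ∈ F, p j) := hp.disjoint_biSup (by simpa using hi)
    rw [Finset.iSup_insert, Finset.sum_insert hi, ← ih]
    have := Submodule.finiteDimensional_finset_sup F p
    rw [Finset.sup_eq_iSup] at this
    have h := Submodule.finrank_sup_add_finrank_inf_eq (p i) (⨆ j ∈ F, p j)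
    rw [hdis.eq_bot, finrank_bot, add_zero] at h
    exact h

theorem finrank_iSup_of_iSupIndep {ι : Type*} {p : ι → Submodule ℂ W} (hp : iSupIndep p)
    [FiniteDimensional ℂ (⨆ i, p i : Submodule ℂ W)] :
    finrank ℂ (⨆ i, p i : Submodule ℂ W) = ∑ᶠ i, finrank ℂ (p i) := by
  have hfin := finite_ne_bot_of_iSupIndep hp
  have hfd : ∀ i, FiniteDimensional ℂ (p i) := fun i =>
    Submodule.finiteDimensional_of_le (le_iSup p i)
  have h : (⨆ i, p i) = ⨆ i ∈ hfin.toFinset, p i := by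
    refine le_antisymm (iSup_le fun i => ?_) (iSup₂_le fun i _ => le_iSup p i)
    by_cases hi : p i = ⊥
    · rw [hi]; exact bot_le
    · exact le_biSup p (by simpa using hi)
  rw [h, finrank_biSup_of_iSupIndep hp hfd, finsum_eq_sum_of_support_subset]
  intro i hi
  simp only [Function.mem_support] at hi
  simp only [Finite.coe_toFinset, mem_ofPred_eq]
  rintro h0
  rw [h0, finrank_bot] at hi
  exact hi rfl

/-! ### Symmetric operators -/

section Symmetric

variable {X : Type*} [NormedAddCommGroup X] [InnerProductSpace ℂ X]

/-- The span of the eigenspaces of `A` for the real eigenvalues in `S`. -/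
def eigenspan (A : X →ₗ[ℂ] X) (S : Set ℝ) : Submodule ℂ X :=
  ⨆ ν : S, End.eigenspace A ((ν : ℝ) : ℂ)

/-- The quadratic form of `A - x`. -/
noncomputable def shiftForm (A : X →ₗ[ℂ] X) (x : ℝ) (u : X) : ℝ :=
  (inner ℂ (A u) u).re - x * ‖u‖ ^ 2

theorem orthogonalFamily_real {A : X →ₗ[ℂ] X} (hA : A.IsSymmetric) (S : Set ℝ) :
    OrthogonalFamily ℂ (fun ν : S => End.eigenspace A ((ν : ℝ) : ℂ)) fun ν =>
      (End.eigenspace A ((ν : ℝ) : ℂ)).subtypeₗᵢ :=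
  hA.orthogonalFamily_eigenspaces.comp (f := fun ν : S => ((ν : ℝ) : ℂ))
    (Complex.ofReal_injective.comp Subtype.val_injective)

/-- Eigenspaces are mutually orthogonal, so the norm and the form of `A` are diagonal in the
eigenvector expansion. -/
theorem exists_sum_of_mem_eigenspan {A : X →ₗ[ℂ] X} (hA : A.IsSymmetric) {S : Set ℝ} {u : X}
    (hu : u ∈ eigenspan A S) : ∃ (F : Finset S) (v : S → X),
      u = ∑ ν ∈ F, v ν ∧ ‖u‖ ^ 2 = ∑ ν ∈ F, ‖v ν‖ ^ 2 ∧
      (inner ℂ (A u) u).re = ∑ ν ∈ F, (ν : ℝ) * ‖v ν‖ ^ 2 := by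
  classical
  have hO := orthogonalFamily_real hA S
  rw [eigenspan, mem_iSup_iff_exists_dfinsupp'] at hu
  obtain ⟨f, hf⟩ := hu
  rw [DFinsupp.sum] at hf
  refine ⟨f.support, fun ν => (f ν : X), hf.symm, ?_, ?_⟩
  · rw [← hf]
    exact hO.norm_sum (fun ν => f ν) f.support
  · have h1 : A u = ∑ ν ∈ f.support, (((((ν : ℝ) : ℂ) • f ν : End.eigenspace A ((ν : ℝ) : ℂ))) : X) := by
      rw [← hf, map_sum]
      refine Finset.sum_congr rfl fun ν _ => ?_
      exact End.mem_eigenspace_iff.1 (f ν).2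
    have h2 := hO.inner_sum (fun ν => ((ν : ℝ) : ℂ) • f ν) (fun ν => f ν) f.support
    change inner ℂ (∑ ν ∈ f.support, ((((ν : ℝ) : ℂ) • f ν :
      End.eigenspace A ((ν : ℝ) : ℂ)) : X)) (∑ ν ∈ f.support, (f ν : X)) = _ at h2
    rw [← h1, hf] at h2
    rw [h2, Complex.re_sum]
    refine Finset.sum_congr rfl fun ν _ => ?_
    rw [inner_smul_left, Complex.conj_ofReal, Complex.re_ofReal_mul]
    congr 1
    exact inner_self_eq_norm_sq (𝕜 := ℂ) (f ν)

theorem shiftForm_pos {A : X →ₗ[ℂ] X} (hA : A.IsSymmetric) {x : ℝ} {u : X}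
    (hu : u ∈ eigenspan A (Ioi x)) (h0 : u ≠ 0) : 0 < shiftForm A x u := by
  obtain ⟨F, v, h1, h2, h3⟩ := exists_sum_of_mem_eigenspan hA hu
  rw [shiftForm, h2, h3, Finset.mul_sum, sub_pos]
  have hex : ∃ ν ∈ F, v ν ≠ 0 := by
    by_contra! h
    exact h0 (h1.trans (Finset.sum_eq_zero h))
  obtain ⟨ν, hν, hv⟩ := hex
  refine Finset.sum_lt_sum (fun μ _ => ?_) ⟨ν, hν, ?_⟩
  · exact mul_le_mul_of_nonneg_right (le_of_lt μ.2) (by positivity)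
  · exact mul_lt_mul_of_pos_right ν.2 (by positivity)

theorem shiftForm_nonpos {A : X →ₗ[ℂ] X} (hA : A.IsSymmetric) {x : ℝ} {u : X}
    (hu : u ∈ eigenspan A (Iic x)) : shiftForm A x u ≤ 0 := by
  obtain ⟨F, v, h1, h2, h3⟩ := exists_sum_of_mem_eigenspan hA hu
  rw [shiftForm, h2, h3, Finset.mul_sum, sub_nonpos]
  exact Finset.sum_le_sum fun μ _ => mul_le_mul_of_nonneg_right μ.2 (by positivity)

/-- The eigenvalues are real, hence each one lies above `x` or not. -/
theorem iSup_eigenspace_le {A : X →ₗ[ℂ] X} (hA : A.IsSymmetric) (x : ℝ) :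
    ⨆ μ : ℂ, End.eigenspace A μ ≤ eigenspan A (Ioi x) ⊔ eigenspan A (Iic x) := by
  refine iSup_le fun μ => ?_
  by_cases h : End.HasEigenvalue A μ
  · have hμ : ((μ.re : ℝ) : ℂ) = μ := Complex.conj_eq_iff_re.1 (hA.conj_eigenvalue_eq_self h)
    rw [← hμ]
    rcases lt_or_ge x μ.re with hx | hx
    · exact le_sup_of_le_left (le_iSup (fun ν : Ioi x => End.eigenspace A ((ν : ℝ) : ℂ)) ⟨μ.re, hx⟩)
    · exact le_sup_of_le_right (le_iSup (fun ν : Iic x => End.eigenspace A ((ν : ℝ) : ℂ)) ⟨μ.re, hx⟩)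
  · rw [End.hasEigenvalue_iff, not_not] at h
    rw [h]
    exact bot_le

/-- The decomposition is `P ⊔ Pᗮ`, with `P` spanned by the eigenvectors above `x`. Because the
eigenvectors are total, `Pᗮ` lies in the closure of the span of the others, where the form is
nonpositive by continuity. -/
theorem hasPosIndex_shiftForm [CompleteSpace X] {A : X →L[ℂ] X} (hA : (A : X →ₗ[ℂ] X).IsSymmetric)
    (hdense : (⨆ μ : ℂ, End.eigenspace (A : X →ₗ[ℂ] X) μ)ᗮ = ⊥) (x : ℝ)
    [FiniteDimensional ℂ (eigenspan (A : X →ₗ[ℂ] X) (Ioi x))] :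
    HasPosIndex (shiftForm (A : X →ₗ[ℂ] X) x) (finrank ℂ (eigenspan (A : X →ₗ[ℂ] X) (Ioi x))) := by
  set P := eigenspan (A : X →ₗ[ℂ] X) (Ioi x) with hP
  set Q := eigenspan (A : X →ₗ[ℂ] X) (Iic x) with hQ
  have hPQ : P ⟂ Q := by
    rw [hP, hQ, eigenspan, eigenspan, isOrtho_iSup_left]
    intro ν
    rw [isOrtho_iSup_right]
    intro ν'
    refine hA.orthogonalFamily_eigenspaces.isOrtho ?_
    have h1 := ν.2
    have h2 := ν'.2
    simp only [mem_Ioi, mem_Iic] at h1 h2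
    exact fun h => (h2.trans_lt h1).ne' (Complex.ofReal_injective h)
  have hbot : Pᗮ ⊓ Qᗮ = ⊥ := by
    rw [inf_orthogonal, eq_bot_iff, ← hdense]
    exact orthogonal_le (iSup_eigenspace_le hA x)
  -- It suffices that `Qᗮ ≤ P`: the part of a vector of `Qᗮ` orthogonal to `P` is orthogonal to all
  -- eigenvectors, hence `0`.
  have hcl : Pᗮ ≤ Q.topologicalClosure := by
    rw [← orthogonal_orthogonal_eq_closure]
    intro u hu
    rw [mem_orthogonal]
    intro v hv
    obtain ⟨p, hp, z, hz, rfl⟩ := P.exists_add_mem_mem_orthogonal v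
    have hzQ : z ∈ Qᗮ := by
      have := Qᗮ.sub_mem hv (hPQ.le hp)
      simpa using this
    have : z = 0 := by
      have : z ∈ Pᗮ ⊓ Qᗮ := ⟨hz, hzQ⟩
      rwa [hbot, mem_bot] at this
    rw [this, add_zero]
    exact (mem_orthogonal _ _).1 hu p hp
  refine ⟨P, Pᗮ, inferInstance, rfl, sup_orthogonal_of_hasOrthogonalProjection,
    fun u hu h0 => shiftForm_pos hA hu h0, fun u hu => ?_⟩
  have hclosed : IsClosed {u : X | shiftForm (A : X →ₗ[ℂ] X) x u ≤ 0} := by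
    refine isClosed_le ?_ continuous_const
    unfold shiftForm
    exact ((Complex.continuous_re.comp (A.continuous.inner continuous_id))).sub
      (continuous_const.mul (continuous_norm.pow 2))
  exact closure_minimal (fun v hv => shiftForm_nonpos hA hv) hclosed (hcl hu)

/-- From `x ‖v‖² ≤ ⟨A v, v⟩ ≤ ‖A v‖ ‖v‖`, the operator is bounded below on the closure of the span.
A compact operator that is a closed embedding has a finite-dimensional domain. -/
theorem finiteDimensional_eigenspan [CompleteSpace X] {A : X →L[ℂ] X}
    (hA : (A : X →ₗ[ℂ] X).IsSymmetric) (hc : IsCompactOperator A) {x : ℝ} (hx : 0 < x) :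
    FiniteDimensional ℂ (eigenspan (A : X →ₗ[ℂ] X) (Ioi x)) := by
  set P := eigenspan (A : X →ₗ[ℂ] X) (Ioi x) with hP
  have hbound : ∀ u ∈ P.topologicalClosure, x * ‖u‖ ≤ ‖A u‖ := by
    have hclosed : IsClosed {u : X | x * ‖u‖ ≤ ‖A u‖} :=
      isClosed_le (by fun_prop) (by fun_prop)
    refine fun u hu => closure_minimal (fun v hv => ?_) hclosed hu
    by_cases h0 : v = 0
    · simp [h0]
    have h1 := shiftForm_pos hA hv h0
    have h2 : (inner ℂ (A v) v).re ≤ ‖A v‖ * ‖v‖ :=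
      (Complex.re_le_norm _).trans (norm_inner_le_norm _ _)
    have h3 : 0 < ‖v‖ := norm_pos_iff.2 h0
    rw [shiftForm] at h1
    simp only [ContinuousLinearMap.coe_coe] at h1
    simp only [mem_ofPred_eq]
    nlinarith
  have hcomp : CompleteSpace P.topologicalClosure :=
    P.isClosed_topologicalClosure.completeSpace_coe
  let T : P.topologicalClosure →L[ℂ] X := A ∘L P.topologicalClosure.subtypeL
  have hT : IsCompactOperator T := hc.comp_clm _
  have hanti : AntilipschitzWith ⟨x⁻¹, by positivity⟩ T := by
    refine AddMonoidHomClass.antilipschitz_of_bound T fun u => ?_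
    have := hbound u u.2
    change ‖(u : X)‖ ≤ x⁻¹ * ‖A u‖
    rw [inv_mul_eq_div, le_div_iff₀ hx]
    linarith
  have hemb := hanti.isClosedEmbedding T.uniformContinuous
  obtain ⟨K, hK, hK0⟩ := hT
  have : FiniteDimensional ℂ P.topologicalClosure :=
    FiniteDimensional.of_isCompactOperator_id ⟨T ⁻¹' K, hemb.isCompact_preimage hK, hK0⟩
  exact Submodule.finiteDimensional_of_le P.le_topologicalClosure

theorem finite_eigenspace_ne_bot {A : X →ₗ[ℂ] X} (hA : A.IsSymmetric) (S : Set ℝ)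
    [hfd : FiniteDimensional ℂ (eigenspan A S)] :
    {ν | ν ∈ S ∧ End.eigenspace A ((ν : ℝ) : ℂ) ≠ ⊥}.Finite := by
  unfold eigenspan at hfd
  refine ((finite_ne_bot_of_iSupIndep (orthogonalFamily_real hA S).independent).image
    Subtype.val).subset ?_
  rintro ν ⟨hν, h⟩
  exact ⟨⟨ν, hν⟩, h, rfl⟩

theorem finrank_eigenspan {A : X →ₗ[ℂ] X} (hA : A.IsSymmetric) (S : Set ℝ)
    [hfd : FiniteDimensional ℂ (eigenspan A S)] :
    finrank ℂ (eigenspan A S) = ∑ᶠ ν ∈ S, finrank ℂ (End.eigenspace A ((ν : ℝ) : ℂ)) := by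
  unfold eigenspan at hfd ⊢
  rw [finrank_iSup_of_iSupIndep (orthogonalFamily_real hA S).independent]
  exact finsum_set_coe_eq_finsum_mem S (f := fun ν => finrank ℂ (End.eigenspace A ((ν : ℝ) : ℂ)))

/-- For a compact symmetric operator, the positive index of `A - x` with `x > 0` counts the
eigenvalues above `x`. -/
theorem hasPosIndex_of_isCompactOperator [CompleteSpace X] {A : X →L[ℂ] X}
    (hA : (A : X →ₗ[ℂ] X).IsSymmetric) (hc : IsCompactOperator A) {x : ℝ} (hx : 0 < x) :
    HasPosIndex (shiftForm (A : X →ₗ[ℂ] X) x)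
      (∑ᶠ ν ∈ Ioi x, finrank ℂ (End.eigenspace (A : X →ₗ[ℂ] X) ((ν : ℝ) : ℂ))) := by
  have := finiteDimensional_eigenspan hA hc hx
  rw [← finrank_eigenspan hA]
  exact hasPosIndex_shiftForm hA
    (ContinuousLinearMap.orthogonalComplement_iSup_eigenspaces_eq_bot hc hA) x

/-- In finite dimension, the positive index of `A - x` counts the eigenvalues above `x`. -/
theorem hasPosIndex_of_finiteDimensional [FiniteDimensional ℂ X] {A : X →ₗ[ℂ] X}
    (hA : A.IsSymmetric) (x : ℝ) :
    HasPosIndex (shiftForm A x) (∑ᶠ ν ∈ Ioi x, finrank ℂ (End.eigenspace A ((ν : ℝ) : ℂ))) := by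
  have : CompleteSpace X := FiniteDimensional.complete ℂ X
  rw [← finrank_eigenspan hA]
  exact hasPosIndex_shiftForm (A := LinearMap.toContinuousLinearMap A) hA
    hA.orthogonalComplement_iSup_eigenspaces_eq_bot x

theorem finsum_finrank_eigenspace [FiniteDimensional ℂ X] {A : X →ₗ[ℂ] X} (hA : A.IsSymmetric) :
    ∑ᶠ ν : ℝ, finrank ℂ (End.eigenspace A (ν : ℂ)) = finrank ℂ X := by
  have h := finrank_eigenspan hA univ
  rw [finsum_mem_univ] at h
  rw [← h]
  have htop : eigenspan A univ = ⊤ := by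
    have h1 : (⨆ μ : ℂ, End.eigenspace A μ) ≤ eigenspan A univ := by
      -- The splitting point `0` is arbitrary.
      refine (iSup_eigenspace_le hA 0).trans (sup_le ?_ ?_) <;>
      · refine iSup_le fun ν => ?_
        exact le_iSup (fun ν : (univ : Set ℝ) => End.eigenspace A ((ν : ℝ) : ℂ)) ⟨ν, mem_univ _⟩
    have h2 := hA.orthogonalComplement_iSup_eigenspaces_eq_bot
    rw [Submodule.orthogonal_eq_bot_iff] at h2
    rw [h2] at h1
    exact top_le_iff.1 h1
  rw [htop, finrank_top]

end Symmetric

end PosIndex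

/-! ## Boundary relations -/

namespace BoundaryRelation

open Module PosIndex

variable {X G : Type*} [NormedAddCommGroup X] [InnerProductSpace ℂ X]
  [NormedAddCommGroup G] [InnerProductSpace ℂ G]

theorem shiftForm_zero (A : X →ₗ[ℂ] X) (x : ℝ) : shiftForm A x 0 = 0 := by simp [shiftForm]

theorem re_inner_comm (u v : X) : (inner ℂ u v).re = (inner ℂ v u).re := inner_re_symm (𝕜 := ℂ) u v

theorem norm_sq_eq_inner_re (u : X) : ‖u‖ ^ 2 = (inner ℂ u u).re :=
  (inner_self_eq_norm_sq (𝕜 := ℂ) u).symm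

/-- Inertia identity obtained by completing the square in two ways in the quadratic form of the
block operator with diagonal entries `R - x`, `M₀ - t` and off-diagonal entries `Γ`, `Γ⋆`. -/
theorem index_identity {R R' : X →ₗ[ℂ] X} {Γ L : G →ₗ[ℂ] X} {Γs K : X →ₗ[ℂ] G}
    {M₀ M₁ : G →ₗ[ℂ] G} {x t : ℝ} (hR : R.IsSymmetric) (hM : M₀.IsSymmetric)
    (hΓ : ∀ w φ, inner ℂ (Γs w) φ = inner ℂ w (Γ φ))
    (hL : ∀ φ, R (L φ) = (x : ℂ) • L φ - Γ φ) (hM₁ : ∀ φ, M₁ φ = M₀ φ + Γs (L φ))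
    (hK : ∀ u, M₀ (K u) = (t : ℂ) • K u - Γs u) (hR' : ∀ u, R' u = R u + Γ (K u))
    {n n' p p' : ℕ} (hn : HasPosIndex (shiftForm R x) n) (hn' : HasPosIndex (shiftForm R' x) n')
    (hp : HasPosIndex (shiftForm M₀ t) p) (hp' : HasPosIndex (shiftForm M₁ t) p') :
    n' + p = n + p' := by
  let q : X × G → ℝ := fun z =>
    shiftForm R x z.1 + 2 * (inner ℂ (Γ z.2) z.1).re + shiftForm M₀ t z.2
  let e₁ : (X × G) ≃ₗ[ℂ] (X × G) :=
    { toFun := fun z => (z.1 + L z.2, z.2)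
      invFun := fun z => (z.1 - L z.2, z.2)
      left_inv := fun z => by simp
      right_inv := fun z => by simp
      map_add' := fun z z' => by
        ext
        · simp only [Prod.fst_add, Prod.snd_add, map_add]; abel
        · simp
      map_smul' := fun a z => by ext <;> simp }
  let e₂ : (X × G) ≃ₗ[ℂ] (X × G) :=
    { toFun := fun z => (z.1, z.2 + K z.1)
      invFun := fun z => (z.1, z.2 - K z.1)
      left_inv := fun z => by simp
      right_inv := fun z => by simp
      map_add' := fun z z' => by
        ext
        · simp
        · simp only [Prod.fst_add, Prod.snd_add, map_add]; abel
      map_smul' := fun a z => by ext <;> simp }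
  -- Since `(R - x) L = -Γ`, the substitution `u + L φ` removes the mixed term and replaces `M₀` by
  -- `M₁ = M₀ + Γ⋆ L`.
  have h₁ : HasPosIndex q (n + p') := by
    refine (hn.prod hp' (shiftForm_zero _ _) (shiftForm_zero _ _)).congr e₁ ?_
    rintro ⟨u, φ⟩
    have h1 := congrArg Complex.re (hR u (L φ))
    have h2 := congrArg Complex.re (hΓ (L φ) φ)
    have h3 := re_inner_comm u (L φ)
    have h4 := re_inner_comm u (Γ φ)
    have h5 := re_inner_comm (L φ) (Γ φ)
    simp only [q, e₁, shiftForm, LinearEquiv.coe_mk, LinearMap.coe_mk, AddHom.coe_mk, map_add, hL,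
      hM₁, norm_sq_eq_inner_re, inner_add_left, inner_add_right, inner_sub_left, inner_sub_right,
      inner_smul_left, inner_smul_right, Complex.conj_ofReal, Complex.add_re, Complex.sub_re,
      Complex.re_ofReal_mul] at h1 h2 h3 h4 h5 ⊢
    rw [h1, h2, h3, h4, h5]
    ring
  -- Since `(M₀ - t) K = -Γ⋆`, the substitution `φ + K u` removes the mixed term and replaces `R` by
  -- `R' = R + Γ K`.
  have h₂ : HasPosIndex q (n' + p) := by
    refine (hn'.prod hp (shiftForm_zero _ _) (shiftForm_zero _ _)).congr e₂ ?_
    rintro ⟨u, φ⟩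
    have h2 := congrArg Complex.re (hΓ u (K u))
    have h3 := congrArg Complex.re (hΓ u φ)
    have h4 := re_inner_comm u (Γ φ)
    have h5 := re_inner_comm u (Γ (K u))
    have h7 := re_inner_comm (Γs u) φ
    have h8 := congrArg Complex.re (hM φ (K u))
    simp only [q, e₂, shiftForm, LinearEquiv.coe_mk, LinearMap.coe_mk, AddHom.coe_mk, map_add, hK,
      hR', norm_sq_eq_inner_re, inner_add_left, inner_add_right, inner_sub_left, inner_sub_right,
      inner_smul_left, inner_smul_right, Complex.conj_ofReal, Complex.add_re, Complex.sub_re,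
      Complex.re_ofReal_mul] at h2 h3 h4 h5 h7 h8 ⊢
    linear_combination h8 + h7 - 2 * h3 - 2 * h4 - h2 - h5
  exact h₂.unique h₁

/-! ### Extensions defined by a boundary relation -/

/-- The extension of a boundary relation with parameter `t`: the pairs `(u, w)` for which there are
boundary values `(g, j)` with `j = t g` (`g = 0` if `t = ∞`). -/
def ext (D : Submodule ℂ (X × X × G × G)) : OnePoint ℝ → Submodule ℂ (X × X)
  | ∞ =>
    { carrier := {p | ∃ j, (p.1, p.2, 0, j) ∈ D}
      add_mem' := by
        rintro p q ⟨j, hj⟩ ⟨k, hk⟩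
        exact ⟨j + k, by simpa using D.add_mem hj hk⟩
      zero_mem' := ⟨0, D.zero_mem⟩
      smul_mem' := by
        rintro a p ⟨j, hj⟩
        exact ⟨a • j, by simpa using D.smul_mem a hj⟩ }
  | (t : ℝ) =>
    { carrier := {p | ∃ g, (p.1, p.2, g, (t : ℂ) • g) ∈ D}
      add_mem' := by
        rintro p q ⟨j, hj⟩ ⟨k, hk⟩
        exact ⟨j + k, by simpa using D.add_mem hj hk⟩
      zero_mem' := ⟨0, by rw [smul_zero]; exact D.zero_mem⟩
      smul_mem' := by
        rintro a p ⟨j, hj⟩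
        refine ⟨a • j, ?_⟩
        rw [smul_comm (t : ℂ) a j]
        exact D.smul_mem a hj }

theorem mem_ext_infty {D : Submodule ℂ (X × X × G × G)} {p : X × X} :
    p ∈ ext D ∞ ↔ ∃ j, (p.1, p.2, 0, j) ∈ D := Iff.rfl

theorem mem_ext_coe {D : Submodule ℂ (X × X × G × G)} {t : ℝ} {p : X × X} :
    p ∈ ext D (t : OnePoint ℝ) ↔ ∃ g, (p.1, p.2, g, (t : ℂ) • g) ∈ D := Iff.rfl

/-- The kernel of a linear relation minus `μ`. -/
def kerRel (r : Submodule ℂ (X × X)) (μ : ℝ) : Submodule ℂ X :=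
  r.comap (LinearMap.id.prod ((μ : ℂ) • LinearMap.id))

theorem mem_kerRel {r : Submodule ℂ (X × X)} {μ : ℝ} {u : X} :
    u ∈ kerRel r μ ↔ (u, (μ : ℂ) • u) ∈ r := Iff.rfl

/-- The inverse of the change of boundary values `(g, j) ↦ (j - r g, -g)`. -/
def rotateMap (r : ℝ) : (X × X × G × G) →ₗ[ℂ] (X × X × G × G) where
  toFun p := (p.1, p.2.1, -p.2.2.2, p.2.2.1 - (r : ℂ) • p.2.2.2)
  map_add' p q := by
    simp only [Prod.fst_add, Prod.snd_add, Prod.mk_add_mk, smul_add, neg_add, Prod.mk.injEq,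
      true_and]
    abel
  map_smul' a p := by
    simp only [Prod.smul_fst, Prod.smul_snd, Prod.smul_mk, smul_neg, smul_sub, RingHom.id_apply,
      smul_comm (r : ℂ) a]

/-- The boundary relation with boundary values `(j - r g, -g)`. -/
def rotate (r : ℝ) (D : Submodule ℂ (X × X × G × G)) : Submodule ℂ (X × X × G × G) :=
  D.comap (rotateMap r)

theorem mem_rotate {r : ℝ} {D : Submodule ℂ (X × X × G × G)} {u w : X} {g j : G} :
    (u, w, g, j) ∈ rotate r D ↔ (u, w, -j, g - (r : ℂ) • j) ∈ D := Iff.rfl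

/-- The boundary relation in which the parameter `t` takes the role of `∞`. -/
def reference (D : Submodule ℂ (X × X × G × G)) : OnePoint ℝ → Submodule ℂ (X × X × G × G)
  | ∞ => D
  | (t : ℝ) => rotate t D

/-- The parameter, with respect to the original boundary values, of the extension with parameter
`t` of the rotated boundary relation. -/
noncomputable def moebius (r t : ℝ) : OnePoint ℝ :=
  if t = 0 then ∞ else ((r - t⁻¹ : ℝ) : OnePoint ℝ)

theorem ext_reference_infty (D : Submodule ℂ (X × X × G × G)) (t : OnePoint ℝ) :
    ext (reference D t) ∞ = ext D t := by
  cases t with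
  | infty => rfl
  | coe t =>
    ext ⟨u, w⟩
    rw [mem_ext_infty, mem_ext_coe]
    constructor
    · rintro ⟨j, hj⟩
      have hj : (u, w, -j, (0 : G) - (t : ℂ) • j) ∈ D := hj
      exact ⟨-j, by simpa using hj⟩
    · rintro ⟨g, hg⟩
      refine ⟨-g, ?_⟩
      change (u, w, - -g, (0 : G) - (t : ℂ) • -g) ∈ D
      simpa using hg

/-- In the rotated boundary values the condition reads `-g = t (j - r g)`, that is `j = (r - t⁻¹)
g`, and `g = 0` for `t = 0`. -/
theorem ext_rotate (D : Submodule ℂ (X × X × G × G)) (r t : ℝ) :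
    ext (rotate r D) (t : OnePoint ℝ) = ext D (moebius r t) := by
  ext ⟨u, w⟩
  rw [mem_ext_coe, moebius]
  split_ifs with ht
  · subst ht
    rw [mem_ext_infty]
    refine exists_congr fun g => ?_
    rw [mem_rotate]
    simp
  · rw [mem_ext_coe]
    have ht' : (t : ℂ) ≠ 0 := by exact_mod_cast ht
    constructor
    · rintro ⟨g, hg⟩
      rw [mem_rotate] at hg
      refine ⟨-((t : ℂ) • g), ?_⟩
      convert hg using 4
      rw [← smul_neg, smul_smul, smul_smul, smul_neg, ← neg_smul]
      conv_rhs => rw [← one_smul ℂ g, smul_smul, ← sub_smul]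
      congr 1
      push_cast
      field_simp
      ring
    · rintro ⟨g, hg⟩
      refine ⟨-((t : ℂ)⁻¹ • g), ?_⟩
      rw [mem_rotate]
      convert hg using 4
      · rw [smul_neg, neg_neg, smul_smul, mul_inv_cancel₀ ht', one_smul]
      · rw [smul_neg, smul_neg, smul_smul, smul_smul, ← neg_smul, sub_neg_eq_add, ← add_smul]
        congr 1
        push_cast
        field_simp
        ring

/-- Green's identity for a boundary relation. -/
def IsGreen (D : Submodule ℂ (X × X × G × G)) : Prop :=
  ∀ p ∈ D, ∀ q ∈ D, inner ℂ p.2.1 q.1 - inner ℂ p.1 q.2.1 =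
    inner ℂ p.2.2.2 q.2.2.1 - inner ℂ p.2.2.1 q.2.2.2

/-- The boundary values are determined by the first component. -/
def IsDetermined (D : Submodule ℂ (X × X × G × G)) : Prop :=
  ∀ w g j, ((0 : X), w, g, j) ∈ D → w = 0 ∧ g = 0 ∧ j = 0

/-- The change of boundary values is a real matrix of determinant one, so it preserves the boundary
form. -/
theorem IsGreen.rotate {D : Submodule ℂ (X × X × G × G)} (hD : IsGreen D) (r : ℝ) :
    IsGreen (rotate r D) := by
  rintro ⟨u, w, g, j⟩ hp ⟨u', w', g', j'⟩ hq
  have h := hD _ (mem_rotate.1 hp) _ (mem_rotate.1 hq)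
  simp only at h ⊢
  rw [h]
  simp only [inner_neg_left, inner_neg_right, inner_sub_left, inner_sub_right, inner_smul_left,
    inner_smul_right, Complex.conj_ofReal]
  ring

theorem IsDetermined.rotate {D : Submodule ℂ (X × X × G × G)} (hD : IsDetermined D) (r : ℝ) :
    IsDetermined (rotate r D) := by
  intro w g j h
  obtain ⟨h1, h2, h3⟩ := hD _ _ _ (mem_rotate.1 h)
  have hj : j = 0 := by simpa using h2
  refine ⟨h1, by simpa [hj] using h3, hj⟩

/-- The solution operators at energy `μ`, for the inhomogeneous equation with boundary value `0`
and for the homogeneous equation with prescribed boundary value. -/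
structure Solution (D : Submodule ℂ (X × X × G × G)) (μ : ℝ) where
  R : X →L[ℂ] X
  Γs : X →ₗ[ℂ] G
  Γ : G →ₗ[ℂ] X
  M : G →ₗ[ℂ] G
  compact : IsCompactOperator R
  R_mem : ∀ w, (R w, w + (μ : ℂ) • R w, 0, Γs w) ∈ D
  Γ_mem : ∀ φ, (Γ φ, (μ : ℂ) • Γ φ, φ, M φ) ∈ D

namespace Solution

variable {D : Submodule ℂ (X × X × G × G)} {μ : ℝ}

theorem R_symm (S : Solution D μ) (hD : IsGreen D) : (S.R : X →ₗ[ℂ] X).IsSymmetric := by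
  intro w w'
  have h := hD _ (S.R_mem w) _ (S.R_mem w')
  simp only [inner_add_left, inner_add_right, inner_smul_left, inner_smul_right,
    Complex.conj_ofReal, inner_zero_left, inner_zero_right] at h
  simp only [ContinuousLinearMap.coe_coe]
  linear_combination -h

theorem M_symm (S : Solution D μ) (hD : IsGreen D) : S.M.IsSymmetric := by
  intro φ ψ
  have h := hD _ (S.Γ_mem φ) _ (S.Γ_mem ψ)
  simp only [inner_smul_left, inner_smul_right, Complex.conj_ofReal] at h
  linear_combination -h

/-- Green's identity between an inhomogeneous and a homogeneous solution: `Γs` is the adjoint of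
`Γ`. The terms in `μ` cancel because `μ` is real. -/
theorem inner_Γs (S : Solution D μ) (hD : IsGreen D) (w : X) (φ : G) :
    inner ℂ (S.Γs w) φ = inner ℂ w (S.Γ φ) := by
  have h := hD _ (S.R_mem w) _ (S.Γ_mem φ)
  simp only [inner_add_left, inner_smul_left, inner_smul_right, Complex.conj_ofReal,
    inner_zero_left] at h
  linear_combination -h

/-- Solvability forces uniqueness by symmetry: Green's identity between `u` and the solution with
right-hand side `u` gives `⟨u, u⟩ = 0`. -/
theorem eq_zero (S : Solution D μ) (hD : IsGreen D) (hD' : IsDetermined D) {u : X} {j : G}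
    (h : (u, (μ : ℂ) • u, 0, j) ∈ D) : u = 0 ∧ j = 0 := by
  have h1 := hD _ (S.R_mem u) _ h
  simp only [inner_add_left, inner_smul_left, inner_smul_right, Complex.conj_ofReal,
    inner_zero_left, inner_zero_right] at h1
  have hu : u = 0 := by
    rw [← inner_self_eq_zero (𝕜 := ℂ)]
    linear_combination h1
  subst hu
  exact ⟨rfl, (hD' _ _ _ h).2.2⟩

/-- Uniqueness for the inhomogeneous problem. -/
theorem eq_of_mem (S : Solution D μ) (hD : IsGreen D) (hD' : IsDetermined D) {u w : X} {g j : G}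
    (h : (u, w + (μ : ℂ) • u, g, j) ∈ D) : u = S.R w + S.Γ g ∧ j = S.Γs w + S.M g := by
  have h1 := D.sub_mem h (D.add_mem (S.R_mem w) (S.Γ_mem g))
  have h2 : (u - (S.R w + S.Γ g), (μ : ℂ) • (u - (S.R w + S.Γ g)), (0 : G),
      j - (S.Γs w + S.M g)) ∈ D := by
    convert h1 using 1
    simp only [Prod.mk_add_mk, Prod.mk_sub_mk, smul_sub, smul_add, zero_add, sub_self, Prod.mk.injEq,
      and_true, true_and]
    abel
  obtain ⟨h3, h4⟩ := S.eq_zero hD hD' h2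
  exact ⟨sub_eq_zero.1 h3, sub_eq_zero.1 h4⟩

theorem Γ_injective (S : Solution D μ) (hD' : IsDetermined D) : Function.Injective S.Γ := by
  rw [← LinearMap.ker_eq_bot, LinearMap.ker_eq_bot']
  intro φ h
  have h1 := S.Γ_mem φ
  rw [h] at h1
  exact (hD' _ _ _ h1).2.1

/-- A homogeneous solution at energy `μ` is determined by its boundary value `g` and has conjugate
boundary value `M g`, so `j = t g` becomes the eigenvalue equation `M g = t g`. -/
theorem kerRel_coe (S : Solution D μ) (hD : IsGreen D) (hD' : IsDetermined D) (t : ℝ) :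
    kerRel (ext D (t : OnePoint ℝ)) μ = (End.eigenspace S.M (t : ℂ)).map S.Γ := by
  ext u
  rw [mem_kerRel, mem_ext_coe, Submodule.mem_map]
  constructor
  · rintro ⟨g, hg⟩
    have hg' : (u, (0 : X) + (μ : ℂ) • u, g, (t : ℂ) • g) ∈ D := by simpa using hg
    obtain ⟨h1, h2⟩ := S.eq_of_mem hD hD' hg'
    simp only [map_zero, zero_add] at h1 h2
    exact ⟨g, End.mem_eigenspace_iff.2 h2.symm, h1.symm⟩
  · rintro ⟨φ, hφ, rfl⟩
    have h := S.Γ_mem φ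
    rw [End.mem_eigenspace_iff.1 hφ] at h
    exact ⟨φ, h⟩

theorem finrank_kerRel_coe (S : Solution D μ) (hD : IsGreen D) (hD' : IsDetermined D) (t : ℝ) :
    finrank ℂ (kerRel (ext D (t : OnePoint ℝ)) μ) = finrank ℂ (End.eigenspace S.M (t : ℂ)) := by
  rw [S.kerRel_coe hD hD']
  exact (Submodule.equivMapOfInjective S.Γ (S.Γ_injective hD') _).finrank_eq.symm

end Solution

end BoundaryRelation

namespace BoundaryRelation

open Module PosIndex

variable {X G : Type*} [NormedAddCommGroup X] [InnerProductSpace ℂ X]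
  [NormedAddCommGroup G] [InnerProductSpace ℂ G]

/-! ### Counting eigenvalues through compact resolvents -/

/-- A relation is symmetric. -/
def IsSymmRel (r : Submodule ℂ (X × X)) : Prop :=
  ∀ p ∈ r, ∀ q ∈ r, inner ℂ p.2 q.1 = inner ℂ p.1 q.2

theorem IsGreen.ext_symm {D : Submodule ℂ (X × X × G × G)} (hD : IsGreen D) (t : OnePoint ℝ) :
    IsSymmRel (ext D t) := by
  intro p hp q hq
  cases t with
  | infty =>
    obtain ⟨j, hj⟩ := mem_ext_infty.1 hp
    obtain ⟨k, hk⟩ := mem_ext_infty.1 hq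
    have h := hD _ hj _ hk
    simpa [sub_eq_zero] using h
  | coe t =>
    obtain ⟨j, hj⟩ := mem_ext_coe.1 hp
    obtain ⟨k, hk⟩ := mem_ext_coe.1 hq
    have h := hD _ hj _ hk
    simp only [inner_smul_left, inner_smul_right, Complex.conj_ofReal, sub_self] at h
    exact sub_eq_zero.1 h

/-- `R` is a right inverse of the relation `r - a`. -/
def IsRes (r : Submodule ℂ (X × X)) (a : ℝ) (R : X →L[ℂ] X) : Prop :=
  ∀ w, (R w, w + (a : ℂ) • R w) ∈ r

section Res

variable {r : Submodule ℂ (X × X)} {a : ℝ} {R : X →L[ℂ] X}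

theorem IsRes.kerRel_eq_bot (h : IsRes r a R) (hr : IsSymmRel r) : kerRel r a = ⊥ := by
  rw [eq_bot_iff]
  intro u hu
  have h1 := hr _ (h u) _ (mem_kerRel.1 hu)
  simp only [inner_add_left, inner_smul_left, inner_smul_right, Complex.conj_ofReal] at h1
  rw [Submodule.mem_bot, ← inner_self_eq_zero (𝕜 := ℂ)]
  linear_combination h1

theorem IsRes.eq_of_mem (h : IsRes r a R) (hr : IsSymmRel r) {u w : X}
    (hu : (u, w + (a : ℂ) • u) ∈ r) : R w = u := by
  have h1 : R w - u ∈ kerRel r a := by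
    rw [mem_kerRel]
    convert r.sub_mem (h w) hu using 1
    simp [smul_sub]
  rw [h.kerRel_eq_bot hr, Submodule.mem_bot, sub_eq_zero] at h1
  exact h1

theorem IsRes.symm (h : IsRes r a R) (hr : IsSymmRel r) : (R : X →ₗ[ℂ] X).IsSymmetric := by
  intro w w'
  have h1 := hr _ (h w) _ (h w')
  simp only [inner_add_left, inner_add_right, inner_smul_left, inner_smul_right,
    Complex.conj_ofReal] at h1
  simp only [ContinuousLinearMap.coe_coe]
  linear_combination -h1

theorem IsRes.kerRel_eq_eigenspace (h : IsRes r a R) (hr : IsSymmRel r) {ν : ℝ} (hν : ν ≠ a) :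
    kerRel r ν = End.eigenspace (R : X →ₗ[ℂ] X) (((ν - a)⁻¹ : ℝ) : ℂ) := by
  have hne : ((ν : ℂ) - a) ≠ 0 := by
    rw [sub_ne_zero]; exact_mod_cast hν
  ext u
  rw [mem_kerRel, End.mem_eigenspace_iff]
  push_cast
  constructor
  · intro hu
    have : R (((ν : ℂ) - a) • u) = u := by
      refine h.eq_of_mem hr ?_
      convert hu using 2
      rw [sub_smul, sub_add_cancel]
    rw [map_smul] at this
    conv_rhs => rw [← this]
    rw [smul_smul, inv_mul_cancel₀ hne, one_smul]
  · intro hu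
    have hu' : R u = ((ν : ℂ) - a)⁻¹ • u := hu
    have h1 := r.smul_mem ((ν : ℂ) - a) (h u)
    rw [hu'] at h1
    convert h1 using 1
    rw [Prod.smul_mk, smul_add, smul_comm _ (a : ℂ), smul_smul, mul_inv_cancel₀ hne, one_smul,
      ← add_smul, sub_add_cancel]

/-- Eigenvalues in the window correspond to the eigenvalues of the resolvent at `a` above the
threshold `(c - a)⁻¹`. -/
theorem bijOn_inv_sub {a c : ℝ} (hac : a < c) :
    BijOn (fun ν : ℝ => (ν - a)⁻¹) (Ioo a c) (Ioi (c - a)⁻¹) := by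
  refine ⟨fun ν hν => ?_, fun ν hν ν' hν' h => ?_, fun x hx => ?_⟩
  · exact (inv_lt_inv₀ (sub_pos.2 hac) (sub_pos.2 hν.1)).2 (by linarith [hν.2])
  · have := inv_injective h
    linarith
  · have hx0 : 0 < x := lt_trans (inv_pos.2 (sub_pos.2 hac)) hx
    refine ⟨a + x⁻¹, ⟨by simpa using hx0, ?_⟩, by simp⟩
    have := (inv_lt_comm₀ (sub_pos.2 hac) hx0).1 hx
    linarith

theorem IsRes.finite_kerRel_ne_bot [CompleteSpace X] (h : IsRes r a R) (hr : IsSymmRel r)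
    (hc : IsCompactOperator R) {c : ℝ} (hac : a < c) :
    {ν | ν ∈ Ico a c ∧ kerRel r ν ≠ ⊥}.Finite := by
  have := finiteDimensional_eigenspan (h.symm hr) hc (inv_pos.2 (sub_pos.2 hac))
  refine Finite.of_finite_image (f := fun ν : ℝ => (ν - a)⁻¹)
    ((finite_eigenspace_ne_bot (h.symm hr) (Ioi (c - a)⁻¹)).subset ?_) ?_
  · rintro _ ⟨ν, ⟨hν, hne⟩, rfl⟩
    have hνa : ν ≠ a := by rintro rfl; exact hne (h.kerRel_eq_bot hr)
    refine ⟨(bijOn_inv_sub hac).mapsTo ⟨lt_of_le_of_ne hν.1 hνa.symm, hν.2⟩, ?_⟩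
    rwa [← h.kerRel_eq_eigenspace hr hνa]
  · intro ν _ ν' _ h
    have := inv_injective h
    linarith

theorem IsRes.hasPosIndex [CompleteSpace X] (h : IsRes r a R) (hr : IsSymmRel r)
    (hc : IsCompactOperator R) {c : ℝ} (hac : a < c) :
    HasPosIndex (shiftForm (R : X →ₗ[ℂ] X) (c - a)⁻¹)
      (∑ᶠ ν ∈ Ico a c, finrank ℂ (kerRel r ν)) := by
  -- The endpoint `a` contributes nothing, because the kernel there is trivial.
  have h1 : ∑ᶠ ν ∈ Ico a c, finrank ℂ (kerRel r ν) = ∑ᶠ ν ∈ Ioo a c, finrank ℂ (kerRel r ν) := by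
    refine finsum_mem_inter_support_eq _ _ _ (Set.ext fun ν => ?_)
    simp only [mem_inter_iff, mem_Ico, mem_Ioo, Function.mem_support, and_congr_left_iff,
      and_congr_left_iff]
    intro hν _
    refine ⟨fun hle => lt_of_le_of_ne hle ?_, le_of_lt⟩
    rintro rfl
    rw [h.kerRel_eq_bot hr, finrank_bot] at hν
    exact hν rfl
  rw [h1, finsum_mem_eq_of_bijOn _ (bijOn_inv_sub hac)
    (g := fun ν => finrank ℂ (End.eigenspace (R : X →ₗ[ℂ] X) ((ν : ℝ) : ℂ)))
    (fun ν hν => by rw [h.kerRel_eq_eigenspace hr hν.1.ne'])]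
  exact hasPosIndex_of_isCompactOperator (h.symm hr) hc (inv_pos.2 (sub_pos.2 hac))

end Res

theorem Solution.isRes {D : Submodule ℂ (X × X × G × G)} {a : ℝ} (S : Solution D a) :
    IsRes (ext D ∞) a S.R := fun w => ⟨S.Γs w, S.R_mem w⟩

/-- This is `index_identity` at the threshold `x = (c - a)⁻¹`. Its hypotheses are two resolvent
formulas: `Γ(c) = R (c - a) Γ(c) + Γ(a)`, so that `L = (c - a) Γ(c)` turns `M(a)` into `M(c)`, and
Krein's formula `R' = R + Γ(a) K`. -/
theorem count_identity [CompleteSpace X] [FiniteDimensional ℂ G]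
    {D : Submodule ℂ (X × X × G × G)} (hD : IsGreen D) (hD' : IsDetermined D) {a c t : ℝ}
    (hac : a < c) (Sa : Solution D a) (Sc : Solution D c) {R' : X →L[ℂ] X}
    (hR' : IsRes (ext D (t : OnePoint ℝ)) a R') (hc' : IsCompactOperator R') :
    ∑ᶠ ν ∈ Ico a c, finrank ℂ (kerRel (ext D (t : OnePoint ℝ)) ν) +
      ∑ᶠ ν ∈ Ioi t, finrank ℂ (End.eigenspace Sa.M ((ν : ℝ) : ℂ)) =
    ∑ᶠ ν ∈ Ico a c, finrank ℂ (kerRel (ext D ∞) ν) +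
      ∑ᶠ ν ∈ Ioi t, finrank ℂ (End.eigenspace Sc.M ((ν : ℝ) : ℂ)) := by
  have hrange : ∀ w, (R' - Sa.R : X →L[ℂ] X) w ∈ LinearMap.range Sa.Γ := fun w => by
    obtain ⟨φ, hφ⟩ := mem_ext_coe.1 (hR' w)
    have : R' w = Sa.R w + Sa.Γ φ := (Sa.eq_of_mem hD hD' hφ).1
    exact ⟨φ, by simp [this]⟩
  -- `K w` is the boundary value of `R' w`; inverting the injective map `Sa.Γ` on its range makes
  -- this choice linear.
  let K : X →ₗ[ℂ] G := (LinearEquiv.ofInjective Sa.Γ (Sa.Γ_injective hD')).symm.toLinearMap ∘ₗ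
    LinearMap.codRestrict _ ((R' - Sa.R : X →L[ℂ] X) : X →ₗ[ℂ] X) hrange
  have hK : ∀ w, Sa.Γ (K w) = R' w - Sa.R w := fun w => by
    have := LinearEquiv.apply_symm_apply (LinearEquiv.ofInjective Sa.Γ (Sa.Γ_injective hD'))
      (LinearMap.codRestrict _ ((R' - Sa.R : X →L[ℂ] X) : X →ₗ[ℂ] X) hrange w)
    exact congrArg Subtype.val this
  have hac' : ((c : ℂ) - a) ≠ 0 := by
    rw [sub_ne_zero]; exact_mod_cast hac.ne'
  -- A homogeneous solution at energy `c` is an inhomogeneous one at energy `a` with right-hand side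
  -- `c - a` times itself.
  have hv : ∀ φ, Sc.Γ φ = Sa.R (((c : ℂ) - a) • Sc.Γ φ) + Sa.Γ φ ∧
      Sc.M φ = Sa.Γs (((c : ℂ) - a) • Sc.Γ φ) + Sa.M φ := fun φ => by
    refine Sa.eq_of_mem hD hD' ?_
    rw [sub_smul, sub_add_cancel]
    exact Sc.Γ_mem φ
  refine index_identity (R := Sa.R) (R' := R') (Γ := Sa.Γ) (L := ((c : ℂ) - a) • Sc.Γ)
    (Γs := Sa.Γs) (K := K) (M₀ := Sa.M) (M₁ := Sc.M) (x := (c - a)⁻¹) (t := t)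
    (Sa.R_symm hD) (Sa.M_symm hD) (Sa.inner_Γs hD) (fun φ => ?_) (fun φ => ?_) (fun u => ?_)
    (fun u => ?_)
    (Sa.isRes.hasPosIndex (hD.ext_symm _) Sa.compact hac) (hR'.hasPosIndex (hD.ext_symm _) hc' hac)
    (hasPosIndex_of_finiteDimensional (Sa.M_symm hD) t)
    (hasPosIndex_of_finiteDimensional (Sc.M_symm hD) t)
  · have h := (hv φ).1
    simp only [ContinuousLinearMap.coe_coe, LinearMap.smul_apply]
    push_cast
    rw [smul_smul, inv_mul_cancel₀ hac', one_smul]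
    exact eq_sub_of_add_eq h.symm
  · rw [(hv φ).2, add_comm]
    rfl
  · obtain ⟨φ, hφ⟩ := mem_ext_coe.1 (hR' u)
    obtain ⟨h1, h2⟩ := Sa.eq_of_mem hD hD' hφ
    simp only at h1
    have : K u = φ := Sa.Γ_injective hD' (by rw [hK, h1]; simp)
    rw [this]
    exact eq_sub_of_add_eq (by rw [h2, add_comm])
  · simp only [ContinuousLinearMap.coe_coe, hK]
    abel

end BoundaryRelation

namespace BoundaryRelation

open Module PosIndex MetricGraph

variable {X G : Type*} [NormedAddCommGroup X] [InnerProductSpace ℂ X]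
  [NormedAddCommGroup G] [InnerProductSpace ℂ G]

/-! ### The crossings of a family of extensions -/

/-- A boundary relation with Green's identity for which every injective extension `ext D t - μ`
has solution operators. -/
structure IsSystem (D : Submodule ℂ (X × X × G × G)) : Prop where
  green : IsGreen D
  det : IsDetermined D
  solv : ∀ (t : OnePoint ℝ) (μ : ℝ), kerRel (ext D t) μ = ⊥ → Nonempty (Solution (reference D t) μ)

theorem IsSystem.exists_isRes {D : Submodule ℂ (X × X × G × G)} (hD : IsSystem D) {t : OnePoint ℝ}
    {μ : ℝ} (h : kerRel (ext D t) μ = ⊥) :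
    ∃ R : X →L[ℂ] X, IsCompactOperator R ∧ IsRes (ext D t) μ R := by
  obtain ⟨S⟩ := hD.solv t μ h
  have h1 := S.isRes
  rw [ext_reference_infty] at h1
  exact ⟨S.R, S.compact, h1⟩

/-! ### The extended parameter line seen from a reference parameter. -/

theorem closeUp_coe (x : ℝ) : closeUp (x : EReal) = (x : OnePoint ℝ) := by
  simp [closeUp]

theorem closeUp_top : closeUp ⊤ = ∞ := by simp [closeUp]

theorem closeUp_bot : closeUp ⊥ = ∞ := by simp [closeUp]

/-- The extended real parameter of the extension with parameter `ν` of the rotated relation. -/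
noncomputable def moebiusEReal (r ν : ℝ) : EReal := if ν = 0 then ⊤ else ((r - ν⁻¹ : ℝ) : EReal)

theorem closeUp_moebiusEReal (r ν : ℝ) : closeUp (moebiusEReal r ν) = moebius r ν := by
  unfold moebiusEReal moebius
  split_ifs
  · exact closeUp_top
  · exact closeUp_coe _

theorem moebius_inv_sub {r x : ℝ} (h : x ≠ r) : moebius r (r - x)⁻¹ = (x : OnePoint ℝ) := by
  rw [moebius, if_neg (inv_ne_zero (sub_ne_zero.2 h.symm)), inv_inv, sub_sub_cancel]

theorem moebius_zero (r : ℝ) : moebius r 0 = ∞ := if_pos rfl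

theorem injective_moebiusEReal (r : ℝ) : Function.Injective (moebiusEReal r) := by
  intro ν ν' h
  unfold moebiusEReal at h
  split_ifs at h with h1 h2 h2
  · rw [h1, h2]
  · exact absurd h (EReal.coe_ne_top _).symm
  · exact absurd h (EReal.coe_ne_top _)
  · have := EReal.coe_injective h
    exact inv_injective (by linarith)

/-- The points to the left of the reference point `r`. -/
theorem exists_bijOn_left {r : ℝ} {p : EReal} (hp : p < r) :
    ∃ t : ℝ, moebius r t = closeUp p ∧ BijOn (moebiusEReal r) (Ioi t) (Ioo p r) := by
  induction p with
  | top => exact absurd hp (by simp)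
  | bot =>
    -- Under `ν ↦ r - ν⁻¹` positive `ν` lie to the left of `r` and negative `ν` to the right; both
    -- infinite ends have rotated parameter `0`.
    refine ⟨0, by rw [moebius_zero, closeUp_bot], ?_, (injective_moebiusEReal r).injOn, ?_⟩
    · intro ν hν
      have hν : 0 < ν := hν
      rw [moebiusEReal, if_neg hν.ne']
      exact ⟨EReal.bot_lt_coe _, EReal.coe_lt_coe (by have := inv_pos.2 hν; linarith)⟩
    · rintro τ ⟨h1, h2⟩
      lift τ to ℝ using ⟨ne_top_of_lt h2, h1.ne'⟩
      have h2 := EReal.coe_lt_coe_iff.1 h2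
      refine ⟨(r - τ)⁻¹, inv_pos.2 (sub_pos.2 h2), ?_⟩
      rw [moebiusEReal, if_neg (inv_ne_zero (sub_pos.2 h2).ne'), inv_inv, sub_sub_cancel]
  | coe x =>
    have hp := EReal.coe_lt_coe_iff.1 hp
    have hx : 0 < r - x := sub_pos.2 hp
    refine ⟨(r - x)⁻¹, by rw [moebius_inv_sub hp.ne, closeUp_coe], ?_,
      (injective_moebiusEReal r).injOn, ?_⟩
    · intro ν hν
      have hν : (r - x)⁻¹ < ν := hν
      have hν0 : 0 < ν := (inv_pos.2 hx).trans hν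
      rw [moebiusEReal, if_neg hν0.ne']
      have h1 := (inv_lt_comm₀ hx hν0).1 hν
      exact ⟨EReal.coe_lt_coe (by linarith), EReal.coe_lt_coe (by have := inv_pos.2 hν0; linarith)⟩
    · rintro τ ⟨h1, h2⟩
      lift τ to ℝ using ⟨ne_top_of_lt h2, ((EReal.bot_lt_coe x).trans h1).ne'⟩
      have h1 := EReal.coe_lt_coe_iff.1 h1
      have h2 := EReal.coe_lt_coe_iff.1 h2
      refine ⟨(r - τ)⁻¹, (inv_lt_inv₀ hx (sub_pos.2 h2)).2 (by linarith), ?_⟩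
      rw [moebiusEReal, if_neg (inv_ne_zero (sub_pos.2 h2).ne'), inv_inv, sub_sub_cancel]

/-- The points to the right of the reference point `r`. -/
theorem exists_bijOn_right {r : ℝ} {q : EReal} (hq : r < q) :
    ∃ t : ℝ, moebius r t = closeUp q ∧ BijOn (moebiusEReal r) (Iic t) (Ioc r q) := by
  have key : ∀ τ : ℝ, r < τ → moebiusEReal r (r - τ)⁻¹ = τ := fun τ h => by
    rw [moebiusEReal, if_neg (inv_ne_zero (sub_neg.2 h).ne), inv_inv, sub_sub_cancel]
  induction q with
  | bot => exact absurd hq (by simp)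
  | top =>
    -- `moebiusEReal` sends `0` to `⊤`, not `⊥`, so the closed ray `Iic 0` covers the right end as
    -- well.
    refine ⟨0, by rw [moebius_zero, closeUp_top], ?_, (injective_moebiusEReal r).injOn, ?_⟩
    · intro ν hν
      have hν : ν ≤ 0 := hν
      rw [moebiusEReal]
      split_ifs with h0
      · exact ⟨EReal.coe_lt_top _, le_rfl⟩
      · have := inv_lt_zero.2 (lt_of_le_of_ne hν h0)
        exact ⟨EReal.coe_lt_coe (by linarith), le_top⟩
    · rintro τ ⟨h1, h2⟩
      induction τ with
      | bot => exact absurd h1 (by simp)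
      | top => exact ⟨0, self_mem_Iic, if_pos rfl⟩
      | coe τ =>
        have h1 := EReal.coe_lt_coe_iff.1 h1
        exact ⟨(r - τ)⁻¹, (inv_lt_zero.2 (sub_neg.2 h1)).le, key τ h1⟩
  | coe x =>
    have hq := EReal.coe_lt_coe_iff.1 hq
    have hx : r - x < 0 := sub_neg.2 hq
    refine ⟨(r - x)⁻¹, by rw [moebius_inv_sub hq.ne', closeUp_coe], ?_,
      (injective_moebiusEReal r).injOn, ?_⟩
    · intro ν hν
      have hν : ν ≤ (r - x)⁻¹ := hν
      have hν0 : ν < 0 := hν.trans_lt (inv_lt_zero.2 hx)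
      rw [moebiusEReal, if_neg hν0.ne]
      have h1 := (le_inv_of_neg hν0 hx).1 hν
      have h2 := inv_lt_zero.2 hν0
      exact ⟨EReal.coe_lt_coe (by linarith), EReal.coe_le_coe (by linarith)⟩
    · rintro τ ⟨h1, h2⟩
      lift τ to ℝ using ⟨ne_top_of_le_ne_top (EReal.coe_ne_top x) h2,
        ((EReal.bot_lt_coe r).trans h1).ne'⟩
      have h1 := EReal.coe_lt_coe_iff.1 h1
      have h2 := EReal.coe_le_coe_iff.1 h2
      exact ⟨(r - τ)⁻¹, (inv_le_inv_of_neg (sub_neg.2 h1) hx).2 (by linarith), key τ h1⟩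

section Crossings

variable [FiniteDimensional ℂ G] {D : Submodule ℂ (X × X × G × G)}

theorem finsum_Ioi_add_Iic {A : G →ₗ[ℂ] G} (hA : A.IsSymmetric) (t : ℝ) :
    ∑ᶠ ν ∈ Ioi t, finrank ℂ (End.eigenspace A ((ν : ℝ) : ℂ)) +
      ∑ᶠ ν ∈ Iic t, finrank ℂ (End.eigenspace A ((ν : ℝ) : ℂ)) = finrank ℂ G := by
  have hfin : ∀ S : Set ℝ,
      (S ∩ Function.support fun ν : ℝ => finrank ℂ (End.eigenspace A (ν : ℂ))).Finite := fun S => by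
    refine (finite_eigenspace_ne_bot hA S).subset ?_
    rintro ν ⟨hν, h⟩
    refine ⟨hν, fun h0 => h ?_⟩
    change finrank ℂ (End.eigenspace A (ν : ℂ)) = 0
    rw [h0, finrank_bot]
  rw [← finsum_finrank_eigenspace hA, ← finsum_mem_union' _ (hfin _) (hfin _), union_comm,
    Iic_union_Ioi, finsum_mem_univ]
  exact Set.disjoint_left.2 fun x hx hx' => absurd (mem_Ioi.1 hx) (not_lt.2 hx')

/-- The multiplicity of the eigenvalue `c` as a function of the parameter. -/
noncomputable def mult (D : Submodule ℂ (X × X × G × G)) (c : ℝ) (τ : EReal) : ℕ :=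
  finrank ℂ (kerRel (ext D (closeUp τ)) c)

/-- The infinite ends are excluded by hypothesis, and the real parameters in the set are eigenvalues
of the matrix `M(c)`. -/
theorem IsSystem.finite_setOf_kerRel_ne_bot (hD : IsSystem D) {c : ℝ}
    (hc : kerRel (ext D ∞) c = ⊥) : {τ : EReal | kerRel (ext D (closeUp τ)) c ≠ ⊥}.Finite := by
  obtain ⟨S⟩ := hD.solv ∞ c hc
  refine ((finite_eigenspace_ne_bot (S.M_symm hD.green) univ).image ((↑) : ℝ → EReal)).subset ?_
  intro τ hτ
  induction τ with
  | bot => rw [mem_ofPred_eq, closeUp_bot] at hτ; exact absurd hc hτ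
  | top => rw [mem_ofPred_eq, closeUp_top] at hτ; exact absurd hc hτ
  | coe x =>
    refine ⟨x, ⟨mem_univ _, fun h => hτ ?_⟩, rfl⟩
    rw [closeUp_coe]
    have h1 := S.kerRel_coe hD.green hD.det x
    rw [h, Submodule.map_bot] at h1
    exact h1

theorem IsSystem.finite_support_mult (hD : IsSystem D) {c : ℝ}
    (hc : kerRel (ext D ∞) c = ⊥) : (Function.support (mult D c)).Finite := by
  refine (hD.finite_setOf_kerRel_ne_bot hc).subset fun τ hτ h => hτ ?_
  rw [mult, h, finrank_bot]

/-- The multiplicities at real parameters are those of the eigenvalues of the symmetric matrix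
`M(c)`, which add up to the dimension of `G`. -/
theorem IsSystem.finsum_mult (hD : IsSystem D) {c : ℝ} (hc : kerRel (ext D ∞) c = ⊥) :
    ∑ᶠ τ ∈ Ioc (⊥ : EReal) ⊤, mult D c τ = finrank ℂ G := by
  obtain ⟨S⟩ := hD.solv ∞ c hc
  rw [← finsum_finrank_eigenspace (S.M_symm hD.green), ← finsum_mem_univ fun ν : ℝ => finrank ℂ _]
  have h1 : ∑ᶠ τ ∈ Ioc (⊥ : EReal) ⊤, mult D c τ = ∑ᶠ τ ∈ Ioo (⊥ : EReal) ⊤, mult D c τ := by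
    refine finsum_mem_inter_support_eq' _ _ _ fun τ hτ => ?_
    refine ⟨fun h => ⟨h.1, lt_of_le_of_ne h.2 ?_⟩, fun h => ⟨h.1, h.2.le⟩⟩
    rintro rfl
    refine hτ ?_
    rw [mult, closeUp_top, hc, finrank_bot]
  rw [h1]
  refine (finsum_mem_eq_of_bijOn ((↑) : ℝ → EReal) ?_ fun x _ => ?_).symm
  · refine ⟨fun x _ => ⟨EReal.bot_lt_coe x, EReal.coe_lt_top x⟩, EReal.coe_injective.injOn, ?_⟩
    rintro τ ⟨h1, h2⟩
    lift τ to ℝ using ⟨h2.ne, h1.ne'⟩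
    exact ⟨τ, mem_univ _, rfl⟩
  · rw [mult, closeUp_coe]
    exact (S.finrank_kerRel_coe hD.green hD.det x).symm

/-- The change of the number of eigenvalues in a window over a piece of the parameter interval is
the number of crossings. -/
theorem IsSystem.count_sub_count [CompleteSpace X] (hD : IsSystem D) {a c : ℝ} (hac : a < c)
    (hc : kerRel (ext D ∞) c = ⊥) {p q : EReal} (hpq : p < q)
    (ha : ∀ τ ∈ Icc p q, kerRel (ext D (closeUp τ)) a = ⊥) :
    ∑ᶠ ν ∈ Ico a c, finrank ℂ (kerRel (ext D (closeUp p)) ν) =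
      ∑ᶠ ν ∈ Ico a c, finrank ℂ (kerRel (ext D (closeUp q)) ν) + ∑ᶠ τ ∈ Ioc p q, mult D c τ := by
  have hfin := hD.finite_support_mult hc
  -- The reference parameter only has to avoid the finitely many crossings of `c`; those of `a` are
  -- absent from the whole piece.
  obtain ⟨r, hpr, hrq, hr⟩ : ∃ r : ℝ, p < r ∧ r < q ∧ kerRel (ext D (r : OnePoint ℝ)) c = ⊥ := by
    obtain ⟨x, hpx, hxq⟩ := EReal.lt_iff_exists_real_btwn.1 hpq
    obtain ⟨y, hxy, hyq⟩ := EReal.lt_iff_exists_real_btwn.1 hxq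
    have hinf : (Ioo x y).Infinite := Ioo_infinite (EReal.coe_lt_coe_iff.1 hxy)
    have hfin' : {z : ℝ | kerRel (ext D (z : OnePoint ℝ)) c ≠ ⊥}.Finite := by
      refine Finite.of_finite_image ((hD.finite_setOf_kerRel_ne_bot hc).subset ?_)
        (EReal.coe_injective.injOn)
      rintro _ ⟨z, hz, rfl⟩
      rw [mem_ofPred_eq, closeUp_coe]
      exact hz
    obtain ⟨r, hr, hr'⟩ := (hinf.sdiff hfin').nonempty
    exact ⟨r, hpx.trans (EReal.coe_lt_coe hr.1), (EReal.coe_lt_coe hr.2).trans hyq,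
      not_not.1 hr'⟩
  obtain ⟨Sc⟩ := hD.solv r c hr
  have har := ha r ⟨hpr.le, hrq.le⟩
  rw [closeUp_coe] at har
  obtain ⟨Sa⟩ := hD.solv r a har
  change Solution (rotate r D) c at Sc
  change Solution (rotate r D) a at Sa
  have hG := hD.green.rotate r
  have hG' := hD.det.rotate r
  obtain ⟨t₀, ht₀, hb₀⟩ := exists_bijOn_left hpr
  obtain ⟨t₁, ht₁, hb₁⟩ := exists_bijOn_right hrq
  have hM : ∀ (μ : ℝ) (S : Solution (rotate r D) μ) (ν : ℝ),
      finrank ℂ (End.eigenspace S.M (ν : ℂ)) = mult D μ (moebiusEReal r ν) := fun μ S ν => by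
    rw [← S.finrank_kerRel_coe hG hG', ext_rotate, mult, closeUp_moebiusEReal]
  obtain ⟨R₀, hR₀, hR₀'⟩ := hD.exists_isRes (ha p ⟨le_rfl, hpq.le⟩)
  obtain ⟨R₁, hR₁, hR₁'⟩ := hD.exists_isRes (ha q ⟨hpq.le, le_rfl⟩)
  rw [← ht₀, ← ext_rotate] at hR₀'
  rw [← ht₁, ← ext_rotate] at hR₁'
  -- Both ends of the piece are compared with the reference `r`.
  have e₀ := count_identity hG hG' hac Sa Sc hR₀' hR₀
  have e₁ := count_identity hG hG' hac Sa Sc hR₁' hR₁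
  rw [ext_rotate, ht₀] at e₀
  rw [ext_rotate, ht₁] at e₁
  -- An eigenvalue of `Sa.M` in this range would be a crossing of `a` at a parameter in `(p, r)`;
  -- the next claim does the same on `(r, q]`.
  have ha₀ : ∑ᶠ ν ∈ Ioi t₀, finrank ℂ (End.eigenspace Sa.M ((ν : ℝ) : ℂ)) = 0 := by
    refine finsum_mem_eq_zero_of_forall_eq_zero fun ν hν => ?_
    have h := hb₀.mapsTo hν
    rw [hM, mult, ha _ ⟨h.1.le, (h.2.trans hrq).le⟩, finrank_bot]
  have ha₁ : ∑ᶠ ν ∈ Iic t₁, finrank ℂ (End.eigenspace Sa.M ((ν : ℝ) : ℂ)) = 0 := by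
    refine finsum_mem_eq_zero_of_forall_eq_zero fun ν hν => ?_
    have h := hb₁.mapsTo hν
    rw [hM, mult, ha _ ⟨(hpr.trans h.1).le, h.2⟩, finrank_bot]
  have hc₀ : ∑ᶠ ν ∈ Ioi t₀, finrank ℂ (End.eigenspace Sc.M ((ν : ℝ) : ℂ)) =
      ∑ᶠ τ ∈ Ioo p r, mult D c τ := finsum_mem_eq_of_bijOn _ hb₀ fun ν _ => hM c Sc ν
  have hc₁ : ∑ᶠ ν ∈ Iic t₁, finrank ℂ (End.eigenspace Sc.M ((ν : ℝ) : ℂ)) =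
      ∑ᶠ τ ∈ Ioc (r : EReal) q, mult D c τ := finsum_mem_eq_of_bijOn _ hb₁ fun ν _ => hM c Sc ν
  -- The point `r` carries no crossing. The interval is open at `p` and closed at `q` because the
  -- windows `[a, c)` do not count the eigenvalue `c` itself at either end.
  have hsplit : ∑ᶠ τ ∈ Ioc p q, mult D c τ =
      ∑ᶠ τ ∈ Ioo p (r : EReal), mult D c τ + ∑ᶠ τ ∈ Ioc (r : EReal) q, mult D c τ := by
    rw [← finsum_mem_union' _ (hfin.inter_of_right _) (hfin.inter_of_right _)]
    · refine finsum_mem_inter_support_eq' _ _ _ fun τ hτ => ?_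
      have hne : τ ≠ r := by
        rintro rfl
        refine hτ ?_
        rw [mult, closeUp_coe, hr, finrank_bot]
      constructor
      · rintro ⟨h1, h2⟩
        rcases lt_or_gt_of_ne hne with h | h
        · exact Or.inl ⟨h1, h⟩
        · exact Or.inr ⟨h, h2⟩
      · rintro (⟨h1, h2⟩ | ⟨h1, h2⟩)
        · exact ⟨h1, (h2.trans hrq).le⟩
        · exact ⟨hpr.trans h1, h2⟩
    · exact Set.disjoint_left.2 fun x hx hx' => lt_asymm hx.2 hx'.1
  -- At `q` the identity counts the eigenvalues above `t₁`, while crossings in `(r, q]` are those at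
  -- most `t₁`; the two counts are complementary in `dim G`.
  have f₁ := finsum_Ioi_add_Iic (Sa.M_symm hG) t₁
  have f₂ := finsum_Ioi_add_Iic (Sc.M_symm hG) t₁
  omega

end Crossings

end BoundaryRelation

namespace BoundaryRelation

open Module PosIndex MetricGraph UnboundedOp

variable {X G : Type*} [NormedAddCommGroup X] [InnerProductSpace ℂ X]
  [NormedAddCommGroup G] [InnerProductSpace ℂ G]

/-! ### The spectral flow of a family of extensions -/

/-- Unit eigenvectors for distinct eigenvalues are orthogonal, hence at distance `√2`, and a
separable space has only countably many disjoint balls of radius `1 / 2`. -/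
theorem IsSymmRel.countable_setOf_kerRel_ne_bot [TopologicalSpace.SeparableSpace X]
    {r : Submodule ℂ (X × X)} (hr : IsSymmRel r) : {μ : ℝ | kerRel r μ ≠ ⊥}.Countable := by
  have hex : ∀ μ ∈ {μ : ℝ | kerRel r μ ≠ ⊥}, ∃ u ∈ kerRel r μ, ‖u‖ = 1 := fun μ hμ => by
    obtain ⟨u, hu, h0⟩ := (Submodule.ne_bot_iff _).1 hμ
    exact ⟨((‖u‖ : ℂ)⁻¹) • u, Submodule.smul_mem _ _ hu, norm_smul_inv_norm h0⟩
  choose! e he hnorm using hex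
  refine Set.PairwiseDisjoint.countable_of_isOpen (s := fun μ => Metric.ball (e μ) (1 / 2))
    (fun μ hμ ν hν hne => ?_) (fun μ _ => Metric.isOpen_ball)
    (fun μ _ => ⟨e μ, Metric.mem_ball_self (by norm_num)⟩)
  have horth : inner ℂ (e μ) (e ν) = 0 := by
    have h := hr _ (mem_kerRel.1 (he μ hμ)) _ (mem_kerRel.1 (he ν hν))
    simp only [inner_smul_left, inner_smul_right, Complex.conj_ofReal] at h
    have hne' : (μ : ℂ) - ν ≠ 0 := by
      rw [sub_ne_zero]; exact_mod_cast hne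
    exact (mul_eq_zero.1 (by linear_combination h : ((μ : ℂ) - ν) * inner ℂ (e μ) (e ν) = 0)).resolve_left hne'
  refine Metric.ball_disjoint_ball ?_
  have h2 : ‖e μ - e ν‖ ^ 2 = 2 := by
    rw [@norm_sub_sq ℂ, horth, hnorm μ hμ, hnorm ν hν]
    norm_num
  rw [dist_eq_norm]
  nlinarith [norm_nonneg (e μ - e ν)]

/-! ### From relations back to operators and partition data. -/

theorem dimKer_eq_finrank {T : X →ₗ.[ℂ] X} {r : Submodule ℂ (X × X)} (h : T.graph = r) (μ : ℝ) :
    dimKer T (μ : ℂ) = finrank ℂ (kerRel r μ) := by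
  rw [dimKer, ← Submodule.finrank_map_subtype_eq]
  have : Submodule.map T.domain.subtype (LinearMap.ker (T.toFun - (μ : ℂ) • T.domain.subtype)) =
      kerRel r μ := by
    ext u
    rw [mem_kerRel, ← h, LinearPMap.mem_graph_iff, Submodule.mem_map]
    constructor
    · rintro ⟨y, hy, rfl⟩
      refine ⟨y, rfl, ?_⟩
      simpa [sub_eq_zero] using hy
    · rintro ⟨y, hy, hy'⟩
      refine ⟨y, ?_, hy⟩
      simp only at hy hy'
      rw [LinearMap.mem_ker, LinearMap.sub_apply, sub_eq_zero]
      change T y = (μ : ℂ) • (y : X)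
      rw [hy', hy]
  rw [this]

/-- A trivial kernel already yields a resolvent, so the real spectrum consists of eigenvalues. -/
theorem IsSystem.notMem_spec_iff {D : Submodule ℂ (X × X × G × G)} (hD : IsSystem D)
    {T : X →ₗ.[ℂ] X} {t : OnePoint ℝ} (h : T.graph = ext D t) {μ : ℝ} :
    (μ : ℂ) ∉ spec T ↔ kerRel (ext D t) μ = ⊥ := by
  have hmem : ∀ {u w : X}, (u, w) ∈ ext D t ↔ ∃ hu : u ∈ T.domain, T ⟨u, hu⟩ = w := by
    intro u w
    rw [← h, LinearPMap.mem_graph_iff]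
    constructor
    · rintro ⟨y, hy, hy'⟩
      simp only at hy hy'
      subst hy
      exact ⟨y.2, hy'⟩
    · rintro ⟨hu, hw⟩
      exact ⟨⟨u, hu⟩, rfl, hw⟩
  rw [spec, mem_ofPred_eq, not_not]
  constructor
  · rintro ⟨R, -, hR⟩
    rw [eq_bot_iff]
    intro u hu
    obtain ⟨hu, hw⟩ := hmem.1 (mem_kerRel.1 hu)
    have := hR ⟨u, hu⟩
    rw [hw] at this
    simpa using this.symm
  · intro hker
    obtain ⟨R, -, hR⟩ := hD.exists_isRes hker
    refine ⟨R, fun w => ?_, fun u => ?_⟩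
    · obtain ⟨h1, h2⟩ := hmem.1 (hR w)
      exact ⟨h1, by rw [h2, add_sub_cancel_right]⟩
    · refine hR.eq_of_mem (hD.green.ext_symm t) ?_
      rw [sub_add_cancel]
      exact hmem.2 ⟨u.2, rfl⟩

/-- Appending one piece to partition data. -/
theorem nonempty_flowPartition_snoc {H : EReal → (X →ₗ.[ℂ] X)} {p q q' : EReal} {c lo hi : ℝ}
    (hπ : Nonempty (FlowPartition H p q c)) (hq : q < q') (hlo : lo < c) (hhi : c < hi)
    (hlo' : ∀ τ ∈ Icc q q', (lo : ℂ) ∉ spec (H τ)) (hhi' : ∀ τ ∈ Icc q q', (hi : ℂ) ∉ spec (H τ)) :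
    Nonempty (FlowPartition H p q' c) := by
  obtain ⟨π⟩ := hπ
  refine ⟨{ N := π.N + 1
            t := Fin.snoc (α := fun _ => EReal) π.t q'
            strictMono := ?_
            first := ?_
            last := Fin.snoc_last ..
            lo := Fin.snoc (α := fun _ => ℝ) π.lo lo
            hi := Fin.snoc (α := fun _ => ℝ) π.hi hi
            lo_lt := ?_
            lt_hi := ?_
            lo_notMem := ?_
            hi_notMem := ?_ }⟩
  · rw [Fin.strictMono_iff_lt_succ]
    intro i
    refine Fin.lastCases ?_ (fun i => ?_) i
    · rw [Fin.succ_last, Fin.snoc_last, Fin.snoc_castSucc, π.last]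
      exact hq
    · rw [← Fin.castSucc_succ, Fin.snoc_castSucc, Fin.snoc_castSucc]
      exact π.strictMono Fin.castSucc_lt_succ
  · rw [← Fin.castSucc_zero, Fin.snoc_castSucc, π.first]
  · intro l
    refine Fin.lastCases ?_ (fun i => ?_) l
    · rwa [Fin.snoc_last]
    · rw [Fin.snoc_castSucc]; exact π.lo_lt i
  · intro l
    refine Fin.lastCases ?_ (fun i => ?_) l
    · rwa [Fin.snoc_last]
    · rw [Fin.snoc_castSucc]; exact π.lt_hi i
  · intro l
    refine Fin.lastCases ?_ (fun i => ?_) l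
    · rw [Fin.succ_last, Fin.snoc_last, Fin.snoc_castSucc, Fin.snoc_last, π.last]
      exact hlo'
    · rw [← Fin.castSucc_succ, Fin.snoc_castSucc, Fin.snoc_castSucc, Fin.snoc_castSucc]
      exact π.lo_notMem i
  · intro l
    refine Fin.lastCases ?_ (fun i => ?_) l
    · rw [Fin.succ_last, Fin.snoc_last, Fin.snoc_castSucc, Fin.snoc_last, π.last]
      exact hhi'
    · rw [← Fin.castSucc_succ, Fin.snoc_castSucc, Fin.snoc_castSucc, Fin.snoc_castSucc]
      exact π.hi_notMem i

theorem nonempty_flowPartition_self (H : EReal → (X →ₗ.[ℂ] X)) (p : EReal) (c : ℝ) :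
    Nonempty (FlowPartition H p p c) :=
  ⟨{ N := 0
     t := fun _ => p
     strictMono := fun i j h => absurd h (by rw [Fin.eq_zero i, Fin.eq_zero j]; exact lt_irrefl _)
     first := rfl
     last := rfl
     lo := Fin.elim0
     hi := Fin.elim0
     lo_lt := fun l => l.elim0
     lt_hi := fun l => l.elim0
     lo_notMem := fun l => l.elim0
     hi_notMem := fun l => l.elim0 }⟩

/-- Partition data exist as soon as every parameter has a neighbourhood with a common window. -/
theorem nonempty_flowPartition_of_local {H : EReal → (X →ₗ.[ℂ] X)} {c : ℝ}
    (hloc : ∀ τ : EReal, ∃ lo hi : ℝ, lo < c ∧ c < hi ∧ ∃ U : Set EReal, IsOpen U ∧ τ ∈ U ∧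
      ∀ σ ∈ U, (lo : ℂ) ∉ spec (H σ) ∧ (hi : ℂ) ∉ spec (H σ)) :
    Nonempty (FlowPartition H ⊥ ⊤ c) := by
  set s : Set EReal := {q | Nonempty (FlowPartition H ⊥ q c)} with hs
  have hbot : ⊥ ∈ s := nonempty_flowPartition_self H ⊥ c
  set x := sSup s with hx
  obtain ⟨lo, hi, hlo, hhi, U, hU, hxU, hspec⟩ := hloc x
  -- `x` is the supremum of the right endpoints that can be reached. Some reachable `q` is so close
  -- to `x` that one window serves all of `[q, x]`.
  obtain ⟨q, hqs, hqx⟩ : ∃ q ∈ s, Icc q x ⊆ U := by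
    by_cases hxb : x = ⊥
    · refine ⟨⊥, hbot, ?_⟩
      rw [hxb, Icc_self, singleton_subset_iff, ← hxb]
      exact hxU
    · obtain ⟨l, hl, hlU⟩ := exists_Ioc_subset_of_mem_nhds (hU.mem_nhds hxU)
        ⟨⊥, bot_lt_iff_ne_bot.2 hxb⟩
      obtain ⟨q, hq, hlq⟩ := lt_sSup_iff.1 hl
      exact ⟨q, hq, fun y hy => hlU ⟨hlq.trans_le hy.1, hy.2⟩⟩
  have hstep : ∀ y, q < y → Icc q y ⊆ U → y ∈ s := fun y hqy hy =>
    nonempty_flowPartition_snoc hqs hqy hlo hhi (fun τ hτ => (hspec τ (hy hτ)).1)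
      (fun τ hτ => (hspec τ (hy hτ)).2)
  have hqle : q ≤ x := le_sSup hqs
  have hxs : x ∈ s := by
    rcases hqle.eq_or_lt with h | h
    · rwa [← h]
    · exact hstep x h hqx
  by_cases hxt : x = ⊤
  · rw [hxt] at hxs
    exact hxs
  -- If `x` were not `⊤`, the same window would reach a point beyond the supremum.
  · obtain ⟨u, hu, huU⟩ := exists_Ico_subset_of_mem_nhds (hU.mem_nhds hxU)
      ⟨⊤, lt_top_iff_ne_top.2 hxt⟩
    obtain ⟨y, hxy, hyu⟩ := exists_between hu
    have hy : y ∈ s := by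
      refine hstep y (hqle.trans_lt hxy) fun z hz => ?_
      rcases le_total z x with h | h
      · exact hqx ⟨hz.1, h⟩
      · exact huU ⟨h, hz.2.trans_lt hyu⟩
    exact absurd (le_sSup hy) (not_le.2 hxy)

variable [FiniteDimensional ℂ G] [CompleteSpace X]

/-- Each piece contributes the increment of the function `A` that counts the crossings so far,
whatever the windows, and the sum telescopes to the total number of crossings. -/
theorem IsSystem.flow_eq {D : Submodule ℂ (X × X × G × G)} (hD : IsSystem D)
    {H : EReal → (X →ₗ.[ℂ] X)} (hH : ∀ τ, (H τ).graph = ext D (closeUp τ)) {c : ℝ}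
    (hc : kerRel (ext D ∞) c = ⊥) (π : FlowPartition H ⊥ ⊤ c) : π.flow = finrank ℂ G := by
  set A : EReal → ℤ := fun τ => ((∑ᶠ σ ∈ Ioc ⊥ τ, mult D c σ : ℕ) : ℤ) with hA
  have hfin := hD.finite_support_mult hc
  have hpiece : ∀ l : Fin π.N, ∑ᶠ α ∈ Ico (π.lo l) c,
      ((dimKer (H (π.t l.castSucc)) (α : ℂ) : ℤ) - (dimKer (H (π.t l.succ)) (α : ℂ) : ℤ)) =
      A (π.t l.succ) - A (π.t l.castSucc) := by
    intro l
    have hlt : π.t l.castSucc < π.t l.succ := π.strictMono Fin.castSucc_lt_succ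
    have ha : ∀ τ ∈ Icc (π.t l.castSucc) (π.t l.succ), kerRel (ext D (closeUp τ)) (π.lo l) = ⊥ :=
      fun τ hτ => (hD.notMem_spec_iff (hH τ)).1 (π.lo_notMem l τ hτ)
    have hcount := hD.count_sub_count (π.lo_lt l) hc hlt ha
    -- Finite support is needed to split the `finsum` of differences, since a `finsum` with infinite
    -- support is `0` by default.
    have hsupp : ∀ τ ∈ Icc (π.t l.castSucc) (π.t l.succ), (Ico (π.lo l) c ∩ Function.support
        fun α : ℝ => (finrank ℂ (kerRel (ext D (closeUp τ)) α) : ℤ)).Finite := fun τ hτ => by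
      obtain ⟨R, hR, hR'⟩ := hD.exists_isRes (ha τ hτ)
      refine (hR'.finite_kerRel_ne_bot (hD.green.ext_symm _) hR (π.lo_lt l)).subset ?_
      rintro ν ⟨hν, h⟩
      refine ⟨hν, fun h0 => h ?_⟩
      change (finrank ℂ (kerRel (ext D (closeUp τ)) ν) : ℤ) = 0
      rw [h0, finrank_bot, Nat.cast_zero]
    have hcast : ∀ τ ∈ Icc (π.t l.castSucc) (π.t l.succ),
        ∑ᶠ α ∈ Ico (π.lo l) c, (finrank ℂ (kerRel (ext D (closeUp τ)) α) : ℤ) =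
        ((∑ᶠ α ∈ Ico (π.lo l) c, finrank ℂ (kerRel (ext D (closeUp τ)) α) : ℕ) : ℤ) := fun τ hτ => by
      refine ((Nat.castAddMonoidHom ℤ).map_finsum_mem' ?_).symm
      refine (hsupp τ hτ).subset fun ν hν => ⟨hν.1, ?_⟩
      simpa using hν.2
    simp only [dimKer_eq_finrank (hH _)]
    have hl := left_mem_Icc.2 hlt.le
    have hr := right_mem_Icc.2 hlt.le
    have hsub : ∑ᶠ α ∈ Ico (π.lo l) c, ((finrank ℂ (kerRel (ext D (closeUp (π.t l.castSucc))) α) : ℤ)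
        - (finrank ℂ (kerRel (ext D (closeUp (π.t l.succ))) α) : ℤ)) +
        ∑ᶠ α ∈ Ico (π.lo l) c, (finrank ℂ (kerRel (ext D (closeUp (π.t l.succ))) α) : ℤ) =
        ∑ᶠ α ∈ Ico (π.lo l) c, (finrank ℂ (kerRel (ext D (closeUp (π.t l.castSucc))) α) : ℤ) := by
      rw [← finsum_mem_add_distrib' _ (hsupp _ hr)]
      · simp only [sub_add_cancel]
      · refine ((hsupp _ hl).union (hsupp _ hr)).subset ?_
        rw [← inter_union_distrib_left]
        exact inter_subset_inter_right _ (Function.support_sub _ _)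
    have hAadd : A (π.t l.succ) = A (π.t l.castSucc) +
        ((∑ᶠ σ ∈ Ioc (π.t l.castSucc) (π.t l.succ), mult D c σ : ℕ) : ℤ) := by
      simp only [hA]
      rw [← Nat.cast_add, ← finsum_mem_union' _ (hfin.inter_of_right _) (hfin.inter_of_right _),
        Ioc_union_Ioc_eq_Ioc bot_le hlt.le]
      exact Set.disjoint_left.2 fun x hx hx' => absurd hx.2 (not_le.2 hx'.1)
    rw [hcast _ hl, hcast _ hr, hcount] at hsub
    push_cast at hsub
    rw [hAadd]
    linarith
  have htel : ∀ (n : ℕ) (t : Fin (n + 1) → EReal),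
      ∑ l : Fin n, (A (t l.succ) - A (t l.castSucc)) = A (t (Fin.last n)) - A (t 0) := by
    intro n
    induction n with
    | zero => intro t; simp
    | succ n ih =>
      intro t
      rw [Fin.sum_univ_castSucc]
      have := ih fun i => t i.castSucc
      simp only [Fin.succ_castSucc]
      rw [this, Fin.succ_last, Fin.castSucc_zero]
      ring
  rw [FlowPartition.flow, Finset.sum_congr rfl fun l _ => hpiece l, htel, π.last, π.first]
  simp only [hA, Ioc_self, finsum_mem_empty, hD.finsum_mult hc]
  simp

/-- The spectral flow of the family of extensions of a boundary relation over the whole parameter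
interval is the dimension of the space of boundary values. -/
theorem IsSystem.hasSpectralFlow [TopologicalSpace.SeparableSpace X]
    {D : Submodule ℂ (X × X × G × G)} (hD : IsSystem D)
    {H : EReal → (X →ₗ.[ℂ] X)} (hH : ∀ τ, (H τ).graph = ext D (closeUp τ)) {c : ℝ}
    (hc : kerRel (ext D ∞) c = ⊥) : HasSpectralFlow H ⊥ ⊤ c (finrank ℂ G) := by
  refine ⟨nonempty_flowPartition_of_local fun τ => ?_, hD.flow_eq hH hc⟩
  -- Window ends avoid this countable set. Avoiding the eigenvalues at `∞` leaves only finitely many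
  -- parameters where a window end is an eigenvalue, so the good parameters form an open set.
  -- Avoiding those at `τ` puts `τ` into it.
  set bad : Set ℝ := {μ : ℝ | kerRel (ext D ∞) μ ≠ ⊥} ∪ {μ : ℝ | kerRel (ext D (closeUp τ)) μ ≠ ⊥}
  have hbad : bad.Countable :=
    (hD.green.ext_symm _).countable_setOf_kerRel_ne_bot.union
      (hD.green.ext_symm _).countable_setOf_kerRel_ne_bot
  have hex : ∀ x y : ℝ, x < y → ∃ z, x < z ∧ z < y ∧ z ∉ bad := fun x y hxy => by
    have h1 : (Ioo x y \ bad).Nonempty := by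
      rw [nonempty_iff_ne_empty, Ne, sdiff_eq_empty]
      intro h
      exact (Cardinal.Real.Ioo_countable_iff.1 (hbad.mono h)).not_gt hxy
    obtain ⟨z, hz, hz'⟩ := h1
    exact ⟨z, hz.1, hz.2, hz'⟩
  obtain ⟨lo, -, hlo, hlo'⟩ := hex (c - 1) c (by linarith)
  obtain ⟨hi, hhi, -, hhi'⟩ := hex c (c + 1) (by linarith)
  have hgood : ∀ z ∉ bad, IsOpen {σ | (z : ℂ) ∉ spec (H σ)} ∧ τ ∈ {σ | (z : ℂ) ∉ spec (H σ)} := by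
    intro z hz
    simp only [bad, mem_union, mem_ofPred_eq, not_or, not_not] at hz
    have : {σ | (z : ℂ) ∉ spec (H σ)} = {σ : EReal | kerRel (ext D (closeUp σ)) z ≠ ⊥}ᶜ := by
      ext σ
      rw [mem_compl_iff, mem_ofPred_eq, mem_ofPred_eq, not_not, hD.notMem_spec_iff (hH σ)]
    rw [this]
    exact ⟨(hD.finite_setOf_kerRel_ne_bot hz.1).isClosed.isOpen_compl, fun h => h hz.2⟩
  exact ⟨lo, hi, hlo, hhi, _, (hgood lo hlo').1.inter (hgood hi hhi').1,
    ⟨(hgood lo hlo').2, (hgood hi hhi').2⟩, fun σ hσ => hσ⟩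

end BoundaryRelation

/-! ## Primitives of square integrable functions on an interval -/

namespace EdgeOp

open scoped BoundedContinuousFunction ComplexConjugate

/-- `L²([0, ℓ])`. -/
abbrev EdgeL2 (ℓ : ℝ) : Type := Lp ℂ 2 (volume.restrict (Icc 0 ℓ))

variable {ℓ : ℝ}

theorem integrableOn_edge (w : EdgeL2 ℓ) : IntegrableOn w (Icc 0 ℓ) :=
  (Lp.memLp w).integrable (by norm_num)

theorem intervalIntegrable_edge (w : EdgeL2 ℓ) {x y : ℝ} (hx : x ∈ Icc 0 ℓ) (hy : y ∈ Icc 0 ℓ) :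
    IntervalIntegrable w volume x y := by
  rw [intervalIntegrable_iff]
  refine (integrableOn_edge w).mono_set (uIoc_subset_uIcc.trans ?_)
  exact (convex_Icc 0 ℓ).ordConnected.uIcc_subset hx hy

/-- Cauchy–Schwarz against the indicator function of the interval. It makes primitives Hölder
continuous of exponent `1 / 2`. -/
theorem norm_integral_le (w : EdgeL2 ℓ) {x y : ℝ} (hx : x ∈ Icc 0 ℓ) (hy : y ∈ Icc 0 ℓ)
    (hxy : x ≤ y) : ‖∫ z in x..y, w z‖ ≤ Real.sqrt (y - x) * ‖w‖ := by
  have hsub : Ioc x y ⊆ Icc 0 ℓ := fun z hz => ⟨hx.1.trans hz.1.le, hz.2.trans hy.2⟩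
  have hfin : (volume.restrict (Icc 0 ℓ)) (Ioc x y) ≠ ⊤ := measure_ne_top _ _
  have hmeas : (volume.restrict (Icc 0 ℓ)) (Ioc x y) = ENNReal.ofReal (y - x) := by
    rw [Measure.restrict_apply measurableSet_Ioc, inter_eq_left.2 hsub, Real.volume_Ioc]
  have h1 : ∫ z in x..y, w z = inner ℂ (indicatorConstLp 2 measurableSet_Ioc hfin (1 : ℂ)) w := by
    rw [L2.inner_indicatorConstLp_one measurableSet_Ioc hfin, intervalIntegral.integral_of_le hxy,
      Measure.restrict_restrict measurableSet_Ioc, inter_eq_left.2 hsub]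
  rw [h1]
  refine (norm_inner_le_norm _ _).trans ?_
  rw [norm_indicatorConstLp (by norm_num) (by norm_num), measureReal_def, hmeas,
    ENNReal.toReal_ofReal (sub_nonneg.2 hxy), norm_one, one_mul, ENNReal.toReal_ofNat,
    Real.sqrt_eq_rpow]

theorem dist_primitive_le (w : EdgeL2 ℓ) {x y : ℝ} (hx : x ∈ Icc 0 ℓ) (hy : y ∈ Icc 0 ℓ) :
    dist (∫ z in (0 : ℝ)..x, w z) (∫ z in (0 : ℝ)..y, w z) ≤ Real.sqrt |x - y| * ‖w‖ := by
  have h0 : (0 : ℝ) ∈ Icc 0 ℓ := ⟨le_rfl, hx.1.trans hx.2⟩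
  rw [dist_eq_norm]
  rcases le_total x y with h | h
  · rw [← norm_neg, neg_sub, intervalIntegral.integral_interval_sub_left
      (intervalIntegrable_edge w h0 hy) (intervalIntegrable_edge w h0 hx), abs_sub_comm,
      abs_of_nonneg (sub_nonneg.2 h)]
    exact norm_integral_le w hx hy h
  · rw [intervalIntegral.integral_interval_sub_left
      (intervalIntegrable_edge w h0 hx) (intervalIntegrable_edge w h0 hy),
      abs_of_nonneg (sub_nonneg.2 h)]
    exact norm_integral_le w hy hx h

theorem continuous_primitive (w : EdgeL2 ℓ) :
    Continuous fun x : Icc 0 ℓ => ∫ z in (0 : ℝ)..x, w z := by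
  rw [Metric.continuous_iff']
  intro x ε hε
  have hlim : Filter.Tendsto (fun y : Icc 0 ℓ => Real.sqrt |(y : ℝ) - x| * ‖w‖) (nhds x) (nhds 0) := by
    have : Continuous fun y : Icc 0 ℓ => Real.sqrt |(y : ℝ) - x| * ‖w‖ := by fun_prop
    simpa using this.tendsto x
  filter_upwards [hlim.eventually_lt_const hε] with y hy
  exact (dist_primitive_le w y.2 x.2).trans_lt hy

/-- The primitive, as a continuous function on the interval. -/
noncomputable def primitive (ℓ : ℝ) : EdgeL2 ℓ →ₗ[ℂ] (Icc 0 ℓ →ᵇ ℂ) where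
  toFun w := BoundedContinuousFunction.mkOfCompact ⟨_, continuous_primitive w⟩
  map_add' w w' := by
    ext x
    have h0 : (0 : ℝ) ∈ Icc 0 ℓ := ⟨le_rfl, x.2.1.trans x.2.2⟩
    change ∫ z in (0 : ℝ)..x, (w + w' : EdgeL2 ℓ) z = (∫ z in (0 : ℝ)..x, w z) + ∫ z in (0 : ℝ)..x, w' z
    rw [← intervalIntegral.integral_add (intervalIntegrable_edge w h0 x.2)
      (intervalIntegrable_edge w' h0 x.2)]
    refine intervalIntegral.integral_congr_ae ?_
    have h := (ae_restrict_iff' measurableSet_Icc).1 (Lp.coeFn_add w w')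
    filter_upwards [h] with z hz hzx
    rw [uIoc_of_le x.2.1] at hzx
    exact hz ⟨hzx.1.le, hzx.2.trans x.2.2⟩
  map_smul' a w := by
    ext x
    change ∫ z in (0 : ℝ)..x, (a • w : EdgeL2 ℓ) z = a • ∫ z in (0 : ℝ)..x, w z
    rw [← intervalIntegral.integral_smul]
    refine intervalIntegral.integral_congr_ae ?_
    have h := (ae_restrict_iff' measurableSet_Icc).1 (Lp.coeFn_smul a w)
    filter_upwards [h] with z hz hzx
    rw [uIoc_of_le x.2.1] at hzx
    exact hz ⟨hzx.1.le, hzx.2.trans x.2.2⟩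

theorem primitive_apply (w : EdgeL2 ℓ) (x : Icc 0 ℓ) :
    primitive ℓ w x = ∫ z in (0 : ℝ)..x, w z := rfl

/-- The class of the constant extension of a continuous function on the interval. -/
noncomputable def toEdgeL2 (hℓ : 0 ≤ ℓ) : (Icc 0 ℓ →ᵇ ℂ) →ₗ[ℂ] EdgeL2 ℓ where
  toFun f := BoundedContinuousFunction.toLp 2 (volume.restrict (Icc 0 ℓ)) ℂ
    (f.compContinuous ⟨projIcc 0 ℓ hℓ, continuous_projIcc⟩)
  map_add' f g := by rw [← map_add]; rfl
  map_smul' a f := by rw [← map_smul]; rfl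

theorem continuous_toEdgeL2 (hℓ : 0 ≤ ℓ) : Continuous (toEdgeL2 hℓ) :=
  (BoundedContinuousFunction.toLp 2 (volume.restrict (Icc 0 ℓ)) ℂ).continuous.comp
    (BoundedContinuousFunction.continuous_compContinuous _)

theorem toEdgeL2_ae (hℓ : 0 ≤ ℓ) (f : Icc 0 ℓ →ᵇ ℂ) :
    toEdgeL2 hℓ f =ᵐ[volume.restrict (Icc 0 ℓ)] fun x => f (projIcc 0 ℓ hℓ x) :=
  BoundedContinuousFunction.coeFn_toLp _ _ ℂ _

/-- Arzelà–Ascoli: primitives of the unit ball are bounded by `√ℓ` and share the modulus of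
continuity `√d`. -/
theorem isCompactOperator_volterra (hℓ : 0 ≤ ℓ) : IsCompactOperator (toEdgeL2 hℓ ∘ₗ primitive ℓ) := by
  rw [isCompactOperator_iff_image_closedBall_subset_compact _ one_pos]
  set A : Set (Icc 0 ℓ →ᵇ ℂ) := primitive ℓ '' Metric.closedBall 0 1 with hA
  have hcpt : IsCompact (closure A) := by
    refine BoundedContinuousFunction.arzela_ascoli (Metric.closedBall 0 (Real.sqrt ℓ))
      (isCompact_closedBall _ _) A ?_ ?_
    · rintro _ x ⟨w, hw, rfl⟩
      rw [mem_closedBall_zero_iff] at hw ⊢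
      rw [primitive_apply]
      refine (norm_integral_le w ⟨le_rfl, hℓ⟩ x.2 x.2.1).trans ?_
      rw [sub_zero]
      calc Real.sqrt x * ‖w‖ ≤ Real.sqrt ℓ * 1 := by
            gcongr
            exact x.2.2
        _ = Real.sqrt ℓ := mul_one _
    · refine Metric.equicontinuous_of_continuity_modulus (fun d => Real.sqrt d) ?_ _ ?_
      · have := Real.continuous_sqrt.tendsto 0
        rwa [Real.sqrt_zero] at this
      · rintro x y ⟨_, w, hw, rfl⟩
        rw [mem_closedBall_zero_iff] at hw
        refine (dist_primitive_le w x.2 y.2).trans ?_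
        rw [Subtype.dist_eq, Real.dist_eq]
        calc _ ≤ Real.sqrt |(x : ℝ) - y| * 1 := by gcongr
          _ = _ := mul_one _
  refine ⟨toEdgeL2 hℓ '' closure A, hcpt.image (continuous_toEdgeL2 hℓ), ?_⟩
  rintro _ ⟨w, hw, rfl⟩
  exact ⟨_, subset_closure ⟨w, hw, rfl⟩, rfl⟩

/-- The Volterra operator `w ↦ ∫₀ˣ w`. -/
noncomputable def volterra (hℓ : 0 ≤ ℓ) : EdgeL2 ℓ →L[ℂ] EdgeL2 ℓ :=
  ContinuousLinearMap.mkOfIsCompactOperator (isCompactOperator_volterra hℓ)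

theorem volterra_ae (hℓ : 0 ≤ ℓ) (w : EdgeL2 ℓ) :
    volterra hℓ w =ᵐ[volume.restrict (Icc 0 ℓ)] fun x => ∫ z in (0 : ℝ)..x, w z := by
  refine (toEdgeL2_ae hℓ (primitive ℓ w)).trans ?_
  filter_upwards [ae_restrict_mem measurableSet_Icc] with x hx
  rw [projIcc_of_mem hℓ hx, primitive_apply]

/-- The constant function `1`. -/
noncomputable def oneFun (ℓ : ℝ) : EdgeL2 ℓ :=
  indicatorConstLp 2 MeasurableSet.univ (measure_ne_top _ _) (1 : ℂ)

theorem oneFun_ae (ℓ : ℝ) : oneFun ℓ =ᵐ[volume.restrict (Icc 0 ℓ)] fun _ => (1 : ℂ) := by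
  refine indicatorConstLp_coeFn.trans ?_
  simp

/-- The integral over the interval. -/
noncomputable def total (ℓ : ℝ) : EdgeL2 ℓ →L[ℂ] ℂ := innerSL ℂ (oneFun ℓ)

theorem total_apply (hℓ : 0 ≤ ℓ) (w : EdgeL2 ℓ) : total ℓ w = ∫ z in (0 : ℝ)..ℓ, w z := by
  change inner ℂ (oneFun ℓ) w = _
  rw [oneFun, L2.inner_indicatorConstLp_one, Measure.restrict_univ,
    intervalIntegral.integral_of_le hℓ, integral_Icc_eq_integral_Ioc]

/-- A constant plus a primitive vanishes only if the constant and the function vanish. -/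
theorem eq_zero_of_add_volterra (hℓ : 0 < ℓ) {a : ℂ} {w : EdgeL2 ℓ}
    (h : a • oneFun ℓ + volterra hℓ.le w = 0) : a = 0 ∧ w = 0 := by
  have hcont : ContinuousOn (fun x => a + ∫ z in (0 : ℝ)..x, w z) (Icc 0 ℓ) := by
    rw [continuousOn_iff_continuous_domRestrict]
    exact continuous_const.add (continuous_primitive w)
  have hzero : EqOn (fun x => a + ∫ z in (0 : ℝ)..x, w z) 0 (Icc 0 ℓ) := by
    refine Measure.eqOn_Icc_of_ae_eq volume hℓ.ne ?_ hcont continuousOn_const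
    have h1 : (a • oneFun ℓ + volterra hℓ.le w : EdgeL2 ℓ) =ᵐ[volume.restrict (Icc 0 ℓ)] 0 := by
      rw [h]; exact Lp.coeFn_zero _ _ _
    filter_upwards [h1, Lp.coeFn_add (a • oneFun ℓ) (volterra hℓ.le w), Lp.coeFn_smul a (oneFun ℓ),
      oneFun_ae ℓ, volterra_ae hℓ.le w] with x h1 h2 h3 h4 h5
    rw [h2, Pi.add_apply, h3, Pi.smul_apply, h4, h5] at h1
    simpa using h1
  have ha : a = 0 := by simpa using hzero (left_mem_Icc.2 hℓ.le)
  refine ⟨ha, ?_⟩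
  subst ha
  have hwint := intervalIntegrable_edge w (left_mem_Icc.2 hℓ.le) (right_mem_Icc.2 hℓ.le)
  apply Lp.ext
  refine Filter.EventuallyEq.trans ?_ (Lp.coeFn_zero _ _ _).symm
  refine (ae_restrict_iff' measurableSet_Icc).2 ?_
  filter_upwards [hwint.ae_hasDerivAt_integral, Measure.ae_ne volume (0 : ℝ),
    Measure.ae_ne volume ℓ] with x hx hne hne' hxm
  rw [uIcc_of_le hℓ.le] at hx
  have h1 := hx hxm 0 (left_mem_Icc.2 hℓ.le)
  have h2 : HasDerivAt (fun x => ∫ y in (0 : ℝ)..x, w y) 0 x := by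
    refine (hasDerivAt_const x (0 : ℂ)).congr_of_eventuallyEq ?_
    filter_upwards [Icc_mem_nhds (lt_of_le_of_ne hxm.1 hne.symm) (lt_of_le_of_ne hxm.2 hne')]
      with y hy
    simpa using hzero hy
  exact h1.unique h2

/-! ### Integration by parts -/

/-- Used to dominate a complex primitive by the real primitive of the norm. -/
theorem absolutelyContinuous_of_dist_le {f : ℝ → ℂ} {g : ℝ → ℝ} {a b : ℝ}
    (hg : AbsolutelyContinuousOnInterval g a b)
    (h : ∀ x ∈ uIcc a b, ∀ y ∈ uIcc a b, dist (f x) (f y) ≤ dist (g x) (g y)) :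
    AbsolutelyContinuousOnInterval f a b := by
  unfold AbsolutelyContinuousOnInterval at hg ⊢
  refine squeeze_zero' (Filter.Eventually.of_forall fun _ =>
    Finset.sum_nonneg fun i _ => dist_nonneg) ?_ hg
  rw [Filter.eventually_inf_principal]
  filter_upwards with I hI
  refine Finset.sum_le_sum fun i hi => h _ (hI.1 i hi).1 _ (hI.1 i hi).2

theorem absolutelyContinuous_primitive {w : ℝ → ℂ} {ℓ : ℝ}
    (hw : IntervalIntegrable w volume 0 ℓ) (a : ℂ) :
    AbsolutelyContinuousOnInterval (fun x => a + ∫ z in (0 : ℝ)..x, w z) 0 ℓ := by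
  have hwint : ∀ x ∈ uIcc 0 ℓ, IntervalIntegrable w volume 0 x := fun x hx =>
    hw.mono_set (uIcc_subset_uIcc left_mem_uIcc hx)
  refine absolutelyContinuous_of_dist_le
    (hw.norm.absolutelyContinuousOnInterval_intervalIntegral (c := 0) left_mem_uIcc) ?_
  intro x hx y hy
  rw [dist_eq_norm, Real.dist_eq, add_sub_add_left_eq_sub,
    intervalIntegral.integral_interval_sub_left (hwint x hx) (hwint y hy),
    intervalIntegral.integral_interval_sub_left (hwint x hx).norm (hwint y hy).norm]
  exact intervalIntegral.norm_integral_le_abs_integral_norm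

/-- Integration by parts for primitives of integrable functions. -/
theorem integral_mul_add_mul {α β : ℝ → ℂ} {ℓ : ℝ} (hℓ : 0 ≤ ℓ) {A B : ℝ → ℂ}
    (hα : IntervalIntegrable α volume 0 ℓ) (hβ : IntervalIntegrable β volume 0 ℓ)
    (hA : ∀ x ∈ Icc 0 ℓ, A x = A 0 + ∫ z in (0 : ℝ)..x, α z)
    (hB : ∀ x ∈ Icc 0 ℓ, B x = B 0 + ∫ z in (0 : ℝ)..x, β z) :
    ∫ x in (0 : ℝ)..ℓ, (α x * B x + A x * β x) = A ℓ * B ℓ - A 0 * B 0 := by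
  -- `A` and `B` are constrained only on the interval; their primitives agree with them there and
  -- have derivatives almost everywhere in it, its endpoints not excluded.
  set A' : ℝ → ℂ := fun x => A 0 + ∫ z in (0 : ℝ)..x, α z with hA'
  set B' : ℝ → ℂ := fun x => B 0 + ∫ z in (0 : ℝ)..x, β z with hB'
  have hAc : AbsolutelyContinuousOnInterval A' 0 ℓ := absolutelyContinuous_primitive hα _
  have hBc : AbsolutelyContinuousOnInterval B' 0 ℓ := absolutelyContinuous_primitive hβ _
  have hwint : IntervalIntegrable (fun x => α x * B' x + A' x * β x) volume 0 ℓ :=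
    (hα.mul_continuousOn hBc.continuousOn).add (hβ.continuousOn_mul hAc.continuousOn)
  -- The product minus the primitive of its formal derivative is absolutely continuous with
  -- derivative `0` almost everywhere, hence constant.
  have hW : AbsolutelyContinuousOnInterval
      (fun x => A' x * B' x - (0 + ∫ z in (0 : ℝ)..x, (α z * B' z + A' z * β z))) 0 ℓ :=
    (hAc.smul hBc).sub (absolutelyContinuous_primitive hwint 0)
  obtain ⟨C, hC⟩ := hW.const_of_ae_hasDerivAt_zero (by
    filter_upwards [hα.ae_hasDerivAt_integral, hβ.ae_hasDerivAt_integral,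
      hwint.ae_hasDerivAt_integral] with x h1 h2 h3 hx
    have d1 : HasDerivAt A' (α x) x := (h1 hx 0 left_mem_uIcc).const_add _
    have d2 : HasDerivAt B' (β x) x := (h2 hx 0 left_mem_uIcc).const_add _
    have d3 := (h3 hx 0 left_mem_uIcc).const_add 0
    have d4 := (d1.mul d2).sub d3
    rw [sub_self] at d4
    exact d4)
  have e0 := hC 0 left_mem_uIcc
  have e1 := hC ℓ right_mem_uIcc
  have hcongr : ∫ x in (0 : ℝ)..ℓ, (α x * B x + A x * β x) =
      ∫ x in (0 : ℝ)..ℓ, (α x * B' x + A' x * β x) := by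
    refine intervalIntegral.integral_congr fun x hx => ?_
    rw [uIcc_of_le hℓ] at hx
    simp only [hA', hB']
    rw [← hA x hx, ← hB x hx]
  rw [hcongr, hA ℓ (right_mem_Icc.2 hℓ), hB ℓ (right_mem_Icc.2 hℓ)]
  simp only [intervalIntegral.integral_same, add_zero, zero_add, sub_zero] at e0 e1
  change _ = A' ℓ * B' ℓ - _
  have e0' : A' 0 * B' 0 = A 0 * B 0 := by simp [hA', hB']
  rw [← e0', e0, ← e1]
  ring

end EdgeOp

/-! ## The boundary relation of a metric graph -/

namespace MetricGraph

open EdgeOp BoundaryRelation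
open scoped ComplexConjugate

variable {V E : Type*}

section Edge

variable {Γ : MetricGraph V E}

theorem integral_congr_edge (Γ : MetricGraph V E) {e : E} {f g : ℝ → ℂ} (h : f =ᵐ[Γ.edgeMeasure e] g) {x : ℝ}
    (hx : x ∈ Icc 0 (Γ.len e)) : ∫ t in (0 : ℝ)..x, f t = ∫ t in (0 : ℝ)..x, g t := by
  refine intervalIntegral.integral_congr_ae ?_
  filter_upwards [(ae_restrict_iff' measurableSet_Icc).1 h] with z hz hzx
  rw [uIoc_of_le hx.1] at hzx
  exact hz ⟨hzx.1.le, hzx.2.trans hx.2⟩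

/-! ### Green's identity -/

/-- The sesquilinear Wronskian of two pairs (value, derivative). -/
noncomputable def wronskian (p q : ℂ × ℂ) : ℂ := conj p.2 * q.1 - conj p.1 * q.2

/-- A rotation by a real angle preserves the symplectic form on pairs (value, derivative). -/
theorem wronskian_eq_gam (s : OnePoint ℝ) (p q : ℂ × ℂ) :
    wronskian p q = conj (gamStar s p) * gam s q - conj (gam s p) * gamStar s q := by
  have h : (Real.cos (pruferAngle s) : ℂ) ^ 2 + (Real.sin (pruferAngle s) : ℂ) ^ 2 = 1 := by
    exact_mod_cast Real.cos_sq_add_sin_sq (pruferAngle s)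
  simp only [wronskian, gam, gamStar, map_add, map_sub, map_mul, Complex.conj_ofReal]
  linear_combination (-(conj p.2 * q.1 - conj p.1 * q.2)) * h

theorem conj_intervalIntegral (f : ℝ → ℂ) (a b : ℝ) :
    ∫ x in a..b, conj (f x) = conj (∫ x in a..b, f x) := by
  simp only [intervalIntegral, integral_conj, map_sub]

/-- Two integrations by parts, in which the products of first derivatives cancel. -/
theorem H2Fun.green_edge (F K : Γ.H2Fun) (e : E) :
    ∫ x in (0 : ℝ)..Γ.len e, (conj (-F.g e x) * K.f e x - conj (F.f e x) * (-K.g e x)) =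
      wronskian (F.traces e).1 (K.traces e).1 - wronskian (F.traces e).2 (K.traces e).2 := by
  have hl := (Γ.len_pos e).le
  have hm := right_mem_Icc.2 hl
  have hconj : ∀ {f : ℝ → ℂ}, IntervalIntegrable f volume 0 (Γ.len e) →
      IntervalIntegrable (fun x => conj (f x)) volume 0 (Γ.len e) := fun h => by
    rw [intervalIntegrable_iff] at h ⊢
    exact Complex.conjCLE.toContinuousLinearMap.integrable_comp h
  have hFg := F.intervalIntegrable_g e hm
  have hFd := F.intervalIntegrable_d e hm
  have hKg := K.intervalIntegrable_g e hm
  have hKd := K.intervalIntegrable_d e hm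
  have h1 := integral_mul_add_mul (A := fun x => conj (F.d e x)) (B := K.f e) hl (hconj hFg) hKd
    (fun x hx => by rw [conj_intervalIntegral, ← map_add, ← F.d_eq e x hx]) (K.f_eq e)
  have h2 := integral_mul_add_mul (A := fun x => conj (F.f e x)) (B := K.d e) hl (hconj hFd) hKg
    (fun x hx => by rw [conj_intervalIntegral, ← map_add, ← F.f_eq e x hx]) (K.d_eq e)
  have hcf : ContinuousOn (fun x => conj (F.f e x)) (uIcc 0 (Γ.len e)) := by
    rw [uIcc_of_le hl]
    exact Complex.continuous_conj.comp_continuousOn (F.continuousOn_f e)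
  have hcd : ContinuousOn (fun x => conj (F.d e x)) (uIcc 0 (Γ.len e)) := by
    rw [uIcc_of_le hl]
    exact Complex.continuous_conj.comp_continuousOn (F.continuousOn_d e)
  have hkf : ContinuousOn (K.f e) (uIcc 0 (Γ.len e)) := by
    rw [uIcc_of_le hl]; exact K.continuousOn_f e
  have hkd : ContinuousOn (K.d e) (uIcc 0 (Γ.len e)) := by
    rw [uIcc_of_le hl]; exact K.continuousOn_d e
  have hsub := intervalIntegral.integral_sub
    (((hconj hFd).mul_continuousOn hkd).add (hKg.continuousOn_mul hcf))
    (((hconj hFg).mul_continuousOn hkf).add (hKd.continuousOn_mul hcd))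
  rw [h1, h2] at hsub
  simp only [H2Fun.traces, wronskian]
  refine Eq.trans ?_ (hsub.trans (by ring))
  refine intervalIntegral.integral_congr fun x _ => ?_
  simp only [map_neg]
  ring

theorem inner_edge {e : E} {u w : Lp ℂ 2 (Γ.edgeMeasure e)} {f g : ℝ → ℂ}
    (hu : u =ᵐ[Γ.edgeMeasure e] f) (hw : w =ᵐ[Γ.edgeMeasure e] g) :
    inner ℂ u w = ∫ x in (0 : ℝ)..Γ.len e, conj (f x) * g x := by
  rw [L2.inner_def, intervalIntegral.integral_of_le (Γ.len_pos e).le,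
    ← integral_Icc_eq_integral_Ioc]
  refine integral_congr_ae ?_
  filter_upwards [hu, hw] with x h1 h2
  rw [h1, h2, RCLike.inner_apply, mul_comm]

end Edge

variable [Fintype E]

/-- Initial data: for each edge, the value and the derivative at its start. -/
abbrev Init (E : Type*) : Type _ := E → ℂ × ℂ

/-! ### The initial value problem `-f'' = w` on the edges. -/

section Solve

variable (Γ : MetricGraph V E)

/-- The derivative on the edge `e` of the solution of `-f'' = w` with given initial data. -/
noncomputable def edgeDeriv (e : E) : (Γ.L2 × Init E) →L[ℂ] EdgeL2 (Γ.len e) :=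
  ((ContinuousLinearMap.snd ℂ ℂ ℂ ∘L ContinuousLinearMap.proj e) ∘L
    ContinuousLinearMap.snd ℂ Γ.L2 (Init E)).smulRight (oneFun (Γ.len e)) -
  volterra (Γ.len_pos e).le ∘L (PiLp.proj 2 (fun e : E => Lp ℂ 2 (Γ.edgeMeasure e)) e ∘L
    ContinuousLinearMap.fst ℂ Γ.L2 (Init E))

/-- The solution on the edge `e` of `-f'' = w` with given initial data. -/
noncomputable def edgeSol (e : E) : (Γ.L2 × Init E) →L[ℂ] EdgeL2 (Γ.len e) :=
  ((ContinuousLinearMap.fst ℂ ℂ ℂ ∘L ContinuousLinearMap.proj e) ∘L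
    ContinuousLinearMap.snd ℂ Γ.L2 (Init E)).smulRight (oneFun (Γ.len e)) +
  volterra (Γ.len_pos e).le ∘L Γ.edgeDeriv e

/-- The solution operator of `-f'' = w` with given initial data. -/
noncomputable def sol : (Γ.L2 × Init E) →L[ℂ] Γ.L2 :=
  (PiLp.continuousLinearEquiv 2 ℂ (fun e : E => Lp ℂ 2 (Γ.edgeMeasure e))).symm.toContinuousLinearMap
    ∘L ContinuousLinearMap.pi fun e => Γ.edgeSol e

/-- The boundary data of the solution of `-f'' = w` with given initial data. -/
noncomputable def tr : (Γ.L2 × Init E) →L[ℂ] Traces E :=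
  ContinuousLinearMap.pi fun e =>
    (ContinuousLinearMap.proj e ∘L ContinuousLinearMap.snd ℂ Γ.L2 (Init E)).prod
    (((ContinuousLinearMap.fst ℂ ℂ ℂ ∘L ContinuousLinearMap.proj e) ∘L
        ContinuousLinearMap.snd ℂ Γ.L2 (Init E) + total (Γ.len e) ∘L Γ.edgeDeriv e).prod
      ((ContinuousLinearMap.snd ℂ ℂ ℂ ∘L ContinuousLinearMap.proj e) ∘L
        ContinuousLinearMap.snd ℂ Γ.L2 (Init E) -
        total (Γ.len e) ∘L (PiLp.proj 2 (fun e : E => Lp ℂ 2 (Γ.edgeMeasure e)) e ∘L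
          ContinuousLinearMap.fst ℂ Γ.L2 (Init E))))

theorem edgeDeriv_apply (e : E) (y : Γ.L2 × Init E) :
    Γ.edgeDeriv e y = (y.2 e).2 • oneFun (Γ.len e) - volterra (Γ.len_pos e).le (y.1 e) := rfl

theorem edgeSol_apply (e : E) (y : Γ.L2 × Init E) :
    Γ.edgeSol e y = (y.2 e).1 • oneFun (Γ.len e) + volterra (Γ.len_pos e).le (Γ.edgeDeriv e y) := rfl

theorem sol_apply (e : E) (y : Γ.L2 × Init E) : Γ.sol y e = Γ.edgeSol e y := rfl

theorem tr_apply (e : E) (y : Γ.L2 × Init E) : Γ.tr y e =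
    (y.2 e, ((y.2 e).1 + total (Γ.len e) (Γ.edgeDeriv e y), (y.2 e).2 - total (Γ.len e) (y.1 e))) :=
  rfl

/-- A rank-one term from the initial value, plus the compact Volterra operator applied to the
bounded `Γ.edgeDeriv e`. -/
theorem isCompactOperator_edgeSol (e : E) : IsCompactOperator (Γ.edgeSol e) := by
  let a : (Γ.L2 × Init E) →L[ℂ] ℂ := (ContinuousLinearMap.fst ℂ ℂ ℂ ∘L
    ContinuousLinearMap.proj e) ∘L ContinuousLinearMap.snd ℂ Γ.L2 (Init E)
  let b : ℂ →L[ℂ] EdgeL2 (Γ.len e) := (ContinuousLinearMap.id ℂ ℂ).smulRight (oneFun (Γ.len e))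
  have h1 : IsCompactOperator (b ∘ a) :=
    (isCompactOperator_of_locallyCompactSpace_dom a).clm_comp b
  have h2 : IsCompactOperator ((toEdgeL2 (Γ.len_pos e).le ∘ₗ primitive (Γ.len e)) ∘ Γ.edgeDeriv e) :=
    (isCompactOperator_volterra (Γ.len_pos e).le).comp_clm (Γ.edgeDeriv e)
  have h3 : ⇑(Γ.edgeSol e) = (b ∘ a) +
      ((toEdgeL2 (Γ.len_pos e).le ∘ₗ primitive (Γ.len e)) ∘ Γ.edgeDeriv e) := by
    funext y
    exact Γ.edgeSol_apply e y
  rw [h3]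
  exact h1.add h2

theorem isCompactOperator_sol : IsCompactOperator Γ.sol := by
  choose K hK hK' using fun e => Γ.isCompactOperator_edgeSol e
  refine ⟨(PiLp.continuousLinearEquiv 2 ℂ (fun e : E => Lp ℂ 2 (Γ.edgeMeasure e))).symm ''
    univ.pi K, (isCompact_univ_pi hK).image (ContinuousLinearEquiv.continuous _), ?_⟩
  filter_upwards [Filter.eventually_all.2 hK'] with y hy
  exact ⟨fun e => Γ.edgeSol e y, fun e _ => hy e, rfl⟩

/-- The solution, and then its derivative, is a constant plus a primitive, so
`eq_zero_of_add_volterra` applies twice. -/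
theorem eq_zero_of_sol_eq_zero {y : Γ.L2 × Init E} (h : Γ.sol y = 0) : y = 0 := by
  have key : ∀ e, (y.2 e).1 = 0 ∧ (y.2 e).2 = 0 ∧ y.1 e = 0 := fun e => by
    have h1 : Γ.edgeSol e y = 0 := by
      rw [← sol_apply, h]; rfl
    rw [edgeSol_apply] at h1
    obtain ⟨h2, h3⟩ := eq_zero_of_add_volterra (Γ.len_pos e) h1
    rw [edgeDeriv_apply, sub_eq_add_neg, ← map_neg] at h3
    obtain ⟨h4, h5⟩ := eq_zero_of_add_volterra (Γ.len_pos e) h3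
    exact ⟨h2, h4, neg_eq_zero.1 h5⟩
  refine Prod.ext ?_ ?_
  · ext1 e
    exact (key e).2.2
  · funext e
    exact Prod.ext (key e).1 (key e).2.1

/-- The `H²` function solving `-f'' = w` with given initial data. -/
noncomputable def solveFun (y : Γ.L2 × Init E) : Γ.H2Fun where
  f e x := (y.2 e).1 + ∫ t in (0 : ℝ)..x, ((y.2 e).2 + ∫ r in (0 : ℝ)..t, -(y.1 e) r)
  d e x := (y.2 e).2 + ∫ r in (0 : ℝ)..x, -(y.1 e) r
  g e := -(y.1 e)
  memLp e := (Lp.memLp (y.1 e)).neg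
  f_eq e x _ := by simp
  d_eq e x _ := by simp

theorem edgeDeriv_ae (e : E) (y : Γ.L2 × Init E) :
    Γ.edgeDeriv e y =ᵐ[Γ.edgeMeasure e] (Γ.solveFun y).d e := by
  rw [edgeDeriv_apply]
  filter_upwards [Lp.coeFn_sub ((y.2 e).2 • oneFun (Γ.len e)) (volterra (Γ.len_pos e).le (y.1 e)),
    Lp.coeFn_smul (y.2 e).2 (oneFun (Γ.len e)), oneFun_ae (Γ.len e),
    volterra_ae (Γ.len_pos e).le (y.1 e)] with x h1 h2 h3 h4
  rw [h1, Pi.sub_apply, h2, Pi.smul_apply, h3, h4]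
  simp [solveFun, sub_eq_add_neg]

theorem sol_ae (e : E) (y : Γ.L2 × Init E) :
    Γ.sol y e =ᵐ[Γ.edgeMeasure e] (Γ.solveFun y).f e := by
  rw [sol_apply, edgeSol_apply]
  filter_upwards [Lp.coeFn_add ((y.2 e).1 • oneFun (Γ.len e))
      (volterra (Γ.len_pos e).le (Γ.edgeDeriv e y)),
    Lp.coeFn_smul (y.2 e).1 (oneFun (Γ.len e)), oneFun_ae (Γ.len e),
    volterra_ae (Γ.len_pos e).le (Γ.edgeDeriv e y), ae_restrict_mem measurableSet_Icc]
    with x h1 h2 h3 h4 hx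
  rw [h1, Pi.add_apply, h2, Pi.smul_apply, h3, h4, Γ.integral_congr_edge (Γ.edgeDeriv_ae e y) hx]
  simp [solveFun]

theorem traces_solveFun (y : Γ.L2 × Init E) : (Γ.solveFun y).traces = Γ.tr y := by
  funext e
  have hl := right_mem_Icc.2 (Γ.len_pos e).le
  rw [tr_apply, total_apply (Γ.len_pos e).le, total_apply (Γ.len_pos e).le,
    Γ.integral_congr_edge (Γ.edgeDeriv_ae e y) hl]
  simp [solveFun, H2Fun.traces, sub_eq_add_neg]

/-- The initial data of an `H²` function. -/
def H2Fun.initData {Γ : MetricGraph V E} (F : Γ.H2Fun) : Init E := fun e => (F.f e 0, F.d e 0)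

variable {Γ}

theorem H2Fun.d_eq_solveFun (F : Γ.H2Fun) {w : Γ.L2}
    {e : E} (hw : w e =ᵐ[Γ.edgeMeasure e] -F.g e) {x : ℝ} (hx : x ∈ Icc 0 (Γ.len e)) :
    F.d e x = (Γ.solveFun (w, F.initData)).d e x := by
  rw [F.d_eq e x hx]
  simp only [solveFun, H2Fun.initData]
  congr 1
  refine Γ.integral_congr_edge ?_ hx
  filter_upwards [hw] with z hz
  rw [hz]
  simp

theorem H2Fun.f_eq_solveFun (F : Γ.H2Fun) {w : Γ.L2}
    {e : E} (hw : w e =ᵐ[Γ.edgeMeasure e] -F.g e) {x : ℝ} (hx : x ∈ Icc 0 (Γ.len e)) :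
    F.f e x = (Γ.solveFun (w, F.initData)).f e x := by
  rw [F.f_eq e x hx, (Γ.solveFun (w, F.initData)).f_eq e x hx]
  congr 1
  · simp [solveFun, H2Fun.initData]
  · refine intervalIntegral.integral_congr fun z hz => ?_
    rw [uIcc_of_le hx.1] at hz
    exact F.d_eq_solveFun hw ⟨hz.1, hz.2.trans hx.2⟩

theorem H2Fun.traces_eq_tr (F : Γ.H2Fun) {w : Γ.L2} (hw : ∀ e, w e =ᵐ[Γ.edgeMeasure e] -F.g e) :
    F.traces = Γ.tr (w, F.initData) := by
  rw [← traces_solveFun]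
  funext e
  have h0 := left_mem_Icc.2 (Γ.len_pos e).le
  have h1 := right_mem_Icc.2 (Γ.len_pos e).le
  simp only [H2Fun.traces]
  rw [F.f_eq_solveFun (hw e) h0, F.f_eq_solveFun (hw e) h1, F.d_eq_solveFun (hw e) h0,
    F.d_eq_solveFun (hw e) h1]

theorem H2Fun.eq_sol (F : Γ.H2Fun) {u w : Γ.L2} (hu : ∀ e, u e =ᵐ[Γ.edgeMeasure e] F.f e)
    (hw : ∀ e, w e =ᵐ[Γ.edgeMeasure e] -F.g e) : u = Γ.sol (w, F.initData) := by
  ext1 e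
  apply Lp.ext
  refine (hu e).trans (Filter.EventuallyEq.trans ?_ (Γ.sol_ae e (w, F.initData)).symm)
  filter_upwards [ae_restrict_mem measurableSet_Icc] with x hx
  exact F.f_eq_solveFun (hw e) hx

/-- Uniqueness for the initial value problem replaces `H²` functions by pairs of a right-hand side
and finitely many initial data, so that vertex conditions become linear equations on such pairs. -/
theorem mem_deltaGraph_iff {s : OnePoint ℝ} {B : Finset V} {t : OnePoint ℝ} {u w : Γ.L2} :
    (u, w) ∈ Γ.deltaGraph s B t ↔
      ∃ z : Init E, u = Γ.sol (w, z) ∧ Γ.IsDeltaData s B t (Γ.tr (w, z)) := by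
  constructor
  · rintro ⟨F, hF, h⟩
    refine ⟨F.initData, F.eq_sol (fun e => (h e).1) fun e => (h e).2, ?_⟩
    rw [← F.traces_eq_tr fun e => (h e).2]
    exact hF
  · rintro ⟨z, rfl, hz⟩
    refine ⟨Γ.solveFun (w, z), by rwa [traces_solveFun], fun e => ⟨Γ.sol_ae e _, ?_⟩⟩
    simp only [solveFun, neg_neg]
    rfl

end Solve

variable {Γ : MetricGraph V E}

theorem green_tr (y y' : Γ.L2 × Init E) :
    inner ℂ y.1 (Γ.sol y') - inner ℂ (Γ.sol y) y'.1 =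
      ∑ e, (wronskian (Γ.tr y e).1 (Γ.tr y' e).1 - wronskian (Γ.tr y e).2 (Γ.tr y' e).2) := by
  rw [PiLp.inner_apply, PiLp.inner_apply, ← Finset.sum_sub_distrib]
  refine Finset.sum_congr rfl fun e _ => ?_
  have hg : ∀ y : Γ.L2 × Init E, y.1 e =ᵐ[Γ.edgeMeasure e] fun x => -(Γ.solveFun y).g e x :=
    fun y => Filter.Eventually.of_forall fun x => by simp [solveFun]
  have hl := (Γ.len_pos e).le
  have hm := right_mem_Icc.2 hl
  rw [← traces_solveFun, ← traces_solveFun, ← H2Fun.green_edge, inner_edge (hg y) (Γ.sol_ae e y'),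
    inner_edge (Γ.sol_ae e y) (hg y'), intervalIntegral.integral_sub]
  · have h1 := (Γ.solveFun y).intervalIntegrable_g e hm
    have h2 : IntervalIntegrable (fun x => conj (-(Γ.solveFun y).g e x)) volume 0 (Γ.len e) := by
      rw [intervalIntegrable_iff] at h1 ⊢
      exact Complex.conjCLE.toContinuousLinearMap.integrable_comp h1.neg
    refine h2.mul_continuousOn ?_
    rw [uIcc_of_le hl]
    exact (Γ.solveFun y').continuousOn_f e
  · refine ((Γ.solveFun y').intervalIntegrable_g e hm).neg.continuousOn_mul ?_
    rw [uIcc_of_le hl]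
    exact Complex.continuous_conj.comp_continuousOn ((Γ.solveFun y).continuousOn_f e)

end MetricGraph

namespace MetricGraph

open EdgeOp BoundaryRelation
open scoped ComplexConjugate

theorem inDeg_outDeg_le_one {V E : Type*} {Γ : MetricGraph V E} (hΓ : Γ.WellOriented) {v : V} (h : Γ.deg v = 1 ∨ Γ.deg v = 2) :
    Γ.inDeg v ≤ 1 ∧ Γ.outDeg v ≤ 1 := by
  rcases h with h | h
  · rw [deg] at h; omega
  · have := hΓ v h; omega

variable {V E : Type*} [Fintype E]

/-! ### Boundary values as linear maps -/

/-- A function that respects linear combinations, as a linear map. -/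
def linOfComb (f : Traces E → ℂ) (h : ∀ τ σ a b, f (a • τ + b • σ) = a * f τ + b * f σ) :
    Traces E →ₗ[ℂ] ℂ where
  toFun := f
  map_add' τ σ := by simpa using h τ σ 1 1
  map_smul' a τ := by simpa using h τ 0 a 0

/-- `γ₁ˢ` at `v`. -/
noncomputable def gam₁L (Γ : MetricGraph V E) (s : OnePoint ℝ) (v : V) : Traces E →ₗ[ℂ] ℂ :=
  linOfComb (fun τ => Γ.gam₁ s τ v) fun τ σ a b => gam₁_lin s τ σ v a b

/-- `γ₂ˢ` at `v`. -/
noncomputable def gam₂L (Γ : MetricGraph V E) (s : OnePoint ℝ) (v : V) : Traces E →ₗ[ℂ] ℂ :=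
  linOfComb (fun τ => Γ.gam₂ s τ v) fun τ σ a b => gam₂_lin s τ σ v a b

/-- `γ₂ˢ⋆ - γ₁ˢ⋆` at `v`. -/
noncomputable def jumpL (Γ : MetricGraph V E) (s : OnePoint ℝ) (v : V) : Traces E →ₗ[ℂ] ℂ :=
  linOfComb (fun τ => Γ.gamStar₂ s τ v - Γ.gamStar₁ s τ v) fun τ σ a b => by
    rw [gamStar₁_lin, gamStar₂_lin]; ring

open Classical in
/-- The sum of the outgoing derivatives at `v`. -/
noncomputable def kirchhoffL (Γ : MetricGraph V E) (v : V) : Traces E →ₗ[ℂ] ℂ :=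
  linOfComb (fun τ => ∑ e with Γ.src e = v, (τ e).1.2 - ∑ e with Γ.tgt e = v, (τ e).2.2)
    fun τ σ a b => by
      simp only [Pi.add_apply, Pi.smul_apply, Prod.fst_add, Prod.snd_add, Prod.smul_fst,
        Prod.smul_snd, smul_eq_mul, Finset.sum_add_distrib, ← Finset.mul_sum]
      ring

/-- The space of boundary values. -/
abbrev BVal (B : Finset V) : Type _ := EuclideanSpace ℂ B

/-- `γ₁ˢ` at the vertices of `B`. -/
noncomputable def gamMap (Γ : MetricGraph V E) (s : OnePoint ℝ) (B : Finset V) :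
    Traces E →ₗ[ℂ] BVal B :=
  (WithLp.linearEquiv 2 ℂ (B → ℂ)).symm.toLinearMap ∘ₗ LinearMap.pi fun v => Γ.gam₁L s v

/-- `γ₂ˢ⋆ - γ₁ˢ⋆` at the vertices of `B`. -/
noncomputable def jumpMap (Γ : MetricGraph V E) (s : OnePoint ℝ) (B : Finset V) :
    Traces E →ₗ[ℂ] BVal B :=
  (WithLp.linearEquiv 2 ℂ (B → ℂ)).symm.toLinearMap ∘ₗ LinearMap.pi fun v => Γ.jumpL s v

theorem gamMap_apply (Γ : MetricGraph V E) (s : OnePoint ℝ) (B : Finset V) (τ : Traces E) (v : B) :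
    Γ.gamMap s B τ v = Γ.gam₁ s τ v := rfl

theorem jumpMap_apply (Γ : MetricGraph V E) (s : OnePoint ℝ) (B : Finset V) (τ : Traces E) (v : B) :
    Γ.jumpMap s B τ v = Γ.gamStar₂ s τ v - Γ.gamStar₁ s τ v := rfl

/-- The conditions common to all parameters: Neumann–Kirchhoff outside `B`, and `γ₁ˢ = γ₂ˢ`
on `B`. -/
def baseData (Γ : MetricGraph V E) (s : OnePoint ℝ) (B : Finset V) : Submodule ℂ (Traces E) where
  carrier := {τ | (∀ v, v ∉ B → Γ.IsNeumannKirchhoff τ v) ∧ ∀ v ∈ B, Γ.gam₁ s τ v = Γ.gam₂ s τ v}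
  add_mem' := by
    rintro τ σ ⟨h1, h2⟩ ⟨k1, k2⟩
    refine ⟨fun v hv => ?_, fun v hv => ?_⟩
    · simpa using (h1 v hv).lin 1 1 (k1 v hv)
    · have e1 := gam₁_lin (Γ := Γ) s τ σ v 1 1
      have e2 := gam₂_lin (Γ := Γ) s τ σ v 1 1
      rw [one_smul, one_smul] at e1 e2
      rw [e1, e2, h2 v hv, k2 v hv]
  zero_mem' := by
    have h := isDeltaData_zero (Γ := Γ) s B ∞
    exact ⟨h.1, fun v hv => (h.2 v hv).1.trans (h.2 v hv).2.symm⟩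
  smul_mem' := by
    rintro a τ ⟨h1, h2⟩
    have h := isDeltaData_zero (Γ := Γ) s B ∞
    refine ⟨fun v hv => ?_, fun v hv => ?_⟩
    · simpa using (h1 v hv).lin a 0 (h.1 v hv)
    · have e1 := (Γ.gam₁L s v).map_smul a τ
      have e2 := (Γ.gam₂L s v).map_smul a τ
      change Γ.gam₁ s (a • τ) v = a • Γ.gam₁ s τ v at e1
      change Γ.gam₂ s (a • τ) v = a • Γ.gam₂ s τ v at e2
      rw [e1, e2, h2 v hv]

/-- The boundary value with respect to which the parameter `t` is the reference. -/
noncomputable def refGam (Γ : MetricGraph V E) (s : OnePoint ℝ) (B : Finset V) :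
    OnePoint ℝ → Traces E →ₗ[ℂ] BVal B
  | ∞ => Γ.gamMap s B
  | (t : ℝ) => Γ.jumpMap s B - (t : ℂ) • Γ.gamMap s B

/-- The conjugate boundary value with respect to which the parameter `t` is the reference. -/
noncomputable def refJump (Γ : MetricGraph V E) (s : OnePoint ℝ) (B : Finset V) :
    OnePoint ℝ → Traces E →ₗ[ℂ] BVal B
  | ∞ => Γ.jumpMap s B
  | (_ : ℝ) => -Γ.gamMap s B

theorem isDeltaData_iff {Γ : MetricGraph V E} {s : OnePoint ℝ} {B : Finset V} {t : OnePoint ℝ}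
    {τ : Traces E} :
    Γ.IsDeltaData s B t τ ↔ τ ∈ Γ.baseData s B ∧ Γ.refGam s B t τ = 0 := by
  cases t with
  | infty =>
    constructor
    · rintro ⟨h1, h2⟩
      refine ⟨⟨h1, fun v hv => (h2 v hv).1.trans (h2 v hv).2.symm⟩, ?_⟩
      ext v
      exact (h2 v v.2).1
    · rintro ⟨⟨h1, h2⟩, h3⟩
      have h4 : ∀ v ∈ B, Γ.gam₁ s τ v = 0 := fun v hv => congrArg (fun x : BVal B => x ⟨v, hv⟩) h3
      exact ⟨h1, fun v hv => ⟨h4 v hv, (h2 v hv).symm.trans (h4 v hv)⟩⟩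
  | coe t =>
    constructor
    · rintro ⟨h1, h2⟩
      refine ⟨⟨h1, fun v hv => (h2 v hv).1⟩, ?_⟩
      ext v
      exact sub_eq_zero.2 (h2 v v.2).2
    · rintro ⟨⟨h1, h2⟩, h3⟩
      exact ⟨h1, fun v hv => ⟨h2 v hv,
        sub_eq_zero.1 (congrArg (fun x : BVal B => x ⟨v, hv⟩) h3)⟩⟩

/-- The solution, the right hand side and the boundary values for given right hand side and
initial data. -/
noncomputable def boundaryMap (Γ : MetricGraph V E) (s : OnePoint ℝ) (B : Finset V) :
    (Γ.L2 × Init E) →ₗ[ℂ] Γ.L2 × Γ.L2 × BVal B × BVal B :=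
  (Γ.sol : (Γ.L2 × Init E) →ₗ[ℂ] Γ.L2).prod ((LinearMap.fst ℂ Γ.L2 (Init E)).prod
    ((Γ.gamMap s B ∘ₗ (Γ.tr : (Γ.L2 × Init E) →ₗ[ℂ] Traces E)).prod
      (Γ.jumpMap s B ∘ₗ (Γ.tr : (Γ.L2 × Init E) →ₗ[ℂ] Traces E))))

/-- The boundary relation of the `δ_s` family. -/
noncomputable def boundaryRel (Γ : MetricGraph V E) (s : OnePoint ℝ) (B : Finset V) :
    Submodule ℂ (Γ.L2 × Γ.L2 × BVal B × BVal B) :=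
  ((Γ.baseData s B).comap (Γ.tr : (Γ.L2 × Init E) →ₗ[ℂ] Traces E)).map (Γ.boundaryMap s B)

variable {Γ : MetricGraph V E} {s : OnePoint ℝ} {B : Finset V}

theorem mem_boundaryRel {u w : Γ.L2} {g j : BVal B} : (u, w, g, j) ∈ Γ.boundaryRel s B ↔
    ∃ z : Init E, Γ.tr (w, z) ∈ Γ.baseData s B ∧ Γ.sol (w, z) = u ∧ Γ.gamMap s B (Γ.tr (w, z)) = g ∧
      Γ.jumpMap s B (Γ.tr (w, z)) = j := by
  constructor
  · rintro ⟨⟨w', z⟩, hy, h⟩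
    have h1 := congrArg Prod.fst h
    have h2 := congrArg (fun p => p.2.1) h
    have h3 := congrArg (fun p => p.2.2.1) h
    have h4 := congrArg (fun p => p.2.2.2) h
    change w' = w at h2
    subst h2
    exact ⟨z, hy, h1, h3, h4⟩
  · rintro ⟨z, hy, rfl, rfl, rfl⟩
    exact ⟨(w, z), hy, rfl⟩

theorem ext_boundaryRel (t : OnePoint ℝ) :
    BoundaryRelation.ext (Γ.boundaryRel s B) t = Γ.deltaGraph s B t := by
  ext ⟨u, w⟩
  rw [mem_deltaGraph_iff]
  simp only [isDeltaData_iff]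
  cases t with
  | infty =>
    rw [mem_ext_infty]
    constructor
    · rintro ⟨j, hj⟩
      obtain ⟨z, h1, h2, h3, -⟩ := mem_boundaryRel.1 hj
      exact ⟨z, h2.symm, h1, h3⟩
    · rintro ⟨z, h1, h2, h3⟩
      exact ⟨_, mem_boundaryRel.2 ⟨z, h2, h1.symm, h3, rfl⟩⟩
  | coe t =>
    rw [mem_ext_coe]
    constructor
    · rintro ⟨g, hg⟩
      obtain ⟨z, h1, h2, h3, h4⟩ := mem_boundaryRel.1 hg
      refine ⟨z, h2.symm, h1, ?_⟩
      rw [← h3] at h4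
      exact sub_eq_zero.2 h4
    · rintro ⟨z, h1, h2, h3⟩
      exact ⟨_, mem_boundaryRel.2 ⟨z, h2, h1.symm, rfl, sub_eq_zero.1 h3⟩⟩

theorem mem_reference_boundaryRel (t : OnePoint ℝ) {w : Γ.L2} {z : Init E}
    (h : Γ.tr (w, z) ∈ Γ.baseData s B) :
    (Γ.sol (w, z), w, Γ.refGam s B t (Γ.tr (w, z)), Γ.refJump s B t (Γ.tr (w, z))) ∈
      reference (Γ.boundaryRel s B) t := by
  cases t with
  | infty => exact mem_boundaryRel.2 ⟨z, h, rfl, rfl, rfl⟩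
  | coe t =>
    refine mem_rotate.2 (mem_boundaryRel.2 ⟨z, h, rfl, ?_, ?_⟩)
    · change _ = - -Γ.gamMap s B (Γ.tr (w, z))
      rw [neg_neg]
    · change _ = Γ.jumpMap s B (Γ.tr (w, z)) - (t : ℂ) • Γ.gamMap s B (Γ.tr (w, z)) -
        (t : ℂ) • -Γ.gamMap s B (Γ.tr (w, z))
      rw [smul_neg, sub_neg_eq_add, sub_add_cancel]

theorem isDetermined_boundaryRel : IsDetermined (Γ.boundaryRel s B) := by
  intro w g j h
  obtain ⟨z, h1, h2, h3, h4⟩ := mem_boundaryRel.1 h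
  have h0 : (w, z) = 0 := Γ.eq_zero_of_sol_eq_zero h2
  rw [h0, map_zero, map_zero] at h3 h4
  exact ⟨congrArg Prod.fst h0, h3.symm, h4.symm⟩

/-! ### Degrees -/

theorem exists_tgt_of_inDeg_ne_zero {v : V} (h : Γ.inDeg v ≠ 0) : ∃ e, Γ.tgt e = v := by
  by_contra! h0
  refine h ?_
  rw [inDeg, ncard_eq_zero]
  exact eq_empty_of_forall_notMem h0

theorem exists_src_of_outDeg_ne_zero {v : V} (h : Γ.outDeg v ≠ 0) : ∃ e, Γ.src e = v := by
  by_contra! h0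
  refine h ?_
  rw [outDeg, ncard_eq_zero]
  exact eq_empty_of_forall_notMem h0

theorem tgt_ne_of_inDeg_eq_zero {v : V} (h : Γ.inDeg v = 0) (e : E) : Γ.tgt e ≠ v := fun he => by
  rw [inDeg, ncard_eq_zero] at h
  exact (h.symm ▸ notMem_empty e : e ∉ {e | Γ.tgt e = v}) he

theorem src_ne_of_outDeg_eq_zero {v : V} (h : Γ.outDeg v = 0) (e : E) : Γ.src e ≠ v := fun he => by
  rw [outDeg, ncard_eq_zero] at h
  exact (h.symm ▸ notMem_empty e : e ∉ {e | Γ.src e = v}) he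

theorem gam₁_eq_gam₂_of_deg_eq_one {v : V} (h : Γ.deg v = 1) (s : OnePoint ℝ) (τ : Traces E) :
    Γ.gam₁ s τ v = Γ.gam₂ s τ v := by
  rw [deg] at h
  by_cases hin : Γ.inDeg v = 0
  · have h1 : ¬∃ e, Γ.tgt e = v := fun ⟨e, he⟩ => tgt_ne_of_inDeg_eq_zero hin e he
    have h2 : ∃ e, Γ.src e = v := exists_src_of_outDeg_ne_zero (by omega)
    rw [gam₁, gam₂, if_neg h1, if_pos h2]
  · have h1 : ∃ e, Γ.tgt e = v := exists_tgt_of_inDeg_ne_zero hin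
    have h2 : ¬∃ e, Γ.src e = v := fun ⟨e, he⟩ =>
      src_ne_of_outDeg_eq_zero (by omega : Γ.outDeg v = 0) e he
    rw [gam₁, gam₂, if_pos h1, if_neg h2]

/-! ### Green's identity for the boundary relation -/

open Classical in
/-- The contribution of a vertex to the boundary form. -/
noncomputable def vertexForm (Γ : MetricGraph V E) (τ σ : Traces E) (v : V) : ℂ :=
  ∑ e with Γ.src e = v, wronskian (τ e).1 (σ e).1 - ∑ e with Γ.tgt e = v, wronskian (τ e).2 (σ e).2

/-- The common values factor out, leaving the sums of outgoing derivatives, which vanish. -/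
theorem vertexForm_of_isNeumannKirchhoff {τ σ : Traces E} {v : V} (hτ : Γ.IsNeumannKirchhoff τ v)
    (hσ : Γ.IsNeumannKirchhoff σ v) : Γ.vertexForm τ σ v = 0 := by
  classical
  obtain ⟨⟨a, ha, ha'⟩, hd⟩ := hτ
  obtain ⟨⟨b, hb, hb'⟩, hd'⟩ := hσ
  have h1 : ∑ e with Γ.src e = v, wronskian (τ e).1 (σ e).1 =
      conj (∑ e with Γ.src e = v, (τ e).1.2) * b - conj a * ∑ e with Γ.src e = v, (σ e).1.2 := by
    rw [map_sum, Finset.sum_mul, Finset.mul_sum, ← Finset.sum_sub_distrib]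
    refine Finset.sum_congr rfl fun e he => ?_
    rw [Finset.mem_filter] at he
    rw [wronskian, ha e he.2, hb e he.2]
  have h2 : ∑ e with Γ.tgt e = v, wronskian (τ e).2 (σ e).2 =
      conj (∑ e with Γ.tgt e = v, (τ e).2.2) * b - conj a * ∑ e with Γ.tgt e = v, (σ e).2.2 := by
    rw [map_sum, Finset.sum_mul, Finset.mul_sum, ← Finset.sum_sub_distrib]
    refine Finset.sum_congr rfl fun e he => ?_
    rw [Finset.mem_filter] at he
    rw [wronskian, ha' e he.2, hb' e he.2]
  have h3 := congrArg conj hd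
  rw [map_sub, map_zero] at h3
  rw [vertexForm, h1, h2]
  linear_combination b * h3 - conj a * hd'

theorem gam_src_eq {v : V} (hdeg : Γ.outDeg v ≤ 1) {τ : Traces E} (h : Γ.gam₁ s τ v = Γ.gam₂ s τ v) {e : E}
    (he : Γ.src e = v) : gam s (τ e).1 = Γ.gam₁ s τ v := by
  classical
  have hfil : (Finset.univ.filter fun e' => Γ.src e' = v) = {e} := by
    ext e'
    simp only [Finset.mem_filter, Finset.mem_univ, true_and, Finset.mem_singleton]
    constructor
    · intro he'
      exact (ncard_le_one (toFinite _)).1 hdeg e' he' e he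
    · rintro rfl; exact he
  rw [h, gam₂, if_pos ⟨e, he⟩, gamOut]
  convert (Finset.sum_singleton (fun e => gam s (τ e).1) e).symm

theorem gam_tgt_eq {v : V} (hdeg : Γ.inDeg v ≤ 1) {τ : Traces E} {e : E}
    (he : Γ.tgt e = v) : gam s (τ e).2 = Γ.gam₁ s τ v := by
  classical
  have hfil : (Finset.univ.filter fun e' => Γ.tgt e' = v) = {e} := by
    ext e'
    simp only [Finset.mem_filter, Finset.mem_univ, true_and, Finset.mem_singleton]
    constructor
    · intro he'
      exact (ncard_le_one (toFinite _)).1 hdeg e' he' e he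
    · rintro rfl; exact he
  rw [gam₁, if_pos ⟨e, he⟩, gamIn]
  convert (Finset.sum_singleton (fun e => gam s (τ e).2) e).symm

/-- With at most one edge in each direction, every edge end at `v` has the same `γˢ`. After rotating
the Wronskian by the Prüfer angle this common value factors out. -/
theorem vertexForm_of_delta (hΓ : Γ.WellOriented) {v : V} (hv : Γ.deg v = 1 ∨ Γ.deg v = 2)
    {τ σ : Traces E} (hτ : Γ.gam₁ s τ v = Γ.gam₂ s τ v) (hσ : Γ.gam₁ s σ v = Γ.gam₂ s σ v) :
    Γ.vertexForm τ σ v =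
      conj (Γ.gamStar₂ s τ v - Γ.gamStar₁ s τ v) * Γ.gam₁ s σ v -
        conj (Γ.gam₁ s τ v) * (Γ.gamStar₂ s σ v - Γ.gamStar₁ s σ v) := by
  classical
  obtain ⟨hin, hout⟩ := inDeg_outDeg_le_one hΓ hv
  have h1 : ∑ e with Γ.src e = v, wronskian (τ e).1 (σ e).1 =
      conj (Γ.gamStar₂ s τ v) * Γ.gam₁ s σ v - conj (Γ.gam₁ s τ v) * Γ.gamStar₂ s σ v := by
    rw [gamStar₂, gamStar₂, map_sum, Finset.sum_mul, Finset.mul_sum, ← Finset.sum_sub_distrib]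
    refine Finset.sum_congr (by congr) fun e he => ?_
    rw [Finset.mem_filter] at he
    rw [wronskian_eq_gam s, gam_src_eq hout hτ he.2, gam_src_eq hout hσ he.2]
  have h2 : ∑ e with Γ.tgt e = v, wronskian (τ e).2 (σ e).2 =
      conj (Γ.gamStar₁ s τ v) * Γ.gam₁ s σ v - conj (Γ.gam₁ s τ v) * Γ.gamStar₁ s σ v := by
    rw [gamStar₁, gamStar₁, map_sum, Finset.sum_mul, Finset.mul_sum, ← Finset.sum_sub_distrib]
    refine Finset.sum_congr (by congr) fun e he => ?_
    rw [Finset.mem_filter] at he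
    rw [wronskian_eq_gam s, gam_tgt_eq hin he.2, gam_tgt_eq hin he.2]
  rw [vertexForm]
  rw [h1, h2, map_sub]
  ring

theorem sum_vertexForm [Fintype V] (τ σ : Traces E) :
    ∑ e, (wronskian (τ e).1 (σ e).1 - wronskian (τ e).2 (σ e).2) = ∑ v, Γ.vertexForm τ σ v := by
  classical
  simp only [vertexForm, Finset.sum_sub_distrib]
  congr 1
  · exact (Finset.sum_fiberwise _ _ _).symm
  · exact (Finset.sum_fiberwise _ _ _).symm

theorem isGreen_boundaryRel [Finite V] (hΓ : Γ.WellOriented)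
    (hB : ∀ v ∈ B, Γ.deg v = 1 ∨ Γ.deg v = 2) : IsGreen (Γ.boundaryRel s B) := by
  classical
  have := Fintype.ofFinite V
  rintro ⟨u, w, g, j⟩ hp ⟨u', w', g', j'⟩ hq
  obtain ⟨z, hz, rfl, rfl, rfl⟩ := mem_boundaryRel.1 hp
  obtain ⟨z', hz', rfl, rfl, rfl⟩ := mem_boundaryRel.1 hq
  have hsum : ∑ v, Γ.vertexForm (Γ.tr (w, z)) (Γ.tr (w', z')) v =
      ∑ v : B, Γ.vertexForm (Γ.tr (w, z)) (Γ.tr (w', z')) v := by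
    rw [Finset.sum_coe_sort B (Γ.vertexForm (Γ.tr (w, z)) (Γ.tr (w', z')))]
    refine (Finset.sum_subset (Finset.subset_univ B) fun v _ hv => ?_).symm
    exact vertexForm_of_isNeumannKirchhoff (hz.1 v hv) (hz'.1 v hv)
  simp only
  rw [green_tr (w, z) (w', z'), sum_vertexForm (Γ := Γ), hsum, PiLp.inner_apply, PiLp.inner_apply,
    ← Finset.sum_sub_distrib]
  refine Finset.sum_congr rfl fun v _ => ?_
  rw [vertexForm_of_delta hΓ (hB v v.2) (hz.2 v v.2) (hz'.2 v v.2), RCLike.inner_apply,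
    RCLike.inner_apply, gamMap_apply, gamMap_apply, jumpMap_apply, jumpMap_apply]
  ring

end MetricGraph

/-! ## Solvability of the boundary value problem and the spectral flow -/

namespace MetricGraph

open EdgeOp BoundaryRelation UnboundedOp

variable {V E : Type*}

/-! ### One condition for each edge end -/

/-- The vertex at an edge end; starts are tagged `inl`, ends are tagged `inr`. -/
def endVertex (Γ : MetricGraph V E) : E ⊕ E → V := Sum.elim Γ.src Γ.tgt

/-- A distinguished edge end at the vertex of a given edge end. -/
noncomputable def mainEnd (Γ : MetricGraph V E) (ε : E ⊕ E) : E ⊕ E :=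
  Classical.choose (⟨ε, rfl⟩ : ∃ ε', Γ.endVertex ε' = Γ.endVertex ε)

theorem endVertex_mainEnd (Γ : MetricGraph V E) (ε : E ⊕ E) :
    Γ.endVertex (Γ.mainEnd ε) = Γ.endVertex ε :=
  Classical.choose_spec (⟨ε, rfl⟩ : ∃ ε', Γ.endVertex ε' = Γ.endVertex ε)

/-- The choice is made from a predicate that involves only the vertex, and proofs are irrelevant. -/
theorem mainEnd_congr (Γ : MetricGraph V E) {ε ε' : E ⊕ E} (h : Γ.endVertex ε = Γ.endVertex ε') :
    Γ.mainEnd ε = Γ.mainEnd ε' := by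
  unfold mainEnd
  congr 1
  rw [h]

theorem mainEnd_mainEnd (Γ : MetricGraph V E) (ε : E ⊕ E) :
    Γ.mainEnd (Γ.mainEnd ε) = Γ.mainEnd ε :=
  Γ.mainEnd_congr (Γ.endVertex_mainEnd ε)

/-- The value at an edge end. -/
def endValue (ε : E ⊕ E) : Traces E →ₗ[ℂ] ℂ :=
  linOfComb (fun τ => ε.elim (fun e => (τ e).1.1) fun e => (τ e).2.1) fun τ σ a b => by
    cases ε <;> simp

/-- Collects one number for each edge end into initial data. -/
noncomputable def pairEnds {M : Type*} [AddCommMonoid M] [Module ℂ M] (f : E ⊕ E → M →ₗ[ℂ] ℂ) :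
    M →ₗ[ℂ] Init E :=
  LinearMap.pi fun e => (f (Sum.inl e)).prod (f (Sum.inr e))

theorem pairEnds_eq {M N : Type*} [AddCommMonoid M] [Module ℂ M] [AddCommMonoid N] [Module ℂ N]
    {f : E ⊕ E → M →ₗ[ℂ] ℂ} {g : E ⊕ E → N →ₗ[ℂ] ℂ} {x : M} {y : N}
    (h : pairEnds f x = pairEnds g y) (ε : E ⊕ E) : f ε x = g ε y := by
  cases ε with
  | inl e => exact congrArg (fun z : Init E => (z e).1) h
  | inr e => exact congrArg (fun z : Init E => (z e).2) h

variable [Fintype E] (Γ : MetricGraph V E) (s : OnePoint ℝ) (B : Finset V)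

/-- The condition of the `δ_s` family imposed at the distinguished end of a vertex of `B`. -/
noncomputable def deltaMain (v : V) : OnePoint ℝ → Traces E →ₗ[ℂ] ℂ
  | ∞ => Γ.gam₁L s v
  | (t : ℝ) => Γ.jumpL s v - (t : ℂ) • Γ.gam₁L s v

/-- The condition of the `δ_s` family imposed at the other end of a vertex of `B`. -/
noncomputable def deltaOther (v : V) : OnePoint ℝ → Traces E →ₗ[ℂ] ℂ
  | ∞ => Γ.gam₂L s v
  | (_ : ℝ) => Γ.gam₁L s v - Γ.gam₂L s v

open Classical in
/-- The condition imposed at an edge end. -/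
noncomputable def condition (t : OnePoint ℝ) (ε : E ⊕ E) : Traces E →ₗ[ℂ] ℂ :=
  if Γ.endVertex ε ∈ B then
    if Γ.mainEnd ε = ε then Γ.deltaMain s (Γ.endVertex ε) t else Γ.deltaOther s (Γ.endVertex ε) t
  else
    if Γ.mainEnd ε = ε then Γ.kirchhoffL (Γ.endVertex ε) else endValue ε - endValue (Γ.mainEnd ε)

open Classical in
/-- The value prescribed for the condition at an edge end, for given boundary values. -/
noncomputable def target (t : OnePoint ℝ) (ε : E ⊕ E) : BVal B →ₗ[ℂ] ℂ :=
  if h : Γ.endVertex ε ∈ B then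
    -- For `t = ∞` both ends prescribe the same value, to `γ₁ˢ` and to `γ₂ˢ`. For real `t` the other
    -- end imposes `γ₁ˢ - γ₂ˢ = 0`, whose target is `0`.
    if Γ.mainEnd ε = ε ∨ t = ∞ then
      (EuclideanSpace.proj (⟨Γ.endVertex ε, h⟩ : B) : BVal B →L[ℂ] ℂ).toLinearMap
    else 0
  else 0

variable {Γ s B}

theorem exists_end_of_deg_ne_zero {v : V} (h : Γ.deg v ≠ 0) : ∃ ε, Γ.endVertex ε = v := by
  by_cases hin : Γ.inDeg v = 0
  · obtain ⟨e, he⟩ := exists_src_of_outDeg_ne_zero (Γ := Γ) (v := v) (by rw [deg] at h; omega)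
    exact ⟨Sum.inl e, he⟩
  · obtain ⟨e, he⟩ := exists_tgt_of_inDeg_ne_zero hin
    exact ⟨Sum.inr e, he⟩

/-- The second end carries the condition `γ₁ˢ = γ₂ˢ`. At degree one no second end exists and this
equality holds by convention. -/
theorem exists_mainEnd_ne (hΓ : Γ.WellOriented) {v : V} (h : Γ.deg v = 2) :
    ∃ ε, Γ.endVertex ε = v ∧ Γ.mainEnd ε ≠ ε := by
  obtain ⟨h1, h2⟩ := hΓ v h
  obtain ⟨e, he⟩ := exists_tgt_of_inDeg_ne_zero (h1.symm ▸ one_ne_zero : Γ.inDeg v ≠ 0)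
  obtain ⟨e', he'⟩ := exists_src_of_outDeg_ne_zero (h2.symm ▸ one_ne_zero : Γ.outDeg v ≠ 0)
  by_cases hm : Γ.mainEnd (Sum.inr e) = Sum.inr e
  · refine ⟨Sum.inl e', he', ?_⟩
    rw [Γ.mainEnd_congr (ε := Sum.inl e') (ε' := Sum.inr e) (he'.trans he.symm), hm]
    exact Sum.inr_ne_inl
  · exact ⟨Sum.inr e, he, hm⟩

theorem isNeumannKirchhoff_of_condition {t : OnePoint ℝ} {τ : Traces E} {v : V} (hv : v ∉ B)
    (h : ∀ ε, Γ.endVertex ε = v → Γ.condition s B t ε τ = 0) : Γ.IsNeumannKirchhoff τ v := by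
  classical
  by_cases hex : ∃ ε, Γ.endVertex ε = v
  · obtain ⟨ε, hε⟩ := hex
    have hval : ∀ ε', Γ.endVertex ε' = v → endValue ε' τ = endValue (Γ.mainEnd ε) τ := by
      intro ε' hε'
      by_cases hm : Γ.mainEnd ε' = ε'
      · rw [Γ.mainEnd_congr (hε.trans hε'.symm), hm]
      · have h1 := h ε' hε'
        rw [condition, if_neg (by rwa [hε']), if_neg hm, Γ.mainEnd_congr (hε'.trans hε.symm)] at h1
        exact sub_eq_zero.1 h1
    refine ⟨⟨endValue (Γ.mainEnd ε) τ, fun e he => hval (Sum.inl e) he,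
      fun e he => hval (Sum.inr e) he⟩, ?_⟩
    have hm := (Γ.endVertex_mainEnd ε).trans hε
    have h1 := h (Γ.mainEnd ε) hm
    rw [condition, if_neg (by rwa [hm]), if_pos (Γ.mainEnd_mainEnd ε), hm] at h1
    exact h1
  -- At an isolated vertex there is nothing to satisfy.
  · have h1 : ∀ e, Γ.src e ≠ v := fun e he => hex ⟨Sum.inl e, he⟩
    have h2 : ∀ e, Γ.tgt e ≠ v := fun e he => hex ⟨Sum.inr e, he⟩
    refine ⟨⟨0, fun e he => absurd he (h1 e), fun e he => absurd he (h2 e)⟩, ?_⟩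
    simp [h1, h2]

theorem deltaMain_apply (t : OnePoint ℝ) (τ : Traces E) (v : B) :
    Γ.deltaMain s v t τ = Γ.refGam s B t τ v := by
  cases t <;> rfl

theorem gam₁_eq_gam₂_of_condition (hΓ : Γ.WellOriented) {t : OnePoint ℝ} {τ : Traces E} {v : V}
    (hv : v ∈ B) (hdeg : Γ.deg v = 1 ∨ Γ.deg v = 2) {φ : BVal B} (hφ : Γ.refGam s B t τ = φ)
    (h : ∀ ε, Γ.condition s B t ε τ = Γ.target B t ε φ) : Γ.gam₁ s τ v = Γ.gam₂ s τ v := by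
  rcases hdeg with hdeg | hdeg
  · exact gam₁_eq_gam₂_of_deg_eq_one hdeg s τ
  obtain ⟨ε, rfl, hm⟩ := exists_mainEnd_ne hΓ hdeg
  have h1 := h ε
  rw [condition, if_pos hv, if_neg hm, target, dif_pos hv] at h1
  cases t with
  | infty =>
    rw [if_pos (Or.inr rfl)] at h1
    have h2 : Γ.gam₁ s τ (Γ.endVertex ε) = φ ⟨Γ.endVertex ε, hv⟩ := by rw [← hφ]; rfl
    exact h2.trans h1.symm
  | coe t =>
    rw [if_neg (by simp [hm])] at h1
    exact sub_eq_zero.1 h1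

/-- The conditions at the edge ends force the base conditions and prescribe the boundary value. -/
theorem mem_baseData_of_condition (hΓ : Γ.WellOriented)
    (hB : ∀ v ∈ B, Γ.deg v = 1 ∨ Γ.deg v = 2) {t : OnePoint ℝ} {τ : Traces E} {φ : BVal B}
    (h : ∀ ε, Γ.condition s B t ε τ = Γ.target B t ε φ) :
    τ ∈ Γ.baseData s B ∧ Γ.refGam s B t τ = φ := by
  have hφ : Γ.refGam s B t τ = φ := by
    ext v
    obtain ⟨ε, hε⟩ := exists_end_of_deg_ne_zero (Γ := Γ) (v := v) (by have := hB v v.2; omega)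
    have hm := (Γ.endVertex_mainEnd ε).trans hε
    have hmem : Γ.endVertex (Γ.mainEnd ε) ∈ B := hm.symm ▸ v.2
    have hv : v = ⟨_, hmem⟩ := Subtype.ext hm.symm
    have h1 := h (Γ.mainEnd ε)
    rw [condition, if_pos hmem, if_pos (Γ.mainEnd_mainEnd ε), target, dif_pos hmem,
      if_pos (Or.inl (Γ.mainEnd_mainEnd ε))] at h1
    rw [hv, ← deltaMain_apply]
    exact h1
  refine ⟨⟨fun v hv => ?_, fun v hv => ?_⟩, hφ⟩
  · refine isNeumannKirchhoff_of_condition (s := s) (t := t) hv fun ε hε => ?_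
    rw [h ε, target, dif_neg (by rwa [hε])]
    rfl
  · exact gam₁_eq_gam₂_of_condition hΓ hv (hB v hv) hφ h

/-! ### The Fredholm alternative -/

variable (Γ s B)

/-- All conditions, as a continuous linear map. -/
noncomputable def conditions (t : OnePoint ℝ) : Traces E →L[ℂ] Init E :=
  LinearMap.toContinuousLinearMap (pairEnds (Γ.condition s B t))

/-- The compact part of the boundary value problem. -/
noncomputable def bvpCompact (t : OnePoint ℝ) (μ : ℝ) : (Γ.L2 × Init E) →L[ℂ] (Γ.L2 × Init E) :=
  ((μ : ℂ) • Γ.sol).prod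
    (ContinuousLinearMap.snd ℂ Γ.L2 (Init E) - Γ.conditions s B t ∘L Γ.tr)

/-- The first component is a multiple of the compact solution operator; the second takes values in
the finite-dimensional `Init E`. Having one condition per edge end makes source and target spaces
coincide. -/
theorem isCompactOperator_bvpCompact (t : OnePoint ℝ) (μ : ℝ) :
    IsCompactOperator (Γ.bvpCompact s B t μ) := by
  have h1 : IsCompactOperator (ContinuousLinearMap.inl ℂ Γ.L2 (Init E) ∘ ((μ : ℂ) • Γ.sol)) :=
    (Γ.isCompactOperator_sol.smul (μ : ℂ)).clm_comp _
  have h2 : IsCompactOperator (ContinuousLinearMap.inr ℂ Γ.L2 (Init E) ∘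
      (ContinuousLinearMap.snd ℂ Γ.L2 (Init E) - Γ.conditions s B t ∘L Γ.tr)) :=
    (isCompactOperator_of_locallyCompactSpace_dom _).clm_comp _
  have h3 : ⇑(Γ.bvpCompact s B t μ) =
      (ContinuousLinearMap.inl ℂ Γ.L2 (Init E) ∘ ((μ : ℂ) • Γ.sol)) +
      (ContinuousLinearMap.inr ℂ Γ.L2 (Init E) ∘
        (ContinuousLinearMap.snd ℂ Γ.L2 (Init E) - Γ.conditions s B t ∘L Γ.tr)) := by
    funext y
    ext1
    · exact (add_zero _).symm
    · exact (zero_add _).symm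
  rw [h3]
  exact h1.add h2

variable {Γ s B}

/-- Unique solvability of the boundary value problem. -/
theorem exists_bvp_inverse (hΓ : Γ.WellOriented) (hB : ∀ v ∈ B, Γ.deg v = 1 ∨ Γ.deg v = 2)
    {t : OnePoint ℝ} {μ : ℝ} (h : kerRel (Γ.deltaGraph s B t) μ = ⊥) :
    ∃ Ψ : (Γ.L2 × Init E) →L[ℂ] (Γ.L2 × Init E), ∀ y,
      (Ψ y).1 = y.1 + (μ : ℂ) • Γ.sol (Ψ y) ∧ Γ.conditions s B t (Γ.tr (Ψ y)) = y.2 := by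
  -- For a fixed point `y`, the function `Γ.sol y` satisfies `-f'' = μ f` with homogeneous
  -- conditions, so it lies in the trivial kernel.
  have hinj : ∀ y, Γ.bvpCompact s B t μ y = y → y = 0 := by
    intro y hy
    have h1 : (μ : ℂ) • Γ.sol y = y.1 := congrArg Prod.fst hy
    have h2 : y.2 - Γ.conditions s B t (Γ.tr y) = y.2 := congrArg Prod.snd hy
    rw [sub_eq_self] at h2
    obtain ⟨h3, h4⟩ := mem_baseData_of_condition (s := s) (t := t) (τ := Γ.tr y) (φ := 0) hΓ hB
      fun ε => pairEnds_eq (h2.trans (map_zero (pairEnds (Γ.target B t))).symm) ε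
    refine Γ.eq_zero_of_sol_eq_zero ?_
    rw [← Submodule.mem_bot ℂ, ← h, mem_kerRel, h1, mem_deltaGraph_iff]
    exact ⟨y.2, rfl, isDeltaData_iff.2 ⟨h3, h4⟩⟩
  -- Fredholm alternative at `1`: either a fixed point exists, or `1` minus the compact part is
  -- invertible, with inverse `Ψ`.
  rcases (Γ.isCompactOperator_bvpCompact s B t μ).hasEigenvalue_or_mem_resolventSet
    (one_ne_zero (α := ℂ)) with h1 | h1
  · obtain ⟨y, hy, hy0⟩ := h1.exists_hasEigenvector
    refine absurd (hinj y ?_) hy0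
    simpa using Module.End.mem_eigenspace_iff.1 hy
  · obtain ⟨Ψ, hΨ⟩ := (spectrum.mem_resolventSet_iff.1 h1).exists_right_inv
    refine ⟨Ψ, fun y => ?_⟩
    have h2 : Ψ y - Γ.bvpCompact s B t μ (Ψ y) = y := by
      simpa using congrArg (fun A : (Γ.L2 × Init E) →L[ℂ] (Γ.L2 × Init E) => A y) hΨ
    have h3 : (Ψ y).1 - (μ : ℂ) • Γ.sol (Ψ y) = y.1 := congrArg Prod.fst h2
    have h4 : (Ψ y).2 - ((Ψ y).2 - Γ.conditions s B t (Γ.tr (Ψ y))) = y.2 := congrArg Prod.snd h2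
    exact ⟨sub_eq_iff_eq_add.1 h3, by rwa [sub_sub_cancel] at h4⟩

/-- All four operators are read off from `Ψ`: boundary value `0` gives `R` and `Γs`, right-hand side
`0` gives `Γ` and `M`. -/
theorem nonempty_solution (hΓ : Γ.WellOriented) (hB : ∀ v ∈ B, Γ.deg v = 1 ∨ Γ.deg v = 2)
    {t : OnePoint ℝ} {μ : ℝ} (h : kerRel (Γ.deltaGraph s B t) μ = ⊥) :
    Nonempty (Solution (reference (Γ.boundaryRel s B) t) μ) := by
  obtain ⟨Ψ, hΨ⟩ := exists_bvp_inverse hΓ hB h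
  have key : ∀ (w : Γ.L2) (φ : BVal B) (y : Γ.L2 × Init E),
      y = Ψ (w, pairEnds (Γ.target B t) φ) →
      (Γ.sol y, w + (μ : ℂ) • Γ.sol y, φ, Γ.refJump s B t (Γ.tr y)) ∈
        reference (Γ.boundaryRel s B) t := by
    rintro w φ ⟨w', z⟩ hy
    obtain ⟨h1, h2⟩ := hΨ (w, pairEnds (Γ.target B t) φ)
    rw [← hy] at h1 h2
    obtain ⟨h3, h4⟩ := mem_baseData_of_condition hΓ hB fun ε => pairEnds_eq h2 ε
    have h5 := mem_reference_boundaryRel t h3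
    rw [h4] at h5
    change w' = w + (μ : ℂ) • Γ.sol (w', z) at h1
    rw [← h1]
    exact h5
  refine ⟨{
    R := Γ.sol ∘L Ψ ∘L ContinuousLinearMap.inl ℂ Γ.L2 (Init E)
    Γs := Γ.refJump s B t ∘ₗ (Γ.tr ∘L Ψ ∘L ContinuousLinearMap.inl ℂ Γ.L2 (Init E)).toLinearMap
    Γ := (Γ.sol ∘L Ψ).toLinearMap ∘ₗ LinearMap.inr ℂ Γ.L2 (Init E) ∘ₗ pairEnds (Γ.target B t)
    M := Γ.refJump s B t ∘ₗ (Γ.tr ∘L Ψ).toLinearMap ∘ₗ LinearMap.inr ℂ Γ.L2 (Init E) ∘ₗ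
      pairEnds (Γ.target B t)
    compact := Γ.isCompactOperator_sol.comp_clm (Ψ ∘L ContinuousLinearMap.inl ℂ Γ.L2 (Init E))
    R_mem := fun w => key w 0 (Ψ (w, 0)) (by rw [map_zero])
    Γ_mem := fun φ => ?_ }⟩
  have h1 := key 0 φ _ rfl
  rw [zero_add] at h1
  exact h1

theorem isSystem_boundaryRel [Finite V] (hΓ : Γ.WellOriented)
    (hB : ∀ v ∈ B, Γ.deg v = 1 ∨ Γ.deg v = 2) : IsSystem (Γ.boundaryRel s B) where
  green := isGreen_boundaryRel hΓ hB
  det := isDetermined_boundaryRel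
  solv t μ h := nonempty_solution hΓ hB (by rwa [ext_boundaryRel] at h)

instance separableSpace_L2 (Γ : MetricGraph V E) : TopologicalSpace.SeparableSpace Γ.L2 := by
  have : Fact ((2 : ENNReal) ≠ ⊤) := ⟨ENNReal.ofNat_ne_top⟩
  let A := (PiLp.continuousLinearEquiv 2 ℂ (fun e : E => Lp ℂ 2 (Γ.edgeMeasure e))).symm
  exact A.surjective.denseRange.separableSpace A.continuous

/-- The spectral flow of a `δ_s` family is the number of vertices on which it is placed. -/
theorem hasSpectralFlow_deltaFamily [Finite V] (hΓ : Γ.WellOriented)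
    (hB : ∀ v ∈ B, Γ.deg v = 1 ∨ Γ.deg v = 2) {c : ℝ} (hc : (c : ℂ) ∉ spec (Γ.deltaOp s B ∞)) :
    HasSpectralFlow (Γ.deltaFamily s B) ⊥ ⊤ c B.card := by
  have hD := isSystem_boundaryRel (s := s) hΓ hB
  have hg : ∀ t, (Γ.deltaOp s B t).graph = BoundaryRelation.ext (Γ.boundaryRel s B) t :=
    fun t => (Γ.deltaOp_graph s B t).trans (ext_boundaryRel t).symm
  have h := hD.hasSpectralFlow (H := Γ.deltaFamily s B) (fun τ => hg (closeUp τ))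
    ((hD.notMem_spec_iff (hg ∞)).1 hc)
  rwa [finrank_euclideanSpace, Fintype.card_coe] at h

end MetricGraph

/-! ## Subdivision -/

namespace MetricGraph

variable {V E : Type*} {Γ : MetricGraph V E} {P : Finset Γ.Point}

theorem mem_cutsAfter {e : E} {x y : ℝ} :
    y ∈ Γ.cutsAfter P e x ↔
      x < y ∧ ∃ hy : y ∈ Ioo 0 (Γ.len e), (⟨(e, y), hy⟩ : Γ.InteriorPoint) ∈ P.toRight := by
  classical
  refine ⟨mem_of_mem_cutsAfter, fun ⟨hxy, hy, hP⟩ => ?_⟩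
  simp only [cutsAfter, Finset.mem_filter, Finset.mem_image]
  exact ⟨⟨_, ⟨hP, rfl⟩, rfl⟩, hxy⟩

theorem pieceStart_nonneg (i : E ⊕ P.toRight) : 0 ≤ (Γ.pieceStart P i).2 := by
  cases i with
  | inl e => exact le_rfl
  | inr q => exact q.1.2.1.le

theorem pieceStart_injective : Function.Injective (Γ.pieceStart P) := by
  rintro (e | q) (e' | q') h
  · exact congrArg Sum.inl (congrArg Prod.fst h)
  · exact absurd (congrArg Prod.snd h) q'.1.2.1.ne
  · exact absurd (congrArg Prod.snd h) q.1.2.1.ne'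
  · exact congrArg Sum.inr (Subtype.ext (Subtype.ext h))

theorem pieceStart_mem_cutsAfter {i : E ⊕ P.toRight} {x : ℝ} (hx : 0 ≤ x)
    (h : x < (Γ.pieceStart P i).2) :
    (Γ.pieceStart P i).2 ∈ Γ.cutsAfter P (Γ.pieceStart P i).1 x := by
  cases i with
  | inl e => exact absurd h hx.not_gt
  | inr q => exact mem_cutsAfter.2 ⟨h, q.1.2, q.2⟩

/-- The last piece of an edge that starts before a given position. -/
theorem exists_last_piece [Finite E] {e : E} {y : ℝ} (hy : 0 < y) :
    ∃ i, (Γ.pieceStart P i).1 = e ∧ (Γ.pieceStart P i).2 < y ∧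
      ∀ z ∈ Γ.cutsAfter P e (Γ.pieceStart P i).2, y ≤ z := by
  let S : Set (E ⊕ P.toRight) := {i | (Γ.pieceStart P i).1 = e ∧ (Γ.pieceStart P i).2 < y}
  obtain ⟨i, ⟨h1, h2⟩, hmax⟩ := exists_max_image S (fun i => (Γ.pieceStart P i).2) (toFinite S)
    ⟨Sum.inl e, rfl, hy⟩
  refine ⟨i, h1, h2, fun z hz => ?_⟩
  obtain ⟨hiz, hz0, hzP⟩ := mem_of_mem_cutsAfter hz
  by_contra! hzy
  exact (hmax (Sum.inr ⟨_, hzP⟩) ⟨rfl, hzy⟩).not_gt hiz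

theorem subdivide_tgt_eq_inl {i : E ⊕ P.toRight} {v : V} :
    (Γ.subdivide P).tgt i = Sum.inl v ↔
      Γ.cutsAfter P (Γ.pieceStart P i).1 (Γ.pieceStart P i).2 = ∅ ∧
        Γ.tgt (Γ.pieceStart P i).1 = v := by
  rw [subdivide]
  dsimp only
  split_ifs with h
  · simp [h.ne_empty]
  · simp [Finset.not_nonempty_iff_eq_empty.1 h]

theorem subdivide_tgt_eq_inr {i : E ⊕ P.toRight} {q : P.toRight} :
    (Γ.subdivide P).tgt i = Sum.inr q ↔ (Γ.pieceStart P i).1 = q.1.1.1 ∧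
      IsLeast (Γ.cutsAfter P (Γ.pieceStart P i).1 (Γ.pieceStart P i).2 : Set ℝ) q.1.1.2 := by
  rw [subdivide]
  dsimp only
  split_ifs with h
  · rw [Sum.inr.injEq]
    constructor
    · rintro rfl
      exact ⟨rfl, Finset.isLeast_min' _ h⟩
    · rintro ⟨h1, h2⟩
      exact Subtype.ext (Subtype.ext (Prod.ext h1 ((Finset.isLeast_min' _ h).unique h2)))
  · exact iff_of_false not_false fun h2 => h ⟨_, h2.2.1⟩

theorem eq_of_pieceStart {i j : E ⊕ P.toRight} (he : (Γ.pieceStart P i).1 = (Γ.pieceStart P j).1)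
    (hij : ¬(Γ.pieceStart P i).2 < (Γ.pieceStart P j).2)
    (hji : ¬(Γ.pieceStart P j).2 < (Γ.pieceStart P i).2) : i = j :=
  pieceStart_injective (Prod.ext he (le_antisymm (not_lt.1 hji) (not_lt.1 hij)))

/-! ### Degrees in the subdivided graph. -/

theorem subdivide_outDeg_inl (v : V) : (Γ.subdivide P).outDeg (Sum.inl v) = Γ.outDeg v := by
  have h : {i | (Γ.subdivide P).src i = Sum.inl v} = Sum.inl '' {e | Γ.src e = v} := by
    ext (e | q)
    · simp [subdivide]
    · simp [subdivide]
  rw [outDeg, h, ncard_image_of_injective _ Sum.inl_injective, outDeg]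

theorem subdivide_outDeg_inr (q : P.toRight) : (Γ.subdivide P).outDeg (Sum.inr q) = 1 := by
  rw [outDeg, ncard_eq_one]
  refine ⟨Sum.inr q, ?_⟩
  ext (e | q')
  · simp [subdivide]
  · simp [subdivide]

/-- Sending a piece to its edge is a bijection from the pieces ending at `v` to the edges ending at
`v`: only the last piece of an edge reaches its end. -/
theorem subdivide_inDeg_inl [Finite E] (v : V) :
    (Γ.subdivide P).inDeg (Sum.inl v) = Γ.inDeg v := by
  have hlast : ∀ {i j : E ⊕ P.toRight}, (Γ.subdivide P).tgt i = Sum.inl v →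
      (Γ.pieceStart P i).1 = (Γ.pieceStart P j).1 →
      ¬(Γ.pieceStart P i).2 < (Γ.pieceStart P j).2 := by
    intro i j hi he hlt
    have h1 := pieceStart_mem_cutsAfter (pieceStart_nonneg i) hlt
    rw [← he, (subdivide_tgt_eq_inl.1 hi).1] at h1
    exact Finset.notMem_empty _ h1
  refine ncard_congr (fun i _ => (Γ.pieceStart P i).1) (fun i hi => (subdivide_tgt_eq_inl.1 hi).2)
    (fun i j hi hj he => eq_of_pieceStart he (hlast hi he) (hlast hj he.symm)) fun e he => ?_
  obtain ⟨i, rfl, -, hi⟩ := exists_last_piece (P := P) (e := e) (Γ.len_pos e)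
  refine ⟨i, subdivide_tgt_eq_inl.2 ⟨Finset.eq_empty_of_forall_notMem fun z hz => ?_, he⟩, rfl⟩
  exact (hi z hz).not_gt (mem_of_mem_cutsAfter hz).2.1.2

/-- The unique piece ending at a cut point is the last one on its edge that starts before it. -/
theorem subdivide_inDeg_inr [Finite E] (q : P.toRight) :
    (Γ.subdivide P).inDeg (Sum.inr q) = 1 := by
  have hlast : ∀ {i j : E ⊕ P.toRight}, (Γ.subdivide P).tgt i = Sum.inr q →
      (Γ.subdivide P).tgt j = Sum.inr q → ¬(Γ.pieceStart P i).2 < (Γ.pieceStart P j).2 := by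
    intro i j hi hj hlt
    rw [subdivide_tgt_eq_inr] at hi hj
    have h1 := pieceStart_mem_cutsAfter (pieceStart_nonneg i) hlt
    rw [hj.1, ← hi.1] at h1
    exact (hi.2.2 h1).not_gt (mem_of_mem_cutsAfter hj.2.1).1
  obtain ⟨i, h1, h2, h3⟩ := exists_last_piece (P := P) (e := q.1.1.1) q.1.2.1
  have hi : (Γ.subdivide P).tgt i = Sum.inr q := by
    rw [subdivide_tgt_eq_inr, h1]
    exact ⟨rfl, mem_cutsAfter.2 ⟨h2, q.1.2, q.2⟩, h3⟩
  rw [inDeg, ncard_eq_one]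
  refine ⟨i, eq_singleton_iff_unique_mem.2 ⟨hi, fun j hj => ?_⟩⟩
  exact eq_of_pieceStart ((subdivide_tgt_eq_inr.1 hj).1.trans h1.symm) (hlast hj hi) (hlast hi hj)

theorem subdivide_deg_inl [Finite E] (v : V) : (Γ.subdivide P).deg (Sum.inl v) = Γ.deg v := by
  rw [deg, subdivide_inDeg_inl, subdivide_outDeg_inl, deg]

theorem WellOriented.subdivide [Finite E] (hΓ : Γ.WellOriented) (P : Finset Γ.Point) :
    (Γ.subdivide P).WellOriented := by
  rintro (v | q) h
  · rw [subdivide_deg_inl] at h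
    rw [subdivide_inDeg_inl, subdivide_outDeg_inl]
    exact hΓ v h
  · exact ⟨subdivide_inDeg_inr q, subdivide_outDeg_inr q⟩

theorem deg_markedVertices [Finite E] {s : OnePoint ℝ} {F : Γ.H2Fun} (hfin : (Γ.sSet s F).Finite)
    {x : V ⊕ hfin.toFinset.toRight} (hx : x ∈ Γ.markedVertices hfin.toFinset) :
    (Γ.subdivide hfin.toFinset).deg x = 1 ∨ (Γ.subdivide hfin.toFinset).deg x = 2 := by
  cases x with
  | inl v =>
    rw [markedVertices, Finset.inl_mem_disjSum, Finset.mem_toLeft, Finite.mem_toFinset] at hx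
    rw [subdivide_deg_inl]
    exact hx.1
  | inr q =>
    right
    rw [deg, subdivide_inDeg_inr, subdivide_outDeg_inr]

theorem card_markedVertices {s : OnePoint ℝ} {F : Γ.H2Fun} (hfin : (Γ.sSet s F).Finite) :
    (Γ.markedVertices hfin.toFinset).card = Γ.sCount s F := by
  rw [markedVertices, Finset.card_disjSum, Finset.card_attach, Finset.card_toLeft_add_card_toRight,
    sCount, ncard_eq_toFinset_card _ hfin]

end MetricGraph

theorem theorem3p5 {V E : Type*} [Finite V] [Fintype E] (Γ : MetricGraph V E)
    (hΓ : Γ.WellOriented) (s : OnePoint ℝ) :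
    (∀ B : Finset V, (∀ v ∈ B, Γ.deg v = 1 ∨ Γ.deg v = 2) →
      ∀ c : ℝ, (c : ℂ) ∉ UnboundedOp.spec (Γ.deltaOp s B OnePoint.infty) →
        UnboundedOp.HasSpectralFlow (Γ.deltaFamily s B) ⊥ ⊤ c B.card) ∧
    (∀ (lam : ℝ) (F : Γ.H2Fun), Γ.IsEigenfunction lam F →
      ∀ hfin : (Γ.sSet s F).Finite, ∀ c : ℝ,
        (c : ℂ) ∉ UnboundedOp.spec ((Γ.subdivide hfin.toFinset).deltaOp s
          (Γ.markedVertices hfin.toFinset) OnePoint.infty) →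
        UnboundedOp.HasSpectralFlow ((Γ.subdivide hfin.toFinset).deltaFamily s
          (Γ.markedVertices hfin.toFinset)) ⊥ ⊤ c (Γ.sCount s F)) := by
  refine ⟨fun B hB c hc => MetricGraph.hasSpectralFlow_deltaFamily hΓ hB hc,
    fun lam F _ hfin c hc => ?_⟩
  -- The `s`-points are now the marked vertices of the subdivided graph, to which the first
  -- statement's argument applies.
  rw [← MetricGraph.card_markedVertices hfin]
  exact MetricGraph.hasSpectralFlow_deltaFamily (hΓ.subdivide _)
    (fun x hx => MetricGraph.deg_markedVertices hfin hx) hc
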